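/- **Setting.** Let $S$, $A$ be finite nonempty sets of states and actions and $H$ the horizon. A principal–agent MDP $M$ consists of an initial law $\mu$ on $S$, a transition kernel $P(\cdot\mid s,a)$, and rewards $r_a(s,a), r_p(s,a)\in[0,1]$ of the agent and the principal. The step $h$ of an episode is regarded as part of the state: a policy is a family $\pi_h(\cdot\mid s)$ of laws on $A$, and a transfer policy a family $\tau_h(s,\cdot)\in\mathbb R_+^{A}$. For a policy $\pi$ and transfers $\tau$, $V_a^{\pi,\tau}$ and $V_p^{\pi,\tau}$ are the expected total rewards in an episode of $H$ steps for the rewards $r_a+\tau$ and $r_p-\tau$; welfare is $W(\pi,\tau)=V_a^{\pi,\tau}+V_p^{\pi,\tau}$, and $W^\star=\max_\pi W(\pi,\tau)$, which does not depend on $\tau$. In each episode $k$ the principal announces a transfer policy $\tau_k$, computed from the preceding episodes and her own rewards in them (she does not know $\mu$, $P$, $r_a$, $r_p$); the agent then plays a policy $\pi_k$ that may depend on the past, on the announced transfers and on private randomness. The welfare regret is $R_{\mathrm{sw}}(T)=TW^\star-\sum_{k=1}^T W(\pi_k,\tau_k)$. The agent has *episodic regret exponent* $\kappa$ with constants $C,\zeta>0$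 if for every $T\ge1$ and every (possibly adaptive) sequence of transfer policies, with probability at least $1-T^{-\zeta}$, $$\sum_{k=1}^T\Bigl(\max_{\pi}V_a^{\pi,\tau_k}-V_a^{\pi_k,\tau_k}\Bigr)\le C\,T^\kappa .$$ $M$ is *uniformly ergodic* if there is $c>0$ such that whenever a state $s$ can be reached at step $h$ by some policy, every policy is in $s$ at step $h$ with probability at least $c$ (so that in a batch of $L$ episodes each such state is visited of the order of $L$ times). The minimal transfers are $\tau^\star_{h,s}(a)=\max_{a'}\bigl(Q_h(s,a')-Q_h(s,a)\bigr)_+$, where $Q$ is the agent's optimal state–action value function without transfers. A reinforcement learning algorithm (naming a deterministic policy for each episode) has *regret exponent* $\gamma$ if on every MDP with these $S,A,H$ and every reward function its regret in $T$ episodes is $O(T^\gamma\operatorname{polylog}T)$ with probability $1-O(T^{-\zeta_0})$ for some $\zeta_0>0$ (the constants may depend on the MDP and the rewards). **The two-phase algorithm** for $T$ episodes, with a reinforcement learning algorithm $\mathcal B$ and a constant $b\ge0$. *Phase 1.* For the triples $(h,s,a)$ one after another, bisect $[0,H]$ down to a length of at most $T^{-\beta}/2$: in each round the midpoint of the current interval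 is offered for action $a$ in state $s$ at step $h$, and nothing else, during a batch of $\lceil T^\alpha\rceil$ episodes; the lower half is kept if the agent chose $a$ in at least half of the visits to $s$ at step $h$, and the upper half otherwise. The estimate $\hat\tau_{h,s}(a)$ is the upper end of the final interval. *Phase 2.* In the remaining episodes run $\mathcal B$ with the observed rewards shifted to $r_p(s,a)-\hat\tau_{h,s}(a)$; to implement the action $a$ that $\mathcal B$ names for $(h,s)$, offer $\hat\tau_{h,s}(a)+b$ for $a$ and $0$ for all other actions. **Theorem (Social efficiency in principal–agent MDPs).** Let $0\le\kappa<\alpha<1$, $0<\beta<1$, $\beta/\alpha<1-\kappa$ and $0\le\gamma<1$. There are a reinforcement learning algorithm $\mathcal B$ with regret exponent $\gamma$ and a constant $b\ge 0$ such that the two-phase algorithm has the following property. For every uniformly ergodic principal–agent MDP with state space $S$, action space $A$ and horizon $H$, and all $C,\zeta>0$, there are $K$, $\zeta'>0$ and $p\in\mathbb N$ such that for every agent with episodic regret exponent $\kappa$ with constants $C,\zeta$: 1. for every $T\ge2$, with probability at least $1-K\,T^{-\zeta'}$, both $|\hat\tau_{h,s}(a)-\tau^\star_{h,s}(a)|\le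 T^{-\beta}$ for all $a$ and all $(h,s)$ with $s$ reachable at step $h$, and $$R_{\mathrm{sw}}(T)\le K\bigl(T^\alpha+T^\gamma+T^\kappa\bigr)(\log T)^p ;$$ 2. $R_{\mathrm{sw}}(T)=o(T)$ in probability: for every $\varepsilon>0$, $\Pr\bigl(|R_{\mathrm{sw}}(T)|\le\varepsilon T\bigr)\to1$ as $T\to\infty$. -/

import Mathlib

open Filter Topology MeasureTheory
open scoped NNReal ENNReal

/-- An episode: the list of the state-action pairs of its steps. -/
abbrev Episode (S A : Type*) := List (S × A)

/-- An episode as seen by a learner who also observes a reward at each step. -/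
abbrev ObsEpisode (S A : Type*) := List (S × A × ℝ)

/-- A (Markov, possibly randomized) policy. The step `h = 0, 1, …` of the episode counts as part
of the state, as is usual with a finite horizon `H`; only the steps `h < H` matter. -/
abbrev Policy (S A : Type*) := ℕ → S → PMF A

/-- A transfer policy: a nonnegative payment for every action at every step and state. -/
abbrev Transfer (S A : Type*) := ℕ → S → A → ℝ≥0

/-- The dynamics of a finite-horizon decision process: initial law and transition kernel. -/
structure Dynamics (S A : Type*) where
  init : PMF S
  trans : S → A → PMF S

namespace Dynamics

variable {S A : Type*} (D : Dynamics S A)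

/-- Law of the remaining `n` steps of an episode that is in state `s` at step `h`. -/
noncomputable def episodeFrom (π : Policy S A) : ℕ → ℕ → S → PMF (Episode S A)
  | 0, _, _ => PMF.pure []
  | n + 1, h, s => (π h s).bind fun a => (D.trans s a).bind fun s' =>
      (episodeFrom π n (h + 1) s').map fun e => (s, a) :: e

/-- Law of an episode of `H` steps under the policy `π`. -/
noncomputable def episodeLaw (H : ℕ) (π : Policy S A) : PMF (Episode S A) :=
  D.init.bind fun s => D.episodeFrom π H 0 s

/-- Law of the state at step `h` under the policy `π`. -/
noncomputable def stateLaw (π : Policy S A) : ℕ → PMF S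
  | 0 => D.init
  | h + 1 => (stateLaw π h).bind fun s => (π h s).bind fun a => D.trans s a

/-- State `s` can be reached at step `h` by some policy. -/
def Reachable (h : ℕ) (s : S) : Prop := ∃ π : Policy S A, D.stateLaw π h s ≠ 0

/-- Law of the first `k` episodes (in chronological order) when the policy of each episode is
`play hist`, a function of the list `hist` of the preceding episodes. -/
noncomputable def runLaw (H : ℕ) (play : List (Episode S A) → Policy S A) :
    ℕ → PMF (List (Episode S A))
  | 0 => PMF.pure []
  | k + 1 => (runLaw H play k).bind fun hist =>
      (D.episodeLaw H (play hist)).map fun e => hist ++ [e]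

/-- Uniform ergodicity: the probability that an episode visits a (reachable) state is bounded
below uniformly over all policies, so that in a batch of `L` episodes each such state is visited
of the order of `L` times, whatever the agent does. -/
def UniformlyErgodic (H : ℕ) : Prop :=
  ∃ c : ℝ≥0∞, 0 < c ∧ ∀ h < H, ∀ s, D.Reachable h s → ∀ π : Policy S A, c ≤ D.stateLaw π h s

variable [Fintype S] [Fintype A]

/-- Expected reward collected by `π` in the remaining `n` steps, from state `s` at step `h`. -/
noncomputable def valueFrom (r : ℕ → S → A → ℝ) (π : Policy S A) : ℕ → ℕ → S → ℝ
  | 0, _, _ => 0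
  | n + 1, h, s => ∑ a, (π h s a).toReal *
      (r h s a + ∑ s', (D.trans s a s').toReal * valueFrom r π n (h + 1) s')

/-- Expected total reward of an episode of `H` steps. -/
noncomputable def value (H : ℕ) (r : ℕ → S → A → ℝ) (π : Policy S A) : ℝ :=
  ∑ s, (D.init s).toReal * D.valueFrom r π H 0 s

/-- The largest expected total reward over all policies. -/
noncomputable def optValue (H : ℕ) (r : ℕ → S → A → ℝ) : ℝ :=
  ⨆ π : Policy S A, D.value H r π

/-- Optimal state-action value function, with `n` steps to go at step `h`. -/
noncomputable def optQ (r : ℕ → S → A → ℝ) : ℕ → ℕ → S → A → ℝ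
  | 0, _, _, _ => 0
  | n + 1, h, s, a =>
      r h s a + ∑ s', (D.trans s a s').toReal * ⨆ a', optQ r n (h + 1) s' a'

end Dynamics

/-- A principal-agent decision process, with the rewards of the agent and of the principal. -/
structure PrincipalAgentMDP (S A : Type*) extends Dynamics S A where
  rA : S → A → ℝ
  rP : S → A → ℝ
  rA_mem : ∀ s a, rA s a ∈ Set.Icc (0 : ℝ) 1
  rP_mem : ∀ s a, rP s a ∈ Set.Icc (0 : ℝ) 1

/-- An algorithm of the principal: from the preceding episodes, with her rewards, it computes the
transfer policy of the next episode. -/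
abbrev PrincipalAlg (S A : Type*) := List (ObsEpisode S A) → Transfer S A

/-- A learning agent. He may use a private random seed. `act ξ hist taus` is his policy in the
next episode, where `hist` lists the preceding episodes and `taus` the transfer policies
up to and including that of the next episode. -/
structure Agent (S A : Type*) where
  Seed : Type
  seedSpace : MeasurableSpace Seed
  law : Measure Seed
  isProb : IsProbabilityMeasure law
  act : Seed → List (Episode S A) → List (Transfer S A) → Policy S A
  measurable_act : ∀ hist taus h s a, Measurable fun ξ => act ξ hist taus h s a

attribute [instance] Agent.seedSpace Agent.isProb

namespace PrincipalAgentMDP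

variable {S A : Type*} (M : PrincipalAgentMDP S A)

/-- Agent's reward under transfers. -/
def agentReward (τ : Transfer S A) : ℕ → S → A → ℝ := fun h s a => M.rA s a + τ h s a

/-- Principal's reward under transfers. -/
def principalReward (τ : Transfer S A) : ℕ → S → A → ℝ := fun h s a => M.rP s a - τ h s a

/-- What the principal sees of an episode. -/
def observe (e : Episode S A) : ObsEpisode S A := e.map fun x => (x.1, x.2, M.rP x.1 x.2)

/-- Transfer policy offered after the episodes `hist`. -/
def offer (alg : PrincipalAlg S A) (hist : List (Episode S A)) : Transfer S A :=
  alg (hist.map M.observe)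

/-- The agent's policy after the episodes `hist`, in answer to the principal's algorithm. -/
noncomputable def agentPolicy (alg : PrincipalAlg S A) (G : Agent S A) (ξ : G.Seed)
    (hist : List (Episode S A)) : Policy S A :=
  G.act ξ hist ((List.range (hist.length + 1)).map fun j => M.offer alg (hist.take j))

/-- Probability of an event that concerns the agent's seed and the first `T` episodes. -/
noncomputable def prob (H : ℕ) (alg : PrincipalAlg S A) (G : Agent S A) (T : ℕ)
    (E : G.Seed → List (Episode S A) → Prop) : ℝ≥0∞ :=
  ∫⁻ ξ, (M.runLaw H (M.agentPolicy alg G ξ) T).toOuterMeasure {hist | E ξ hist} ∂G.law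

variable [Fintype S] [Fintype A]

/-- Welfare: sum of the two players' values. -/
noncomputable def welfare (H : ℕ) (π : Policy S A) (τ : Transfer S A) : ℝ :=
  M.value H (M.agentReward τ) π + M.value H (M.principalReward τ) π

/-- Optimal welfare (it does not depend on the transfers). -/
noncomputable def optWelfare (H : ℕ) : ℝ := ⨆ π : Policy S A, M.welfare H π 0

/-- Regret of the agent over the first `T` episodes: in each episode his policy is compared with a
policy that is optimal for him under the transfers offered in that episode. -/
noncomputable def agentRegret (H : ℕ) (alg : PrincipalAlg S A) (G : Agent S A) (T : ℕ)
    (ξ : G.Seed) (hist : List (Episode S A)) : ℝ :=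
  ∑ k ∈ Finset.range T,
    (M.optValue H (M.agentReward (M.offer alg (hist.take k))) -
      M.value H (M.agentReward (M.offer alg (hist.take k))) (M.agentPolicy alg G ξ (hist.take k)))

/-- Social-welfare regret over the first `T` episodes. -/
noncomputable def welfareRegret (H : ℕ) (alg : PrincipalAlg S A) (G : Agent S A) (T : ℕ)
    (ξ : G.Seed) (hist : List (Episode S A)) : ℝ :=
  T * M.optWelfare H - ∑ k ∈ Finset.range T,
    M.welfare H (M.agentPolicy alg G ξ (hist.take k)) (M.offer alg (hist.take k))

/-- The agent has episodic regret exponent `κ` with constants `C`, `ζ`, for every number of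
episodes and every (possibly adaptive) sequence of transfer policies. -/
def HasAgentRegret (H : ℕ) (κ C ζ : ℝ) (G : Agent S A) : Prop :=
  ∀ alg : PrincipalAlg S A, ∀ T : ℕ, 1 ≤ T →
    ENNReal.ofReal (1 - (T : ℝ) ^ (-ζ)) ≤
      M.prob H alg G T fun ξ hist => M.agentRegret H alg G T ξ hist ≤ C * (T : ℝ) ^ κ

/-- The minimal transfer for action `a` in state `s` at step `h`. -/
noncomputable def minTransfer (H h : ℕ) (s : S) (a : A) : ℝ :=
  ⨆ a', max (M.optQ (M.agentReward 0) (H - h) h s a' - M.optQ (M.agentReward 0) (H - h) h s a) 0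

end PrincipalAgentMDP

/-- A reinforcement learning algorithm: given the number of episodes and the preceding episodes
with their rewards, it names a deterministic policy for the next episode. -/
abbrev RLAlg (S A : Type*) := ℕ → List (ObsEpisode S A) → ℕ → S → A

namespace RLAlg

variable {S A : Type*}

/-- The policy played by the algorithm itself on a decision process with rewards `r`. -/
noncomputable def play (B : RLAlg S A) (r : ℕ → S → A → ℝ) (T : ℕ) (hist : List (Episode S A)) :
    Policy S A := fun h s =>
  PMF.pure (B T (hist.map fun e => e.mapIdx fun i x => (x.1, x.2, r i x.1 x.2)) h s)

/-- Regret exponent `γ`: on every decision process with `H` steps and any rewards, the regret in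
`T` episodes is `O(T ^ γ polylog T)` with high probability. -/
def HasRegretExponent [Fintype S] [Fintype A] (B : RLAlg S A) (H : ℕ) (γ : ℝ) : Prop :=
  ∀ (D : Dynamics S A) (r : ℕ → S → A → ℝ), ∃ (C ζ : ℝ) (p : ℕ), 0 < ζ ∧ ∀ T : ℕ, 2 ≤ T →
    ENNReal.ofReal (1 - C * (T : ℝ) ^ (-ζ)) ≤
      (D.runLaw H (B.play r T) T).toOuterMeasure {hist |
        ∑ k ∈ Finset.range T, (D.optValue H r - D.value H r (B.play r T (hist.take k)))
          ≤ C * (T : ℝ) ^ γ * Real.log T ^ p}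

end RLAlg

namespace TwoPhase

variable {S A : Type*} [DecidableEq S] [DecidableEq A]

/-- Number of episodes of a list in which the state at step `h` is `s`. -/
def visits (b : List (ObsEpisode S A)) (h : ℕ) (s : S) : ℕ :=
  b.countP fun e => decide (e[h]?.map (fun x => x.1) = some s)

/-- Number of episodes of a list in which, at step `h`, action `a` is taken in state `s`. -/
def plays (b : List (ObsEpisode S A)) (h : ℕ) (s : S) (a : A) : ℕ :=
  b.countP fun e => decide (e[h]?.map (fun x => (x.1, x.2.1)) = some (s, a))

/-- Length of a batch: `T ^ α` episodes, rounded up. -/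
noncomputable def batchLen (α : ℝ) (T : ℕ) : ℕ := ⌈(T : ℝ) ^ α⌉₊

/-- Number of bisections of `[0, H]` that lead to a length of at most `T ^ (-β) / 2`. -/
noncomputable def rounds (H : ℕ) (β : ℝ) (T : ℕ) : ℕ := ⌈Real.logb 2 (2 * H * (T : ℝ) ^ β)⌉₊

/-- The `i`-th batch of a list of episodes. -/
def batch (L i : ℕ) (hist : List (ObsEpisode S A)) : List (ObsEpisode S A) :=
  (hist.drop (i * L)).take L

variable [Fintype S] [Fintype A]

/-- The searches for the minimal transfers of the triples `(h, s, a)` are done one after another;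
this is the position of the search for `q` in that order. -/
noncomputable def searchIndex (H : ℕ) (q : Fin H × S × A) : ℕ := (Fintype.equivFin _ q).val

/-- Search interval for `q = (h, s, a)` after a number of rounds (batches of length `L`, `n` of
them for each search). The midpoint has been offered during the batch of the round; the lower half
is kept if `a` was chosen in at least half of the visits to `s` at step `h`. -/
noncomputable def interval (H L n : ℕ) (hist : List (ObsEpisode S A)) (q : Fin H × S × A) :
    ℕ → ℝ≥0 × ℝ≥0
  | 0 => (0, H)
  | j + 1 =>
      let I := interval H L n hist q j
      let b := batch L (searchIndex H q * n + j) hist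
      if visits b q.1 q.2.1 ≤ 2 * plays b q.1 q.2.1 q.2.2 then (I.1, (I.1 + I.2) / 2)
      else ((I.1 + I.2) / 2, I.2)

/-- Transfers of the `i`-th batch: the midpoint of the current interval for the triple under
search, and nothing else. -/
noncomputable def searchTransfer (H L n : ℕ) (hist : List (ObsEpisode S A)) (i : ℕ) :
    Transfer S A := fun h s a =>
  if hh : h < H then
    if searchIndex H (⟨h, hh⟩, s, a) = i / n then
      ((interval H L n hist (⟨h, hh⟩, s, a) (i % n)).1 +
        (interval H L n hist (⟨h, hh⟩, s, a) (i % n)).2) / 2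
    else 0
  else 0

/-- Estimates of the minimal transfers: upper ends of the final intervals. -/
noncomputable def estimate (H L n : ℕ) (hist : List (ObsEpisode S A)) : Transfer S A :=
  fun h s a => if hh : h < H then (interval H L n hist (⟨h, hh⟩, s, a) n).2 else 0

/-- Number of episodes of the first phase. -/
noncomputable def phaseOneLen (S A : Type*) [Fintype S] [Fintype A] (H : ℕ) (α β : ℝ) (T : ℕ) : ℕ :=
  Fintype.card (Fin H × S × A) * rounds H β T * batchLen α T

/-- The principal's two-phase algorithm for `T` episodes. In the first phase, batched binary search
for the minimal transfers. In the second phase, the learning algorithm `B` is run with the rewards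
of the principal shifted by the estimates; the action that `B` names for a state is implemented by
offering its estimated minimal transfer plus a constant `slack`, and nothing for other actions. -/
noncomputable def alg (B : RLAlg S A) (slack : ℝ≥0) (H : ℕ) (α β : ℝ) (T : ℕ) :
    PrincipalAlg S A := fun hist =>
  let L := batchLen α T
  let n := rounds H β T
  let N := phaseOneLen S A H α β T
  if hist.length < N then searchTransfer H L n hist (hist.length / L)
  else
    let est := estimate H L n hist
    let shifted := (hist.drop N).map fun e =>
      e.mapIdx fun h x => (x.1, x.2.1, x.2.2 - (est h x.1 x.2.1 : ℝ))
    fun h s a => if a = B (T - N) shifted h s then est h s a + slack else 0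

end TwoPhase

/-! The slack in the second phase may be any constant and the learner may be chosen, so the proof
takes slack `1` and an explore-then-commit learner over the finitely many deterministic plans, which
restarts its exploration whenever an episode departs from the named plan. The constants may depend
on the MDP, hence on the gap between the best and the second best plan; exploring each plan about
`log² T` times then identifies an optimal plan exactly, up to an error probability of order `1/T`.
This gives polylogarithmic regret and thus every exponent `γ ≥ 0`
(`RobustExplore.hasRegretExponent_alg`).

Binary search. An offer `x` for one triple `(h,s,a)` only raises the agent's value of `a` at `(h,s)`
by `x`. If `x` is at distance at least `δ` from the minimal transfer, each wrong choice at `(h,s)`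
therefore costs the agent `δ` (`agentGap_of_high`, `agentGap_of_low`), and his regret bounds the
expected number of wrong choices by `C N ^ κ / δ`, with `N` of order at most `T ^ α log T` and `δ =
T ^ (-β) / 2`. The condition `β / α < 1 - κ` makes this small compared with the batch length `T ^
α`, while ergodicity yields visits of the order of `T ^ α`; so the majority decides correctly
(`TwoPhase.round_correct`). An offer closer than `δ` may be decided either way, at the price of an
error `δ` (`TwoPhase.interval_accurate`).

Learning. Paying the minimal transfers makes the agent indifferent, and by potential shaping the
principal's value net of these transfers is the welfare minus a constant
(`exists_value_sub_minTransfer_eq`). Hence a plan that is best for the shifted rewards is best for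
welfare, also with slightly wrong estimates because of the gap. The slack turns indifference into a
strict preference: each deviation from the plan costs the agent at least `1/2`
(`deviation_le_agentGap`), so that his regret allows only `O(T ^ κ)` expected deviations. Each
deviation costs `O(1)` welfare directly and at most one more exploration of polylogarithmic length
(`pathSum_explore_le`). Once the exploration is completed the implemented plan is optimal, and only
deviations cost welfare (`TwoPhase.welfareRegret_le`).

Two probabilistic facts carry this. Counts along the run obey multiplicative tail bounds, proved by
exponential supermartingales (`runLaw_count_ge`, `runLaw_count_le`). And the scores of the plans
stay unbiased enough although the agent may choose when to deviate: on episodes that follow the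
plan, the law is dominated by the plan's own law (`expect_episodeFrom_follows_le`), and a restart
resets the exponential process to `1` (`expect_exp_score_le`). -/

/-! ### Expectations in `ℝ≥0∞` under discrete laws -/

section Expectation

variable {α β : Type*}

/-- Expectation of a nonnegative function under a discrete law. -/
noncomputable def PMF.expect (p : PMF α) (f : α → ℝ≥0∞) : ℝ≥0∞ := ∑' a, p a * f a

namespace PMF

theorem expect_pure (a : α) (f : α → ℝ≥0∞) : (PMF.pure a).expect f = f a := by
  classical
  rw [expect, tsum_eq_single a]
  · simp
  · intro b hb
    simp [PMF.pure_apply, hb]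

theorem expect_bind (p : PMF α) (q : α → PMF β) (f : β → ℝ≥0∞) :
    (p.bind q).expect f = p.expect fun a => (q a).expect f := by
  simp only [expect, PMF.bind_apply, ← ENNReal.tsum_mul_right, ← ENNReal.tsum_mul_left]
  rw [ENNReal.tsum_comm]
  simp only [mul_assoc]

theorem expect_map (p : PMF α) (g : α → β) (f : β → ℝ≥0∞) :
    (p.map g).expect f = p.expect fun a => f (g a) := by
  rw [← PMF.bind_pure_comp, expect_bind]
  simp [expect_pure]

theorem expect_mono_support (p : PMF α) {f g : α → ℝ≥0∞} (h : ∀ a, p a ≠ 0 → f a ≤ g a) :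
    p.expect f ≤ p.expect g := by
  refine ENNReal.tsum_le_tsum fun a => ?_
  by_cases ha : p a = 0
  · simp [ha]
  · gcongr
    exact h a ha

theorem expect_mono (p : PMF α) {f g : α → ℝ≥0∞} (h : ∀ a, f a ≤ g a) :
    p.expect f ≤ p.expect g := p.expect_mono_support fun a _ => h a

theorem expect_congr_support (p : PMF α) {f g : α → ℝ≥0∞} (h : ∀ a, p a ≠ 0 → f a = g a) :
    p.expect f = p.expect g :=
  le_antisymm (p.expect_mono_support fun a ha => (h a ha).le)
    (p.expect_mono_support fun a ha => (h a ha).ge)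

theorem expect_add (p : PMF α) (f g : α → ℝ≥0∞) :
    p.expect (fun a => f a + g a) = p.expect f + p.expect g := by
  simp [expect, mul_add, ENNReal.tsum_add]

theorem expect_const_mul (p : PMF α) (c : ℝ≥0∞) (f : α → ℝ≥0∞) :
    p.expect (fun a => c * f a) = c * p.expect f := by
  simp only [expect, ← ENNReal.tsum_mul_left]
  exact tsum_congr fun a => by ring

theorem expect_const (p : PMF α) (c : ℝ≥0∞) : p.expect (fun _ => c) = c := by
  simp [expect, ENNReal.tsum_mul_right, p.tsum_coe]

theorem expect_sum {ι : Type*} (p : PMF α) (s : Finset ι) (f : ι → α → ℝ≥0∞) :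
    p.expect (fun a => ∑ i ∈ s, f i a) = ∑ i ∈ s, p.expect (f i) := by
  classical
  induction s using Finset.induction_on with
  | empty => simp [expect]
  | insert i s hi ih => simp only [Finset.sum_insert hi, expect_add, ih]

theorem toOuterMeasure_eq_expect (p : PMF α) (s : Set α) :
    p.toOuterMeasure s = p.expect (s.indicator 1) := by
  rw [PMF.toOuterMeasure_apply]
  refine tsum_congr fun a => ?_
  by_cases h : a ∈ s <;> simp [h]

theorem toOuterMeasure_le_one (p : PMF α) (s : Set α) : p.toOuterMeasure s ≤ 1 := by
  rw [toOuterMeasure_eq_expect, ← p.expect_const 1]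
  exact p.expect_mono fun a => Set.indicator_le_self' (by simp) a

theorem expect_eq_sum [Fintype α] (p : PMF α) (f : α → ℝ≥0∞) :
    p.expect f = ∑ a, p a * f a := tsum_fintype _

/-- Markov's inequality in exponential form. -/
theorem toOuterMeasure_le_of_expect_exp (p : PMF α) (X : α → ℝ) (s : Set α) (K : ℝ≥0∞) (l : ℝ)
    (hE : p.expect (fun a => ENNReal.ofReal (Real.exp (X a))) ≤ K) (hs : ∀ a ∈ s, l ≤ X a) :
    p.toOuterMeasure s ≤ K * ENNReal.ofReal (Real.exp (-l)) := by
  rw [toOuterMeasure_eq_expect]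
  calc p.expect (s.indicator 1)
      ≤ p.expect (fun a => ENNReal.ofReal (Real.exp (-l)) * ENNReal.ofReal (Real.exp (X a))) := by
        refine p.expect_mono fun a => ?_
        by_cases h : a ∈ s
        · rw [Set.indicator_of_mem h, ← ENNReal.ofReal_mul (Real.exp_pos _).le, ← Real.exp_add]
          simpa using hs a h
        · simp [h]
    _ ≤ K * ENNReal.ofReal (Real.exp (-l)) := by
        rw [expect_const_mul, mul_comm]
        gcongr

/-- If two events can hold together only inside a third one or one of finitely many exceptional
ones, then their probabilities satisfy the corresponding inequality. -/
theorem add_toOuterMeasure_le (p : PMF α) {ι : Type*} (I : Finset ι) (s t g : Set α)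
    (bad : ι → Set α)
    (h : ∀ a, p a ≠ 0 → a ∈ s → a ∈ t → (∀ i ∈ I, a ∉ bad i) → a ∈ g) :
    p.toOuterMeasure s + p.toOuterMeasure t ≤
      p.toOuterMeasure g + (1 + ∑ i ∈ I, p.toOuterMeasure (bad i)) := by
  simp only [toOuterMeasure_eq_expect]
  rw [← p.expect_const 1, ← expect_sum, ← expect_add, ← expect_add, ← expect_add]
  refine p.expect_mono_support fun a ha => ?_
  have hle : ∀ u : Set α, u.indicator (1 : α → ℝ≥0∞) a ≤ 1 :=
    fun u => Set.indicator_le_self' (by simp) a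
  by_cases hg : a ∈ g
  · rw [Set.indicator_of_mem hg]
    exact add_le_add (hle s) ((hle t).trans le_self_add)
  by_cases hs : a ∈ s
  · by_cases ht : a ∈ t
    · have : ∃ i ∈ I, a ∈ bad i := by
        by_contra! hc
        exact hg (h a ha hs ht hc)
      obtain ⟨i, hi, hb⟩ := this
      have h1 : (1 : ℝ≥0∞) ≤ ∑ i ∈ I, (bad i).indicator (1 : α → ℝ≥0∞) a := by
        refine le_trans ?_ (Finset.single_le_sum (f := fun i => (bad i).indicator
          (1 : α → ℝ≥0∞) a) (fun _ _ => zero_le) hi)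
        simp [hb]
      calc _ ≤ (1 : ℝ≥0∞) + 1 := add_le_add (hle s) (hle t)
        _ ≤ 1 + ∑ i ∈ I, (bad i).indicator (1 : α → ℝ≥0∞) a := by gcongr
        _ ≤ _ := le_add_self
    · rw [Set.indicator_of_notMem ht, add_zero]
      exact (hle s).trans (le_self_add.trans le_add_self)
  · rw [Set.indicator_of_notMem hs, zero_add]
    exact (hle t).trans (le_self_add.trans le_add_self)

end PMF

end Expectation

/-! ### Indicators, and sums along a history -/

open Classical in
/-- Indicator of a proposition. -/
noncomputable def ind (P : Prop) : ℝ := if P then 1 else 0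

theorem ind_of_true {P : Prop} (h : P) : ind P = 1 := if_pos h

theorem ind_of_false {P : Prop} (h : ¬ P) : ind P = 0 := if_neg h

theorem ind_nonneg (P : Prop) : 0 ≤ ind P := by
  unfold ind
  split_ifs <;> norm_num

section PathSum

variable {E : Type*}

/-- Sum along a list of a function of the preceding entries and the current one. -/
noncomputable def pathSum (f : List E → E → ℝ) (l : List E) : ℝ :=
  ∑ k : Fin l.length, f (l.take k) l[k]

theorem pathSum_nil (f : List E → E → ℝ) : pathSum f [] = 0 := by simp [pathSum]

theorem pathSum_concat (f : List E → E → ℝ) (l : List E) (e : E) :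
    pathSum f (l ++ [e]) = pathSum f l + f l e := by
  have hl : l.length + 1 = (l ++ [e]).length := by simp
  unfold pathSum
  rw [← Fin.sum_congr' (fun k : Fin (l ++ [e]).length => f ((l ++ [e]).take k) (l ++ [e])[k]) hl,
    Fin.sum_univ_castSucc]
  congr 1
  · refine Finset.sum_congr rfl fun k _ => ?_
    have hk : (k : ℕ) < l.length := k.2
    simp [List.take_append_of_le_length hk.le, List.getElem_append_left hk]
  · simp

theorem pathSum_mono {f g : List E → E → ℝ} {l : List E}
    (h : ∀ k (hk : k < l.length), f (l.take k) l[k] ≤ g (l.take k) l[k]) :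
    pathSum f l ≤ pathSum g l :=
  Finset.sum_le_sum fun k _ => h k k.2

theorem pathSum_add (f g : List E → E → ℝ) (l : List E) :
    pathSum (fun p e => f p e + g p e) l = pathSum f l + pathSum g l := by
  simp [pathSum, Finset.sum_add_distrib]

theorem pathSum_const_mul (c : ℝ) (f : List E → E → ℝ) (l : List E) :
    pathSum (fun p e => c * f p e) l = c * pathSum f l := by
  simp [pathSum, Finset.mul_sum]

theorem pathSum_eq_sum_range (f : List E → ℝ) (l : List E) :
    pathSum (fun p _ => f p) l = ∑ k ∈ Finset.range l.length, f (l.take k) := by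
  rw [pathSum, Fin.sum_univ_eq_sum_range fun k => f (l.take k)]

theorem pathSum_window_const (c : ℝ) (a L : ℕ) (l : List E) (hl : a + L ≤ l.length) :
    pathSum (fun p _ => ind (a ≤ p.length ∧ p.length < a + L) * c) l = L * c := by
  rw [pathSum_eq_sum_range fun p : List E => ind (a ≤ p.length ∧ p.length < a + L) * c]
  have : ∀ k ∈ Finset.range l.length,
      ind (a ≤ (l.take k).length ∧ (l.take k).length < a + L) * c
        = if k ∈ Finset.Ico a (a + L) then c else 0 := by
    intro k hk
    have : (l.take k).length = k := by simp; exact (Finset.mem_range.1 hk).le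
    simp only [this, Finset.mem_Ico, ind, ite_mul, one_mul, zero_mul]
  rw [Finset.sum_congr rfl this, ← Finset.sum_filter, Finset.sum_const]
  have : (Finset.range l.length).filter (fun k => k ∈ Finset.Ico a (a + L))
      = Finset.Ico a (a + L) := by
    ext k
    simp
    omega
  rw [this]
  simp

/-- Brings the counts on which the principal bases her decisions into the form to which the tail
bounds along a run apply. -/
theorem countP_window_eq_pathSum (P : E → Bool) (a L : ℕ) (l : List E) :
    (((l.drop a).take L).countP P : ℝ) =
      pathSum (fun p e => ind ((a ≤ p.length ∧ p.length < a + L) ∧ P e = true)) l := by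
  induction l using List.reverseRecOn with
  | nil => simp [pathSum_nil]
  | append_singleton l e ih =>
    rw [pathSum_concat, ← ih]
    by_cases h1 : a ≤ l.length
    · rw [List.drop_append_of_le_length h1]
      by_cases h2 : l.length < a + L
      · rw [List.take_append, List.take_of_length_le (l := [e]) (by simp; omega)]
        by_cases hP : P e = true <;> simp [h1, h2, hP, ind]
      · rw [List.take_append_of_le_length (by simp; omega)]
        simp [h2, ind]
    · have : (l ++ [e]).drop a = [] := by simp; omega
      have h' : l.drop a = [] := by simp; omega
      simp [this, h', h1, ind]

end PathSum

/-! ### The law of a run, and exponential tail bounds for counts -/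

namespace Dynamics

variable {S A : Type*} (D : Dynamics S A) (H : ℕ) (play : List (Episode S A) → Policy S A)

theorem length_of_runLaw_ne_zero (T : ℕ) (hist : List (Episode S A))
    (h : D.runLaw H play T hist ≠ 0) : hist.length = T := by
  induction T generalizing hist with
  | zero =>
    have : hist ∈ (PMF.pure ([] : List (Episode S A))).support := h
    simpa using this
  | succ k ih =>
    have : hist ∈ (D.runLaw H play (k + 1)).support := h
    simp only [runLaw, PMF.mem_support_bind_iff, PMF.mem_support_map_iff] at this
    obtain ⟨l, hl, e, -, rfl⟩ := this
    simp [ih l hl]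

theorem length_of_episodeFrom_ne_zero (π : Policy S A) (n h : ℕ) (s : S) (e : Episode S A)
    (he : D.episodeFrom π n h s e ≠ 0) : e.length = n := by
  induction n generalizing h s e with
  | zero =>
    have : e ∈ (PMF.pure ([] : Episode S A)).support := he
    simpa using this
  | succ k ih =>
    have : e ∈ (D.episodeFrom π (k + 1) h s).support := he
    simp only [episodeFrom, PMF.mem_support_bind_iff, PMF.mem_support_map_iff] at this
    obtain ⟨a, -, s', -, e', he', rfl⟩ := this
    simp [ih _ _ _ he']

theorem length_of_episodeLaw_ne_zero (π : Policy S A) (e : Episode S A)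
    (he : D.episodeLaw H π e ≠ 0) : e.length = H := by
  have : e ∈ (D.episodeLaw H π).support := he
  simp only [episodeLaw, PMF.mem_support_bind_iff] at this
  obtain ⟨s, -, hs⟩ := this
  exact D.length_of_episodeFrom_ne_zero _ _ _ _ _ hs

theorem expect_runLaw_succ (T : ℕ) (F : List (Episode S A) → ℝ≥0∞) :
    (D.runLaw H play (T + 1)).expect F = (D.runLaw H play T).expect fun hist =>
      (D.episodeLaw H (play hist)).expect fun e => F (hist ++ [e]) := by
  simp only [runLaw, PMF.expect_bind, PMF.expect_map]

/-- A function of the history whose conditional expectation grows by at most `c` in each episode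
grows by at most `T * c` in expectation. -/
theorem expect_runLaw_le (F : List (Episode S A) → ℝ≥0∞) (c : ℝ≥0∞)
    (hF : ∀ hist, (D.episodeLaw H (play hist)).expect (fun e => F (hist ++ [e])) ≤ F hist + c)
    (T : ℕ) : (D.runLaw H play T).expect F ≤ F [] + T * c := by
  induction T with
  | zero => simp [runLaw, PMF.expect_pure]
  | succ T ih =>
    rw [expect_runLaw_succ]
    calc _ ≤ (D.runLaw H play T).expect fun hist => F hist + c := PMF.expect_mono _ hF
      _ = (D.runLaw H play T).expect F + c := by rw [PMF.expect_add, PMF.expect_const]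
      _ ≤ F [] + T * c + c := by gcongr
      _ = F [] + (T + 1 : ℕ) * c := by push_cast; ring

theorem expect_runLaw_take (k T : ℕ) (hk : k ≤ T) (F : List (Episode S A) → ℝ≥0∞) :
    (D.runLaw H play T).expect (fun hist => F (hist.take k)) = (D.runLaw H play k).expect F := by
  induction T, hk using Nat.le_induction with
  | base =>
    refine PMF.expect_congr_support _ fun hist hh => ?_
    rw [List.take_of_length_le (D.length_of_runLaw_ne_zero H play _ _ hh).le]
  | succ T hT ih =>
    rw [expect_runLaw_succ, ← ih]
    refine PMF.expect_congr_support _ fun hist hh => ?_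
    have hl := D.length_of_runLaw_ne_zero H play _ _ hh
    rw [← PMF.expect_const (D.episodeLaw H (play hist)) (F (hist.take k))]
    refine PMF.expect_mono _ (fun e => ?_) |>.antisymm (PMF.expect_mono _ fun e => ?_) <;>
    rw [List.take_append_of_le_length (by omega)]

/-- Upper tail bound for the number of occurrences of an event along the episodes. -/
theorem runLaw_count_ge (Z : List (Episode S A) → Episode S A → Prop)
    (q : List (Episode S A) → ℝ) (hq : ∀ p, 0 ≤ q p)
    (hZ : ∀ p, (D.episodeLaw H (play p)).toOuterMeasure {e | Z p e} ≤ ENNReal.ofReal (q p))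
    (T : ℕ) (l : ℝ) :
    (D.runLaw H play T).toOuterMeasure {hist | 2 * pathSum (fun p _ => q p) hist + l ≤
      pathSum (fun p e => ind (Z p e)) hist} ≤ ENNReal.ofReal (Real.exp (-l)) := by
  -- The process `exp (∑ (Z - 2 q))` is a supermartingale started at `1`; Markov's inequality then
  -- gives the tail `exp (-l)`.
  have key := D.expect_runLaw_le H play (fun hist => ENNReal.ofReal (Real.exp
    (pathSum (fun p e => ind (Z p e) + (-2) * q p) hist))) 0 (fun hist => ?_) T
  · have := PMF.toOuterMeasure_le_of_expect_exp _ _ {hist | 2 * pathSum (fun p _ => q p) hist + l ≤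
      pathSum (fun p e => ind (Z p e)) hist} _ l key (fun hist hh => ?_)
    · simpa [pathSum_nil] using this
    · rw [pathSum_add, pathSum_const_mul (-2) (fun p _ => q p)]
      simp only [Set.mem_ofPred_eq] at hh
      linarith
  · simp only [pathSum_concat, add_zero]
    have e1 : ∀ e, ENNReal.ofReal (Real.exp (pathSum (fun p e => ind (Z p e)
        + (-2) * q p) hist + (ind (Z hist e) + (-2) * q hist))) =
        ENNReal.ofReal (Real.exp (pathSum (fun p e => ind (Z p e)
        + (-2) * q p) hist) * Real.exp (-2 * q hist)) *
          ENNReal.ofReal (Real.exp (ind (Z hist e))) := by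
      intro e
      rw [← ENNReal.ofReal_mul (by positivity), ← Real.exp_add, ← Real.exp_add]
      ring_nf
    simp only [e1, PMF.expect_const_mul]
    -- For an indicator, `exp Z ≤ 1 + 2 Z` since `e ≤ 3`; hence the conditional expectation is at
    -- most `1 + 2 q ≤ exp (2 q)`.
    have e2 : (D.episodeLaw H (play hist)).expect
        (fun e => ENNReal.ofReal (Real.exp (ind (Z hist e)))) ≤
          ENNReal.ofReal (Real.exp (2 * q hist)) := by
      calc
        _ ≤ (D.episodeLaw H (play hist)).expect
            (fun e => 1 + 2 * ({e | Z hist e} : Set _).indicator 1 e) := by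
            refine PMF.expect_mono _ fun e => ?_
            by_cases h : Z hist e
            · rw [ind_of_true h]
              simp only [h, if_true, Set.indicator, Set.mem_ofPred_eq, Pi.one_apply]
              have : Real.exp 1 ≤ 3 := by linarith [Real.exp_one_lt_d9]
              calc _ ≤ ENNReal.ofReal 3 := ENNReal.ofReal_le_ofReal this
                _ = _ := by norm_num
            · rw [ind_of_false h]
              simp [h]
        _ ≤ 1 + 2 * ENNReal.ofReal (q hist) := by
            rw [PMF.expect_add, PMF.expect_const, PMF.expect_const_mul,
              ← PMF.toOuterMeasure_eq_expect]
            gcongr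
            exact hZ hist
        _ = ENNReal.ofReal (1 + 2 * q hist) := by
            rw [ENNReal.ofReal_add (by norm_num) (by linarith [hq hist]),
              ENNReal.ofReal_mul (by norm_num)]
            norm_num
        _ ≤ _ := ENNReal.ofReal_le_ofReal (by linarith [Real.add_one_le_exp (2 * q hist)])
    calc _ ≤ _ := mul_le_mul_right e2 _
      _ = _ := by
        rw [← ENNReal.ofReal_mul (by positivity), mul_assoc, ← Real.exp_add]
        norm_num

/-- Lower tail bound for the number of occurrences of an event along the episodes. -/
theorem runLaw_count_le (Z : List (Episode S A) → Episode S A → Prop)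
    (q : List (Episode S A) → ℝ) (hq : ∀ p, 0 ≤ q p)
    (hZ : ∀ p, ENNReal.ofReal (q p) ≤ (D.episodeLaw H (play p)).toOuterMeasure {e | Z p e})
    (T : ℕ) (l : ℝ) :
    (D.runLaw H play T).toOuterMeasure {hist | pathSum (fun p e => ind (Z p e)) hist + l
      ≤ 1 / 2 * pathSum (fun p _ => q p) hist} ≤ ENNReal.ofReal (Real.exp (-l)) := by
  have key := D.expect_runLaw_le H play (fun hist => ENNReal.ofReal (Real.exp
    (pathSum (fun p e => (1 / 2) * q p + (-1) * ind (Z p e)) hist))) 0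
      (fun hist => ?_) T
  · have := PMF.toOuterMeasure_le_of_expect_exp _ _ {hist |
      pathSum (fun p e => ind (Z p e)) hist + l
      ≤ 1 / 2 * pathSum (fun p _ => q p) hist} _ l key (fun hist hh => ?_)
    · simpa [pathSum_nil] using this
    · rw [pathSum_add, pathSum_const_mul (1 / 2) (fun p _ => q p), pathSum_const_mul (-1)]
      simp only [Set.mem_ofPred_eq] at hh
      linarith
  · simp only [pathSum_concat, add_zero]
    have e1 : ∀ e, ENNReal.ofReal (Real.exp (pathSum (fun p e => (1 / 2) * q p +
        (-1) * ind (Z p e)) hist + ((1 / 2) * q hist +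
        (-1) * ind (Z hist e)))) =
        ENNReal.ofReal (Real.exp (pathSum (fun p e => (1 / 2) * q p +
        (-1) * ind (Z p e)) hist) * Real.exp (q hist / 2)) *
          ENNReal.ofReal (Real.exp (-ind (Z hist e))) := by
      intro e
      rw [← ENNReal.ofReal_mul (by positivity), ← Real.exp_add, ← Real.exp_add]
      ring_nf
    simp only [e1, PMF.expect_const_mul]
    have e2 : (D.episodeLaw H (play hist)).expect
        (fun e => ENNReal.ofReal (Real.exp (-ind (Z hist e)))) ≤
          ENNReal.ofReal (Real.exp (-(q hist / 2))) := by
      -- For an indicator, `exp (-Z) ≤ 1 - Z / 2` since `e ≥ 2`. It is used with the subtracted term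
      -- on the left, so that expectations in `ℝ≥0∞` can be added.
      have h1 : (D.episodeLaw H (play hist)).expect
          (fun e => ENNReal.ofReal (Real.exp (-ind (Z hist e)))) +
          ENNReal.ofReal (1 / 2) * ENNReal.ofReal (q hist) ≤ 1 := by
        calc
          _ ≤ (D.episodeLaw H (play hist)).expect
            (fun e => ENNReal.ofReal (Real.exp (-ind (Z hist e)))) +
              ENNReal.ofReal (1 / 2) *
                (D.episodeLaw H (play hist)).toOuterMeasure {e | Z hist e} := by
                gcongr
                exact hZ hist
          _ ≤ (D.episodeLaw H (play hist)).expect (fun _ => 1) := by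
            rw [PMF.toOuterMeasure_eq_expect, ← PMF.expect_const_mul, ← PMF.expect_add]
            refine PMF.expect_mono _ fun e => ?_
            by_cases h : Z hist e
            · rw [ind_of_true h]
              simp only [h, if_true, Set.indicator, Set.mem_ofPred_eq, Pi.one_apply, mul_one]
              rw [← ENNReal.ofReal_add (by positivity) (by positivity), ← ENNReal.ofReal_one]
              refine ENNReal.ofReal_le_ofReal ?_
              have h2 : (2 : ℝ) ≤ Real.exp 1 := by linarith [Real.exp_one_gt_d9]
              have : Real.exp (-1) ≤ 1 / 2 := by
                rw [Real.exp_neg, one_div]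
                exact inv_anti₀ (by norm_num) h2
              linarith
            · rw [ind_of_false h]
              simp [h]
          _ = 1 := PMF.expect_const _ _
      rw [← ENNReal.ofReal_mul (by norm_num)] at h1
      calc _ ≤ 1 - ENNReal.ofReal (1 / 2 * q hist) :=
            ENNReal.le_sub_of_add_le_right ENNReal.ofReal_ne_top h1
        _ = ENNReal.ofReal (1 - 1 / 2 * q hist) := by
            rw [ENNReal.ofReal_sub _ (by linarith [hq hist])]
            simp
        _ ≤ _ := ENNReal.ofReal_le_ofReal (by linarith [Real.add_one_le_exp (-(q hist / 2))])
    calc _ ≤ _ := mul_le_mul_right e2 _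
      _ = _ := by
        rw [← ENNReal.ofReal_mul (by positivity), mul_assoc, ← Real.exp_add]
        norm_num

end Dynamics

/-! ### Returns, followed plans and visited states of one episode -/

theorem PMF.sum_toReal_eq_one {α : Type*} [Fintype α] (p : PMF α) : ∑ a, (p a).toReal = 1 := by
  rw [← ENNReal.toReal_sum fun a _ => p.apply_ne_top a, ← tsum_fintype (L := .unconditional _),
    p.tsum_coe, ENNReal.toReal_one]

theorem PMF.expect_ofReal {α : Type*} [Fintype α] (p : PMF α) (x : α → ℝ) (hx : ∀ a, 0 ≤ x a) :
    p.expect (fun a => ENNReal.ofReal (x a)) = ENNReal.ofReal (∑ a, (p a).toReal * x a) := by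
  rw [PMF.expect_eq_sum, ENNReal.ofReal_sum_of_nonneg fun a _ =>
    mul_nonneg ENNReal.toReal_nonneg (hx a)]
  refine Finset.sum_congr rfl fun a _ => ?_
  rw [ENNReal.ofReal_mul ENNReal.toReal_nonneg, ENNReal.ofReal_toReal (p.apply_ne_top a)]

/-- The deterministic policy that plays `f h s` in state `s` at step `h`. -/
noncomputable def detPolicy {S A : Type*} (f : ℕ → S → A) : Policy S A :=
  fun h s => PMF.pure (f h s)

namespace Episode

variable {S A : Type*}

/-- Total reward of an episode that starts at step `h`. -/
def retFrom (r : ℕ → S → A → ℝ) : ℕ → Episode S A → ℝ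
  | _, [] => 0
  | h, x :: e => r h x.1 x.2 + retFrom r (h + 1) e

/-- The actions of an episode that starts at step `h` are those of `f`. -/
def Follows (f : ℕ → S → A) : ℕ → Episode S A → Prop
  | _, [] => True
  | h, x :: e => x.2 = f h x.1 ∧ Follows f (h + 1) e

theorem retFrom_nonneg (r : ℕ → S → A → ℝ) (h : ℕ) (e : Episode S A)
    (hr : ∀ h', h ≤ h' → h' < h + e.length → ∀ s a, 0 ≤ r h' s a) : 0 ≤ retFrom r h e := by
  induction e generalizing h with
  | nil => exact le_rfl
  | cons x e ih =>
    refine add_nonneg (hr h le_rfl (by simp) _ _) (ih _ fun h' h1 h2 => hr h' (by omega) ?_)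
    simp only [List.length_cons]
    omega

theorem retFrom_le (r : ℕ → S → A → ℝ) (c : ℝ) (h : ℕ) (e : Episode S A)
    (hr : ∀ h', h ≤ h' → h' < h + e.length → ∀ s a, r h' s a ≤ c) :
    retFrom r h e ≤ e.length * c := by
  induction e generalizing h with
  | nil => simp [retFrom]
  | cons x e ih =>
    have h1 := hr h le_rfl (by simp) x.1 x.2
    have h2 := ih (h + 1) fun h' h1 h2 => hr h' (by omega) (by simp only [List.length_cons]; omega)
    simp only [retFrom, List.length_cons]
    push_cast
    linarith

theorem retFrom_add_const (r : ℕ → S → A → ℝ) (c : ℝ) (h : ℕ) (e : Episode S A) :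
    retFrom (fun h s a => r h s a + c) h e = retFrom r h e + e.length * c := by
  induction e generalizing h with
  | nil => simp [retFrom]
  | cons x e ih =>
    simp only [retFrom, List.length_cons, ih]
    push_cast
    ring

theorem retFrom_neg (r : ℕ → S → A → ℝ) (h : ℕ) (e : Episode S A) :
    retFrom (fun h s a => -r h s a) h e = -retFrom r h e := by
  induction e generalizing h with
  | nil => simp [retFrom]
  | cons x e ih =>
    simp only [retFrom, ih]
    ring

theorem le_retFrom_of_getElem? (r : ℕ → S → A → ℝ) (hr : ∀ h s a, 0 ≤ r h s a) (h i : ℕ)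
    (e : Episode S A) (x : S × A) (hx : e[i]? = some x) : r (h + i) x.1 x.2 ≤ retFrom r h e := by
  induction e generalizing h i with
  | nil => simp at hx
  | cons y e ih =>
    have h0 : 0 ≤ retFrom r (h + 1) e := retFrom_nonneg _ _ _ fun _ _ _ => hr _
    cases i with
    | zero =>
      simp only [List.getElem?_cons_zero, Option.some.injEq] at hx
      subst hx
      simp [retFrom, h0]
    | succ i =>
      simp only [List.getElem?_cons_succ] at hx
      have := ih (h + 1) i hx
      rw [show h + 1 + i = h + (i + 1) by omega] at this
      simp only [retFrom]
      linarith [hr h y.1 y.2]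

theorem one_le_retFrom_of_not_follows (f : ℕ → S → A) (h : ℕ) (e : Episode S A)
    (he : ¬ Follows f h e) : 1 ≤ retFrom (fun h s a => ind (a ≠ f h s)) h e := by
  induction e generalizing h with
  | nil => simp [Follows] at he
  | cons x e ih =>
    simp only [Follows, not_and_or] at he
    simp only [retFrom]
    have h0 : 0 ≤ retFrom (fun h s a => ind (a ≠ f h s)) (h + 1) e :=
      retFrom_nonneg _ _ _ fun _ _ _ _ _ => ind_nonneg _
    rcases he with he | he
    · rw [ind_of_true he]
      linarith
    · linarith [ih _ he, ind_nonneg (x.2 ≠ f h x.1)]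

end Episode

namespace Dynamics

open Episode

variable {S A : Type*} (D : Dynamics S A)

theorem expect_episodeFrom_succ (π : Policy S A) (n h : ℕ) (s : S) (F : Episode S A → ℝ≥0∞) :
    (D.episodeFrom π (n + 1) h s).expect F = (π h s).expect fun a => (D.trans s a).expect fun s' =>
      (D.episodeFrom π n (h + 1) s').expect fun e => F ((s, a) :: e) := by
  simp only [episodeFrom, PMF.expect_bind, PMF.expect_map]

open Classical in
/-- On the episodes that follow `f`, any law of episodes is dominated by that of `f`. -/
theorem expect_episodeFrom_follows_le (π : Policy S A) (f : ℕ → S → A) (n h : ℕ) (s : S)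
    (F : Episode S A → ℝ≥0∞) :
    (D.episodeFrom π n h s).expect (fun e => if Follows f h e then F e else 0) ≤
      (D.episodeFrom (detPolicy f) n h s).expect F := by
  induction n generalizing h s F with
  | zero => simp [episodeFrom, PMF.expect_pure, Follows]
  | succ n ih =>
    rw [expect_episodeFrom_succ, expect_episodeFrom_succ]
    simp only [detPolicy, PMF.expect_pure]
    -- Only `a = f h s` contributes on the left. There the action is drawn with some probability at
    -- most one, so the bound holds with the same constant for every `a` and integrates to that
    -- constant.
    refine le_of_le_of_eq (PMF.expect_mono _ fun a => ?_) (PMF.expect_const (π h s) _)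
    simp only [Follows]
    by_cases ha : a = f h s
    · subst ha
      simp only [true_and]
      exact PMF.expect_mono _ fun s' => ih _ _ _
    · simp [ha, PMF.expect]

open Classical in
theorem expect_episodeLaw_follows_le (H : ℕ) (π : Policy S A) (f : ℕ → S → A)
    (F : Episode S A → ℝ≥0∞) :
    (D.episodeLaw H π).expect (fun e => if Follows f 0 e then F e else 0) ≤
      (D.episodeLaw H (detPolicy f)).expect F := by
  simp only [episodeLaw, PMF.expect_bind]
  exact PMF.expect_mono _ fun s => D.expect_episodeFrom_follows_le π f H 0 s F

theorem expect_state (π : Policy S A) (n h i : ℕ) (hi : i < n) (f : Option S → ℝ≥0∞) :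
    ((D.stateLaw π h).expect fun s => (D.episodeFrom π n h s).expect fun e =>
      f (e[i]?.map fun x => x.1)) = (D.stateLaw π (h + i)).expect fun s => f (some s) := by
  induction i generalizing n h with
  | zero =>
    obtain ⟨n, rfl⟩ : ∃ k, n = k + 1 := ⟨n - 1, by omega⟩
    simp [expect_episodeFrom_succ, PMF.expect_const]
  | succ i ih =>
    obtain ⟨n, rfl⟩ : ∃ k, n = k + 1 := ⟨n - 1, by omega⟩
    have := ih n (h + 1) (by omega)
    rw [show h + 1 + i = h + (i + 1) by omega] at this
    rw [← this]
    simp only [expect_episodeFrom_succ, List.getElem?_cons_succ, stateLaw, PMF.expect_bind]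

theorem episodeLaw_state (H h : ℕ) (hh : h < H) (π : Policy S A) (s : S) :
    (D.episodeLaw H π).toOuterMeasure {e | e[h]?.map (fun x => x.1) = some s} =
      D.stateLaw π h s := by
  have := D.expect_state π H 0 h hh (Set.indicator {some s} 1)
  rw [PMF.toOuterMeasure_eq_expect, episodeLaw, PMF.expect_bind]
  rw [zero_add] at this
  have h2 : (D.stateLaw π h).expect (fun s' => Set.indicator {some s} 1 (some s')) =
      D.stateLaw π h s := by
    rw [PMF.expect, tsum_eq_single s]
    · simp
    · intro b hb
      simp [hb]
  rw [← h2, ← this]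
  rfl

theorem reachable_zero {s : S} [Nonempty A] (hs : D.init s ≠ 0) : D.Reachable 0 s :=
  ⟨fun _ _ => PMF.pure (Classical.arbitrary A), hs⟩

theorem stateLaw_congr {π π' : Policy S A} (h : ℕ) (hπ : ∀ h' < h, ∀ s, π h' s = π' h' s) :
    D.stateLaw π h = D.stateLaw π' h := by
  induction h with
  | zero => rfl
  | succ h ih =>
    simp only [stateLaw, ih fun h' hh => hπ h' (by omega), hπ h (by omega)]

theorem Reachable.succ {D : Dynamics S A} {h : ℕ} {s s' : S} {a : A} (hs : D.Reachable h s)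
    (h' : D.trans s a s' ≠ 0) : D.Reachable (h + 1) s' := by
  obtain ⟨π, hπ⟩ := hs
  -- Changing the policy at step `h` alone does not affect the law of the state at step `h`.
  refine ⟨fun k => if k = h then fun _ => PMF.pure a else π k, ?_⟩
  have hc := D.stateLaw_congr (π := fun k => if k = h then fun _ => PMF.pure a else π k) (π' := π) h
    (fun k hk s => by simp [hk.ne])
  change s' ∈ PMF.support _
  simp only [stateLaw, PMF.mem_support_bind_iff]
  refine ⟨s, ?_, a, ?_, h'⟩
  · rw [hc]
    exact hπ
  · simp

/-! ### Value functions, potential shaping and optimal policies -/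

variable [Fintype S] [Fintype A]

/-- The link between the recursively defined values and the law of episodes. Rewards are nonnegative
because expectations live in `ℝ≥0∞`; the second conclusion is needed by the induction to split
`ENNReal.ofReal` of a sum. -/
theorem expect_retFrom (r : ℕ → S → A → ℝ) (π : Policy S A) (n h : ℕ) (s : S)
    (hr : ∀ h', h ≤ h' → h' < h + n → ∀ s a, 0 ≤ r h' s a) :
    (D.episodeFrom π n h s).expect (fun e => ENNReal.ofReal (retFrom r h e)) =
      ENNReal.ofReal (D.valueFrom r π n h s) ∧ 0 ≤ D.valueFrom r π n h s := by
  induction n generalizing h s with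
  | zero => simp [episodeFrom, PMF.expect_pure, retFrom, valueFrom]
  | succ n ih =>
    have ih' := fun s' => ih (h + 1) s' fun h' h1 h2 => hr h' (by omega) (by omega)
    have h0 := hr h le_rfl (by omega)
    have hv : ∀ a, 0 ≤ ∑ s', (D.trans s a s').toReal * D.valueFrom r π n (h + 1) s' := fun a =>
      Finset.sum_nonneg fun s' _ => mul_nonneg ENNReal.toReal_nonneg (ih' s').2
    refine ⟨?_, Finset.sum_nonneg fun a _ => mul_nonneg ENNReal.toReal_nonneg
      (add_nonneg (h0 s a) (hv a))⟩
    rw [expect_episodeFrom_succ, valueFrom, ← PMF.expect_ofReal _ _ fun a =>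
      add_nonneg (h0 s a) (hv a)]
    congr 1
    funext a
    rw [ENNReal.ofReal_add (h0 s a) (hv a), ← PMF.expect_ofReal _ _ fun s' => (ih' s').2]
    have : ∀ s', (D.episodeFrom π n (h + 1) s').expect
        (fun e => ENNReal.ofReal (retFrom r h ((s, a) :: e))) =
        ENNReal.ofReal (r h s a) + ENNReal.ofReal (D.valueFrom r π n (h + 1) s') := by
      intro s'
      rw [← (ih' s').1, ← PMF.expect_const (D.episodeFrom π n (h + 1) s') (ENNReal.ofReal (r h s a)),
        ← PMF.expect_add]
      refine PMF.expect_congr_support _ fun e he => ?_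
      have hl := D.length_of_episodeFrom_ne_zero _ _ _ _ _ he
      rw [← ENNReal.ofReal_add (h0 s a)]
      · rfl
      · exact retFrom_nonneg _ _ _ fun h' h1 h2 => hr h' (by omega) (by omega)
    simp only [this, PMF.expect_add, PMF.expect_const]

theorem expect_episodeLaw_retFrom (H : ℕ) (r : ℕ → S → A → ℝ) (π : Policy S A)
    (hr : ∀ h < H, ∀ s a, 0 ≤ r h s a) :
    (D.episodeLaw H π).expect (fun e => ENNReal.ofReal (retFrom r 0 e)) =
      ENNReal.ofReal (D.value H r π) := by
  have := fun s => D.expect_retFrom r π H 0 s fun h' _ h2 => hr h' (by omega)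
  rw [episodeLaw, PMF.expect_bind]
  simp only [(this _).1]
  exact PMF.expect_ofReal _ _ fun s => (this s).2

/-- Monotonicity of the value in the rewards, which have to be compared only on a set of states
that is closed under the transitions. -/
theorem valueFrom_mono {r r' : ℕ → S → A → ℝ} (π : Policy S A) (R : ℕ → S → Prop)
    (hR : ∀ h s a s', R h s → D.trans s a s' ≠ 0 → R (h + 1) s') (n h : ℕ) (s : S) (hs : R h s)
    (hr : ∀ h', h ≤ h' → h' < h + n → ∀ s a, R h' s → r h' s a ≤ r' h' s a) :
    D.valueFrom r π n h s ≤ D.valueFrom r' π n h s := by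
  induction n generalizing h s with
  | zero => exact le_rfl
  | succ n ih =>
    simp only [valueFrom]
    refine Finset.sum_le_sum fun a _ => mul_le_mul_of_nonneg_left (add_le_add
      (hr h le_rfl (by omega) s a hs) (Finset.sum_le_sum fun s' _ => ?_)) ENNReal.toReal_nonneg
    by_cases h' : D.trans s a s' = 0
    · simp [h']
    · exact mul_le_mul_of_nonneg_left (ih _ _ (hR _ _ _ _ hs h')
        fun k h1 h2 => hr k (by omega) (by omega)) ENNReal.toReal_nonneg

theorem value_mono_of_reachable [Nonempty A] {r r' : ℕ → S → A → ℝ} (H : ℕ) (π : Policy S A)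
    (hr : ∀ h < H, ∀ s a, D.Reachable h s → r h s a ≤ r' h s a) :
    D.value H r π ≤ D.value H r' π := by
  refine Finset.sum_le_sum fun s _ => ?_
  by_cases hs : D.init s = 0
  · simp [hs]
  · exact mul_le_mul_of_nonneg_left (D.valueFrom_mono π D.Reachable
      (fun h s a s' h1 h2 => h1.succ h2) H 0 s (D.reachable_zero hs)
      fun h' _ h2 s a => hr h' (by omega) s a) ENNReal.toReal_nonneg

theorem value_mono {r r' : ℕ → S → A → ℝ} (H : ℕ) (π : Policy S A)
    (hr : ∀ h < H, ∀ s a, r h s a ≤ r' h s a) : D.value H r π ≤ D.value H r' π :=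
  Finset.sum_le_sum fun s _ => mul_le_mul_of_nonneg_left (D.valueFrom_mono π (fun _ _ => True)
    (fun _ _ _ _ _ _ => trivial) H 0 s trivial fun h' _ h2 s a _ => hr h' (by omega) s a)
    ENNReal.toReal_nonneg

theorem value_congr {r r' : ℕ → S → A → ℝ} (H : ℕ) (π : Policy S A)
    (hr : ∀ h < H, ∀ s a, r h s a = r' h s a) : D.value H r π = D.value H r' π :=
  (D.value_mono H π fun h hh s a => (hr h hh s a).le).antisymm
    (D.value_mono H π fun h hh s a => (hr h hh s a).ge)

theorem valueFrom_lin (r r' : ℕ → S → A → ℝ) (c : ℝ) (π : Policy S A) (n h : ℕ) (s : S) :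
    D.valueFrom (fun h s a => r h s a + c * r' h s a) π n h s =
      D.valueFrom r π n h s + c * D.valueFrom r' π n h s := by
  induction n generalizing h s with
  | zero => simp [valueFrom]
  | succ n ih =>
    simp only [valueFrom, ih, Finset.mul_sum, ← Finset.sum_add_distrib, mul_add]
    refine Finset.sum_congr rfl fun a _ => ?_
    rw [Finset.sum_add_distrib]
    have : ∀ x, (π h s a).toReal * ((D.trans s a x).toReal * (c * D.valueFrom r' π n (h + 1) x)) =
        c * ((π h s a).toReal * ((D.trans s a x).toReal * D.valueFrom r' π n (h + 1) x)) :=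
      fun x => by ring
    simp only [this]
    ring

theorem value_lin (H : ℕ) (r r' : ℕ → S → A → ℝ) (c : ℝ) (π : Policy S A) :
    D.value H (fun h s a => r h s a + c * r' h s a) π = D.value H r π + c * D.value H r' π := by
  simp only [value, valueFrom_lin, mul_add, Finset.sum_add_distrib, Finset.mul_sum]
  congr 1
  exact Finset.sum_congr rfl fun s _ => by ring

theorem value_zero (H : ℕ) (π : Policy S A) : D.value H (fun _ _ _ => 0) π = 0 := by
  have := D.value_lin H (fun _ _ _ => 0) (fun _ _ _ => 0) 1 π
  simp only [one_mul, add_zero] at this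
  linarith

theorem value_const_mul (H : ℕ) (r : ℕ → S → A → ℝ) (c : ℝ) (π : Policy S A) :
    D.value H (fun h s a => c * r h s a) π = c * D.value H r π := by
  have := D.value_lin H (fun _ _ _ => 0) r c π
  simpa only [zero_add, value_zero] using this

theorem value_neg (H : ℕ) (r : ℕ → S → A → ℝ) (π : Policy S A) :
    D.value H (fun h s a => -r h s a) π = -D.value H r π := by
  simpa using D.value_const_mul H r (-1) π

theorem valueFrom_const (c : ℝ) (π : Policy S A) (n h : ℕ) (s : S) :
    D.valueFrom (fun _ _ _ => c) π n h s = n * c := by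
  induction n generalizing h s with
  | zero => simp [valueFrom]
  | succ n ih =>
    simp only [valueFrom, ih, ← Finset.sum_mul, PMF.sum_toReal_eq_one]
    push_cast
    ring

theorem value_const (H : ℕ) (c : ℝ) (π : Policy S A) :
    D.value H (fun _ _ _ => c) π = H * c := by
  simp only [value, valueFrom_const, ← Finset.sum_mul, PMF.sum_toReal_eq_one, one_mul]

/-- Shaping the rewards by a potential changes the value by the initial potential. -/
theorem valueFrom_shaping (r : ℕ → S → A → ℝ) (Φ : ℕ → S → ℝ) (π : Policy S A) (n h : ℕ) (s : S)
    (hΦ : ∀ s, Φ (h + n) s = 0) :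
    D.valueFrom (fun h s a => r h s a + ∑ s', (D.trans s a s').toReal * Φ (h + 1) s' - Φ h s)
      π n h s = D.valueFrom r π n h s - Φ h s := by
  induction n generalizing h s with
  | zero => simpa [valueFrom] using hΦ s
  | succ n ih =>
    have ih' := fun s' => ih (h + 1) s' fun s => by
      rw [show h + 1 + n = h + (n + 1) by omega]; exact hΦ s
    simp only [valueFrom, ih']
    have : ∀ a, (π h s a).toReal * (r h s a + ∑ s', (D.trans s a s').toReal * Φ (h + 1) s' - Φ h s +
        ∑ s', (D.trans s a s').toReal * (D.valueFrom r π n (h + 1) s' - Φ (h + 1) s')) =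
        (π h s a).toReal * (r h s a + ∑ s', (D.trans s a s').toReal * D.valueFrom r π n (h + 1) s')
          - (π h s a).toReal * Φ h s := by
      intro a
      simp only [mul_sub, Finset.sum_sub_distrib, mul_add]
      ring
    simp only [this, Finset.sum_sub_distrib, ← Finset.sum_mul, PMF.sum_toReal_eq_one, one_mul]

theorem value_shaping (H : ℕ) (r : ℕ → S → A → ℝ) (Φ : ℕ → S → ℝ) (π : Policy S A)
    (hΦ : ∀ s, Φ H s = 0) :
    D.value H (fun h s a => r h s a + ∑ s', (D.trans s a s').toReal * Φ (h + 1) s' - Φ h s) π =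
      D.value H r π - ∑ s, (D.init s).toReal * Φ 0 s := by
  simp only [value]
  rw [Finset.sum_congr rfl fun s _ => by
    rw [D.valueFrom_shaping r Φ π H 0 s fun s => by rw [zero_add]; exact hΦ s]]
  simp only [mul_sub, Finset.sum_sub_distrib]

/-- Performance difference identity. -/
theorem value_sub_value (H : ℕ) (r : ℕ → S → A → ℝ) (ρ π : Policy S A) :
    D.value H r ρ - D.value H r π = D.value H (fun h s a => D.valueFrom r ρ (H - h) h s -
      (r h s a + ∑ s', (D.trans s a s').toReal * D.valueFrom r ρ (H - (h + 1)) (h + 1) s')) π := by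
  -- The potential is the value function of `ρ`; the shaped rewards are then the advantages with
  -- respect to `ρ`.
  have := D.value_shaping H r (fun h s => D.valueFrom r ρ (H - h) h s) π
    (fun s => by simp [valueFrom])
  have h2 := D.value_neg H (fun h s a => r h s a + ∑ s', (D.trans s a s').toReal *
    D.valueFrom r ρ (H - (h + 1)) (h + 1) s' - D.valueFrom r ρ (H - h) h s) π
  simp only [neg_sub] at h2
  rw [h2, this]
  simp only [value, Nat.sub_zero]
  ring

theorem valueFrom_det_succ (r : ℕ → S → A → ℝ) (f : ℕ → S → A) (n h : ℕ) (s : S) :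
    D.valueFrom r (detPolicy f) (n + 1) h s = r h s (f h s) +
      ∑ s', (D.trans s (f h s) s').toReal * D.valueFrom r (detPolicy f) n (h + 1) s' := by
  classical
  rw [valueFrom, Finset.sum_eq_single (f h s)]
  · simp [detPolicy]
  · intro b _ hb
    simp [detPolicy, PMF.pure_apply, hb]
  · simp

/-- Optimal state value function, with `n` steps to go at step `h`. -/
noncomputable def optV (r : ℕ → S → A → ℝ) (n h : ℕ) (s : S) : ℝ := ⨆ a, D.optQ r n h s a

theorem optQ_le_optV (r : ℕ → S → A → ℝ) (n h : ℕ) (s : S) (a : A) :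
    D.optQ r n h s a ≤ D.optV r n h s :=
  le_ciSup (Set.finite_range fun a => D.optQ r n h s a).bddAbove a

theorem optQ_succ (r : ℕ → S → A → ℝ) (n h : ℕ) (s : S) (a : A) :
    D.optQ r (n + 1) h s a =
      r h s a + ∑ s', (D.trans s a s').toReal * D.optV r n (h + 1) s' := rfl

theorem exists_optQ_eq_optV [Nonempty A] (r : ℕ → S → A → ℝ) (n h : ℕ) (s : S) :
    ∃ a, D.optQ r n h s a = D.optV r n h s := exists_eq_ciSup_of_finite

theorem optV_zero (r : ℕ → S → A → ℝ) (h : ℕ) (s : S) : D.optV r 0 h s = 0 := by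
  simp [optV, optQ]

theorem valueFrom_le_optV (r : ℕ → S → A → ℝ) (π : Policy S A) (n h : ℕ) (s : S) :
    D.valueFrom r π n h s ≤ D.optV r n h s := by
  induction n generalizing h s with
  | zero => simp [valueFrom, optV_zero]
  | succ n ih =>
    calc D.valueFrom r π (n + 1) h s ≤ ∑ a, (π h s a).toReal * D.optV r (n + 1) h s := by
          refine Finset.sum_le_sum fun a _ => mul_le_mul_of_nonneg_left
            (le_trans ?_ (D.optQ_le_optV r (n + 1) h s a)) ENNReal.toReal_nonneg
          rw [optQ_succ]
          gcongr
          exact ih _ _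
      _ = _ := by rw [← Finset.sum_mul, PMF.sum_toReal_eq_one, one_mul]

/-- A policy that is optimal from every state at every step. -/
theorem exists_det_valueFrom_eq_optV [Nonempty A] (H : ℕ) (r : ℕ → S → A → ℝ) :
    ∃ f : ℕ → S → A, ∀ n h s, n + h = H →
      D.valueFrom r (detPolicy f) n h s = D.optV r n h s := by
  choose g hg using D.exists_optQ_eq_optV r
  refine ⟨fun h s => g (H - h) h s, fun n => ?_⟩
  induction n with
  | zero => intro h s _; simp [valueFrom, optV_zero]
  | succ n ih =>
    intro h s hH
    rw [valueFrom_det_succ, ← hg (n + 1) h s, show H - h = n + 1 by omega, optQ_succ]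
    congr 1
    exact Finset.sum_congr rfl fun s' _ => by rw [ih (h + 1) s' (by omega)]

theorem value_le_sum_optV (H : ℕ) (r : ℕ → S → A → ℝ) (π : Policy S A) :
    D.value H r π ≤ ∑ s, (D.init s).toReal * D.optV r H 0 s :=
  Finset.sum_le_sum fun s _ => mul_le_mul_of_nonneg_left (D.valueFrom_le_optV r π H 0 s)
    ENNReal.toReal_nonneg

theorem bddAbove_value (H : ℕ) (r : ℕ → S → A → ℝ) :
    BddAbove (Set.range fun π => D.value H r π) :=
  ⟨_, by rintro _ ⟨π, rfl⟩; exact D.value_le_sum_optV H r π⟩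

theorem value_le_optValue (H : ℕ) (r : ℕ → S → A → ℝ) (π : Policy S A) :
    D.value H r π ≤ D.optValue H r := le_ciSup (D.bddAbove_value H r) π

theorem exists_det_value_eq_optValue [Nonempty A] (H : ℕ) (r : ℕ → S → A → ℝ) :
    ∃ f : ℕ → S → A, D.value H r (detPolicy f) = D.optValue H r ∧
      D.optValue H r = ∑ s, (D.init s).toReal * D.optV r H 0 s := by
  obtain ⟨f, hf⟩ := D.exists_det_valueFrom_eq_optV H r
  have h1 : D.value H r (detPolicy f) = ∑ s, (D.init s).toReal * D.optV r H 0 s :=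
    Finset.sum_congr rfl fun s _ => by rw [hf H 0 s (by omega)]
  have : Nonempty (Policy S A) := ⟨detPolicy f⟩
  have h2 : D.optValue H r ≤ ∑ s, (D.init s).toReal * D.optV r H 0 s :=
    ciSup_le fun π => D.value_le_sum_optV H r π
  have h3 := D.value_le_optValue H r (detPolicy f)
  exact ⟨f, by linarith, by linarith⟩

theorem optValue_eq [Nonempty A] (H : ℕ) (r : ℕ → S → A → ℝ) :
    D.optValue H r = ∑ s, (D.init s).toReal * D.optV r H 0 s :=
  (D.exists_det_value_eq_optValue H r).choose_spec.2

/-- The loss of a policy is the value of the optimal advantages, with the opposite sign. -/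
theorem optValue_sub_value [Nonempty A] (H : ℕ) (r : ℕ → S → A → ℝ) (π : Policy S A) :
    D.optValue H r - D.value H r π =
      D.value H (fun h s a => D.optV r (H - h) h s - D.optQ r (H - h) h s a) π := by
  -- The potential is now the optimal value function, whose initial mean is `optValue`.
  have h1 := D.value_shaping H r (fun h s => D.optV r (H - h) h s) π
    (fun s => by simp [optV_zero])
  rw [Nat.sub_zero, ← D.optValue_eq] at h1
  have h2 : D.value H (fun h s a => D.optV r (H - h) h s - D.optQ r (H - h) h s a) π =
      D.value H (fun h s a => -(r h s a + ∑ s', (D.trans s a s').toReal *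
        D.optV r (H - (h + 1)) (h + 1) s' - D.optV r (H - h) h s)) π := by
    refine D.value_congr H π fun h hh s a => ?_
    rw [show H - h = (H - (h + 1)) + 1 by omega, optQ_succ]
    ring
  rw [h2, D.value_neg, h1]
  ring

theorem optQ_congr {r r' : ℕ → S → A → ℝ} (n h : ℕ) (s : S) (a : A)
    (hr : ∀ h', h ≤ h' → ∀ s a, r h' s a = r' h' s a) : D.optQ r n h s a = D.optQ r' n h s a := by
  induction n generalizing h s a with
  | zero => rfl
  | succ n ih =>
    simp only [optQ]
    rw [hr h le_rfl]
    congr 1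
    refine Finset.sum_congr rfl fun s' _ => ?_
    rw [iSup_congr fun a' => ih (h + 1) s' a' fun h' hh => hr h' (by omega)]

theorem valueFrom_mem_Icc {r : ℕ → S → A → ℝ} {c : ℝ} (hr : ∀ h s a, r h s a ∈ Set.Icc 0 c)
    (π : Policy S A) (n h : ℕ) (s : S) : D.valueFrom r π n h s ∈ Set.Icc 0 (n * c) := by
  have h1 := D.valueFrom_mono (r := fun _ _ _ => 0) (r' := r) π (fun _ _ => True)
    (fun _ _ _ _ _ _ => trivial) n h s trivial fun h' _ _ s a _ => (hr h' s a).1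
  have h2 := D.valueFrom_mono (r := r) (r' := fun _ _ _ => c) π (fun _ _ => True)
    (fun _ _ _ _ _ _ => trivial) n h s trivial fun h' _ _ s a _ => (hr h' s a).2
  rw [valueFrom_const] at h1 h2
  exact ⟨by simpa using h1, h2⟩

theorem value_mem_Icc {r : ℕ → S → A → ℝ} {c : ℝ} (hr : ∀ h s a, r h s a ∈ Set.Icc 0 c)
    (H : ℕ) (π : Policy S A) : D.value H r π ∈ Set.Icc 0 (H * c) := by
  have h1 := D.value_mono (r := fun _ _ _ => 0) (r' := r) H π fun h _ s a => (hr h s a).1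
  have h2 := D.value_mono (r := r) (r' := fun _ _ _ => c) H π fun h _ s a => (hr h s a).2
  rw [value_const] at h1 h2
  exact ⟨by simpa using h1, h2⟩

end Dynamics

/-! ### Probability of a deviation, and exponential moments of the return -/

namespace Dynamics

open Episode

variable {S A : Type*} (D : Dynamics S A) [Fintype S] [Fintype A]

theorem episodeLaw_not_follows_le (H : ℕ) (π : Policy S A) (f : ℕ → S → A) :
    (D.episodeLaw H π).toOuterMeasure {e | ¬ Follows f 0 e} ≤
      ENNReal.ofReal (D.value H (fun h s a => ind (a ≠ f h s)) π) := by
  rw [← D.expect_episodeLaw_retFrom H _ π fun _ _ _ _ => ind_nonneg _,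
    PMF.toOuterMeasure_eq_expect]
  refine PMF.expect_mono _ fun e => ?_
  by_cases he : Follows f 0 e
  · simp [he]
  · simpa [Set.indicator, he] using one_le_retFrom_of_not_follows f 0 e he

/-- With `episodeLaw_not_follows_le` it shows that a learner who plays his own plans never restarts,
almost surely; this is the case needed for the regret exponent. -/
theorem value_det_deviation (H : ℕ) (f : ℕ → S → A) :
    D.value H (fun h s a => ind (a ≠ f h s)) (detPolicy f) = 0 := by
  have : ∀ n h s, D.valueFrom (fun h s a => ind (a ≠ f h s)) (detPolicy f) n h s = 0 := by
    intro n
    induction n with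
    | zero => intro h s; rfl
    | succ n ih => intro h s; simp only [valueFrom_det_succ, ih]; simp [ind]
  simp [value, this]

theorem value_congr_det (H : ℕ) (r : ℕ → S → A → ℝ) {f g : ℕ → S → A}
    (hfg : ∀ h < H, ∀ s, f h s = g h s) :
    D.value H r (detPolicy f) = D.value H r (detPolicy g) := by
  have : ∀ n h s, n + h ≤ H →
      D.valueFrom r (detPolicy f) n h s = D.valueFrom r (detPolicy g) n h s := by
    intro n
    induction n with
    | zero => intro h s _; rfl
    | succ n ih =>
      intro h s hH
      rw [valueFrom_det_succ, valueFrom_det_succ, hfg h (by omega)]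
      congr 1
      exact Finset.sum_congr rfl fun s' _ => by rw [ih (h + 1) s' (by omega)]
  exact Finset.sum_congr rfl fun s _ => by rw [this H 0 s (by omega)]

/-- Bound for the moment generating function of the centred total reward, nonnegative rewards. -/
theorem expect_exp_retFrom_le (H : ℕ) (r : ℕ → S → A → ℝ) (π : Policy S A) (c t : ℝ)
    (hr : ∀ h < H, ∀ s a, r h s a ∈ Set.Icc 0 c) (ht : 0 ≤ t) (htc : t * (H * c) ≤ 1) :
    (D.episodeLaw H π).expect (fun e => ENNReal.ofReal
      (Real.exp (t * (retFrom r 0 e - D.value H r π)))) ≤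
      ENNReal.ofReal (Real.exp (t ^ 2 * (H * c) ^ 2)) := by
  set μ := D.value H r π with hμ
  have hμ0 : 0 ≤ μ := by
    have := D.value_mono (r := fun _ _ _ => 0) (r' := r) H π fun h hh s a => (hr h hh s a).1
    rwa [value_zero] at this
  have hμ1 : μ ≤ H * c := by
    have := D.value_mono (r := r) (r' := fun _ _ _ => c) H π fun h hh s a => (hr h hh s a).2
    rwa [value_const] at this
  have hR : 0 ≤ (H : ℝ) * c := hμ0.trans hμ1
  calc
    _ ≤ (D.episodeLaw H π).expect (fun e => ENNReal.ofReal (Real.exp (-(t * μ))) *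
        (1 + ENNReal.ofReal (t * (1 + t * (H * c))) * ENNReal.ofReal (retFrom r 0 e))) := by
      refine PMF.expect_mono_support _ fun e he => ?_
      have hl := D.length_of_episodeLaw_ne_zero H π e he
      have h0 : 0 ≤ retFrom r 0 e := retFrom_nonneg _ _ _ fun h _ hh s a =>
        (hr h (by omega) s a).1
      have h1 : retFrom r 0 e ≤ H * c := by
        have := retFrom_le r c 0 e fun h _ hh s a => (hr h (by omega) s a).2
        rwa [hl] at this
      set G := retFrom r 0 e
      rw [← ENNReal.ofReal_mul (by positivity), ← ENNReal.ofReal_one,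
        ← ENNReal.ofReal_add zero_le_one (by positivity), ← ENNReal.ofReal_mul (by positivity)]
      refine ENNReal.ofReal_le_ofReal ?_
      rw [show t * (G - μ) = -(t * μ) + t * G by ring, Real.exp_add]
      refine mul_le_mul_of_nonneg_left ?_ (Real.exp_pos _).le
      have hx0 : 0 ≤ t * G := by positivity
      have hx1 : t * G ≤ 1 := (mul_le_mul_of_nonneg_left h1 ht).trans htc
      -- On `[0,1]`, `exp x ≤ 1 + x + x²`. One factor of the square is bounded by its maximum `t H
      -- c`, so the estimate is affine in the return and its expectation is known from the value
      -- alone.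
      have hb := Real.abs_exp_sub_one_sub_id_le (x := t * G) (by rw [abs_of_nonneg hx0]; exact hx1)
      have hb' := (abs_le.1 hb).2
      have : (t * G) ^ 2 ≤ t * (t * (H * c)) * G := by
        have : G * G ≤ (H * c) * G := mul_le_mul_of_nonneg_right h1 h0
        nlinarith [mul_nonneg ht ht]
      nlinarith
    _ = ENNReal.ofReal (Real.exp (-(t * μ)) * (1 + t * (1 + t * (H * c)) * μ)) := by
      rw [PMF.expect_const_mul, PMF.expect_add, PMF.expect_const, PMF.expect_const_mul,
        D.expect_episodeLaw_retFrom H r π fun h hh s a => (hr h hh s a).1, ← hμ,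
        ← ENNReal.ofReal_mul (by positivity), ← ENNReal.ofReal_one,
        ← ENNReal.ofReal_add zero_le_one (by positivity), ← ENNReal.ofReal_mul (by positivity)]
    _ ≤ _ := by
      refine ENNReal.ofReal_le_ofReal ?_
      calc _ ≤ Real.exp (-(t * μ)) * Real.exp (t * (1 + t * (H * c)) * μ) := by
            gcongr
            linarith [Real.add_one_le_exp (t * (1 + t * (H * c)) * μ)]
        _ = Real.exp (t ^ 2 * (H * c) * μ) := by
            rw [← Real.exp_add]
            ring_nf
        _ ≤ _ := by
            refine Real.exp_le_exp.2 ?_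
            calc t ^ 2 * (H * c) * μ ≤ t ^ 2 * (H * c) * (H * c) :=
                  mul_le_mul_of_nonneg_left hμ1 (by positivity)
              _ = _ := by ring

/-- Bound for the moment generating function of the centred total reward. -/
theorem expect_exp_retFrom_le_of_abs_le (H : ℕ) (r : ℕ → S → A → ℝ) (π : Policy S A) (c t : ℝ)
    (hr : ∀ h < H, ∀ s a, |r h s a| ≤ c) (htc : |t| * (H * (2 * c)) ≤ 1) :
    (D.episodeLaw H π).expect (fun e => ENNReal.ofReal
      (Real.exp (t * (retFrom r 0 e - D.value H r π)))) ≤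
      ENNReal.ofReal (Real.exp (t ^ 2 * (H * (2 * c)) ^ 2)) := by
  -- A negative `t` is absorbed into the rewards; then adding `c` to each reward makes them lie in
  -- `[0, 2c]` and leaves the centred return unchanged.
  wlog ht : 0 ≤ t generalizing r t
  · have := this (fun h s a => -r h s a) (-t) (fun h hh s a => by simpa using hr h hh s a)
      (by simpa using htc) (by linarith)
    simp only [retFrom_neg, value_neg, neg_sq] at this
    refine le_of_eq_of_le ?_ this
    congr 1
    funext e
    ring_nf
  have h1 := D.expect_exp_retFrom_le H (fun h s a => r h s a + c) π (2 * c) t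
    (fun h hh s a => by
      have := abs_le.1 (hr h hh s a)
      exact ⟨by linarith, by linarith⟩) ht (by rwa [abs_of_nonneg ht] at htc)
  refine le_of_eq_of_le (PMF.expect_congr_support _ fun e he => ?_) h1
  have hl := D.length_of_episodeLaw_ne_zero H π e he
  have h2 := D.value_lin H r (fun _ _ _ => c) 1 π
  simp only [one_mul, value_const] at h2
  rw [retFrom_add_const, hl, h2]
  ring_nf

end Dynamics

/-- Applied to the finitely many plans: a plan whose value is within less than `g` of the optimum is
exactly optimal, so that committing to it costs nothing. The gap depends on the MDP, as the
constants may. -/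
theorem exists_pos_gap {ι : Type*} [Finite ι] (v : ι → ℝ) (w : ℝ) :
    ∃ g, 0 < g ∧ ∀ i, v i < w → v i + g ≤ w := by
  classical
  cases isEmpty_or_nonempty ι
  · exact ⟨1, one_pos, fun i => isEmptyElim i⟩
  obtain ⟨i₀, hi₀⟩ := Finite.exists_min fun i => if v i < w then w - v i else 1
  refine ⟨if v i₀ < w then w - v i₀ else 1, ?_, fun i hi => ?_⟩
  · split_ifs with h
    · linarith
    · exact one_pos
  · have := hi₀ i
    rw [if_pos hi] at this
    linarith

/-! ### The learner: explore-then-commit with restarts -/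

namespace RobustExplore

open Episode

variable {S A : Type*}

/-- What a learner with rewards `r` sees of an episode. -/
def obs (r : ℕ → S → A → ℝ) (e : Episode S A) : ObsEpisode S A :=
  e.mapIdx fun i x => (x.1, x.2, r i x.1 x.2)

/-- The states and actions of an observed episode. -/
def path (e : ObsEpisode S A) : Episode S A := e.map fun x => (x.1, x.2.1)

/-- Total observed reward. -/
def total (e : ObsEpisode S A) : ℝ := (e.map fun x => x.2.2).sum

theorem path_obs (r : ℕ → S → A → ℝ) (e : Episode S A) : path (obs r e) = e := by
  refine List.ext_getElem? fun i => ?_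
  simp only [path, obs, List.getElem?_map, List.getElem?_mapIdx, Option.map_map]
  cases e[i]? <;> rfl

theorem total_obs (r : ℕ → S → A → ℝ) (e : Episode S A) : total (obs r e) = retFrom r 0 e := by
  have : ∀ h, (e.mapIdx fun i x => r (h + i) x.1 x.2).sum = retFrom r h e := by
    induction e with
    | nil => intro h; simp [retFrom]
    | cons x e ih =>
      intro h
      simp only [List.mapIdx_cons, List.sum_cons, retFrom, add_zero]
      rw [← ih (h + 1)]
      simp only [Nat.add_assoc, Nat.add_comm 1]
  rw [← this 0, total, obs]
  congr 1
  refine List.ext_getElem? fun i => ?_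
  simp only [List.getElem?_map, List.getElem?_mapIdx, Option.map_map, zero_add]
  rfl

variable (S A) in
/-- Deterministic policies for `H` steps. -/
abbrev Plan (H : ℕ) := Fin H → S → A

variable {H : ℕ}

/-- Extension of a plan to all steps. -/
noncomputable def Plan.extend [Nonempty A] (d : Plan S A H) : ℕ → S → A := fun h s =>
  if hh : h < H then d ⟨h, hh⟩ s else Classical.arbitrary A

/-- The policy of a plan. -/
noncomputable def Plan.policy [Nonempty A] (d : Plan S A H) : Policy S A := detPolicy d.extend

variable [Fintype S] [Fintype A] [DecidableEq S] [Nonempty A]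

variable (S A H) in
/-- Number of plans. -/
noncomputable def numPlans : ℕ := Fintype.card (Plan S A H)

theorem numPlans_pos : 0 < numPlans S A H := Fintype.card_pos

/-- The plans are explored in turns. -/
noncomputable def scheduled (n : ℕ) : Plan S A H :=
  (Fintype.equivFin (Plan S A H)).symm ⟨n % numPlans S A H, Nat.mod_lt _ numPlans_pos⟩

theorem scheduled_eq_iff (n : ℕ) (d : Plan S A H) :
    scheduled n = d ↔ n % numPlans S A H = Fintype.equivFin (Plan S A H) d := by
  rw [scheduled, Equiv.symm_apply_eq, Fin.ext_iff]

open Classical in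
/-- How often a plan is named in the first `n` explored episodes. -/
noncomputable def turns (d : Plan S A H) (n : ℕ) : ℕ := Nat.count (fun i => scheduled i = d) n

theorem turns_zero (d : Plan S A H) : turns d 0 = 0 := by simp [turns]

theorem turns_succ_of_eq {d : Plan S A H} {n : ℕ} (h : scheduled n = d) :
    turns d (n + 1) = turns d n + 1 := by simp [turns, Nat.count_succ, h]

theorem turns_succ_of_ne {d : Plan S A H} {n : ℕ} (h : scheduled n ≠ d) :
    turns d (n + 1) = turns d n := by simp [turns, Nat.count_succ, h]

theorem turns_mul (d : Plan S A H) (m : ℕ) : turns d (numPlans S A H * m) = m := by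
  classical
  induction m with
  | zero => simp [turns]
  | succ m ih =>
    rw [Nat.mul_succ, turns, Nat.count_add]
    change turns d _ + _ = _
    rw [ih]
    congr 1
    -- The schedule is periodic, so each further block of `numPlans` turns contains each plan once.
    have : ∀ k, scheduled (H := H) (numPlans S A H * m + k) = (scheduled k : Plan S A H) := by
      intro k
      rw [scheduled_eq_iff, scheduled, Equiv.apply_symm_apply]
      simp
    simp only [this, scheduled_eq_iff, Nat.count_eq_card_filter_range]
    rw [Finset.card_eq_one]
    refine ⟨Fintype.equivFin (Plan S A H) d, ?_⟩
    ext k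
    simp only [Finset.mem_filter, Finset.mem_range, Finset.mem_singleton]
    constructor
    · rintro ⟨h1, h2⟩
      rwa [Nat.mod_eq_of_lt h1] at h2
    · intro h
      have hk : k < numPlans S A H := h ▸ (Fintype.equivFin (Plan S A H) d).2
      exact ⟨hk, by rw [Nat.mod_eq_of_lt hk, h]⟩

open Classical in
/-- One step of the exploration. The state consists of the number of episodes since the last restart
and the scores of the plans. -/
noncomputable def step (M : ℕ) (st : ℕ × (Plan S A H → ℝ)) (e : ObsEpisode S A) :
    ℕ × (Plan S A H → ℝ) :=
  if st.1 = M then st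
  else if Follows (scheduled st.1 : Plan S A H).extend 0 (path e) then
    (st.1 + 1, fun d => st.2 d + if scheduled st.1 = d then total e else 0)
  else (0, 0)

/-- State of the exploration after a list of episodes. -/
noncomputable def track (M : ℕ) (hist : List (ObsEpisode S A)) : ℕ × (Plan S A H → ℝ) :=
  hist.foldl (step M) (0, 0)

/-- A plan of largest score. -/
noncomputable def best (score : Plan S A H → ℝ) : Plan S A H :=
  (Finite.exists_max score).choose

theorem le_best (score : Plan S A H → ℝ) (d : Plan S A H) : score d ≤ score (best score) :=
  (Finite.exists_max score).choose_spec d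

open Classical in
/-- The plan named in a state of the exploration. -/
noncomputable def named (M : ℕ) (st : ℕ × (Plan S A H → ℝ)) : Plan S A H :=
  if st.1 = M then best st.2 else scheduled st.1

/-- Number of episodes in which each plan is explored. -/
noncomputable def repeats (T : ℕ) : ℕ := ⌈Real.log T ^ 2⌉₊

variable (S A H) in
/-- Length of the exploration. -/
noncomputable def exploreLen (T : ℕ) : ℕ := numPlans S A H * repeats T

variable (S A H) in
/-- Explore-then-commit over the deterministic policies, robust against deviations: the exploration
restarts whenever an episode does not follow the policy that was named for it. -/
noncomputable def alg : RLAlg S A := fun T hist =>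
  (named (H := H) (exploreLen S A H T) (track (exploreLen S A H T) hist)).extend

theorem track_append (M : ℕ) (l : List (ObsEpisode S A)) (e : ObsEpisode S A) :
    track (H := H) M (l ++ [e]) = step M (track M l) e := by simp [track]

theorem step_of_eq {M : ℕ} {st : ℕ × (Plan S A H → ℝ)} (h : st.1 = M) (e : ObsEpisode S A) :
    step M st e = st := if_pos h

theorem step_fst_le {M : ℕ} {st : ℕ × (Plan S A H → ℝ)} (h : st.1 ≤ M) (e : ObsEpisode S A) :
    (step M st e).1 ≤ M := by
  unfold step
  split_ifs with h1 h2
  · exact h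
  · simp only
    omega
  · exact Nat.zero_le _

theorem track_fst_le (M : ℕ) (l : List (ObsEpisode S A)) : (track (H := H) M l).1 ≤ M := by
  induction l using List.reverseRecOn with
  | nil => exact Nat.zero_le _
  | append_singleton l e ih =>
    rw [track_append]
    exact step_fst_le ih e

/-! ### Exploration under an arbitrary agent: its length and its accuracy -/

section Exploration

variable (M N : ℕ) (rew : List (Episode S A) → ℕ → S → A → ℝ)

/-- State of the exploration when it starts after `N` episodes, with rewards that depend on
these. -/
noncomputable def state (hist : List (Episode S A)) : ℕ × (Plan S A H → ℝ) :=
  track M ((hist.drop N).map (obs (rew (hist.take N))))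

theorem state_of_length_le {hist : List (Episode S A)} (h : hist.length ≤ N) :
    state (H := H) M N rew hist = (0, 0) := by
  rw [state, List.drop_of_length_le h]
  rfl

theorem state_append {hist : List (Episode S A)} (h : N ≤ hist.length) (e : Episode S A) :
    state (H := H) M N rew (hist ++ [e]) =
      step M (state M N rew hist) (obs (rew (hist.take N)) e) := by
  rw [state, List.drop_append_of_le_length h, List.take_append_of_le_length h, List.map_append,
    List.map_singleton, track_append]
  rfl

theorem state_fst_le (hist : List (Episode S A)) : (state (H := H) M N rew hist).1 ≤ M :=
  track_fst_le _ _

/-- The state does not change after the exploration. -/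
theorem state_eq_of_take {hist : List (Episode S A)} {k : ℕ} (hk : k ≤ hist.length) (hN : N ≤ k)
    (h : (state (H := H) M N rew (hist.take k)).1 = M) :
    state (H := H) M N rew hist = state M N rew (hist.take k) := by
  induction hist using List.reverseRecOn with
  | nil => simp
  | append_singleton l e ih =>
    rcases Nat.lt_or_ge l.length k with h1 | h1
    · rw [List.take_of_length_le (by simp; omega)]
    · rw [List.take_append_of_le_length h1] at h ⊢
      rw [state_append _ _ _ (hN.trans h1), ih h1 h, step_of_eq h]

/-- The exploration lasts at most `M` episodes for each deviation, plus `M`. -/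
theorem pathSum_explore_le (hist : List (Episode S A)) :
    pathSum (fun p _ => ind (N ≤ p.length ∧ (state (H := H) M N rew p).1 ≠ M)) hist ≤
      M * pathSum (fun p e => ind (N ≤ p.length ∧
        ¬ Follows (named (H := H) M (state M N rew p)).extend 0 e)) hist +
        (state (H := H) M N rew hist).1 := by
  -- The counter serves as a potential. An exploring episode that follows the plan raises it by one;
  -- one that deviates resets it from at most `M - 1` to zero, which the extra term `M` on the right
  -- pays for.
  induction hist using List.reverseRecOn with
  | nil => simp [pathSum_nil]
  | append_singleton l e ih =>
    rw [pathSum_concat, pathSum_concat]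
    rcases Nat.lt_or_ge l.length N with h1 | h1
    · rw [ind_of_false (by omega), ind_of_false (by omega),
        state_of_length_le (hist := l ++ [e]) M N rew (by simp; omega)]
      rw [state_of_length_le M N rew h1.le] at ih
      simpa using ih
    rw [state_append _ _ _ h1]
    by_cases h2 : (state (H := H) M N rew l).1 = M
    · rw [step_of_eq h2, ind_of_false (fun h => h.2 h2)]
      have := mul_nonneg (Nat.cast_nonneg M) (ind_nonneg (N ≤ l.length ∧
        ¬ Follows (named (H := H) M (state M N rew l)).extend 0 e))
      rw [mul_add]
      linarith
    · rw [ind_of_true ⟨h1, h2⟩]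
      have hle := state_fst_le (H := H) M N rew l
      have hM : (((state (H := H) M N rew l).1 : ℝ)) + 1 ≤ M := by
        exact_mod_cast lt_of_le_of_ne hle h2
      have hn : named M (state (H := H) M N rew l) = scheduled (state (H := H) M N rew l).1 :=
        if_neg h2
      by_cases h3 : Follows (scheduled (state (H := H) M N rew l).1 : Plan S A H).extend 0 e
      · rw [hn, ind_of_false (fun h => h.2 h3), step, if_neg h2, path_obs, if_pos h3]
        push_cast
        linarith
      · rw [hn, ind_of_true ⟨h1, h3⟩, step, if_neg h2, path_obs, if_neg h3]
        push_cast
        linarith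

variable (D : Dynamics S A) (play : List (Episode S A) → Policy S A)

/-- Between restarts this is the usual exponential process of centred returns, compensated by their
moment bound. The agent may select the trajectories on which he follows the plan, but this can only
lose mass compared with the plan's own law. Each restart sends the process to `exp 0 = 1`. So the
expectation grows by at most one per episode, which explains `1 + T`. The rewards may depend on the
first `N` episodes, since they are fixed before the exploration starts. -/
theorem expect_exp_score_le (c t : ℝ) (hr : ∀ p, ∀ h < H, ∀ s a, |rew p h s a| ≤ c)
    (htc : |t| * (H * (2 * c)) ≤ 1) (d : Plan S A H) (T : ℕ) :
    (D.runLaw H play T).expect (fun hist => ENNReal.ofReal (Real.exp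
      (t * ((state M N rew hist).2 d - turns d (state (H := H) M N rew hist).1 *
        D.value H (rew (hist.take N)) d.policy) -
        t ^ 2 * (H * (2 * c)) ^ 2 * turns d (state (H := H) M N rew hist).1))) ≤ 1 + T := by
  classical
  have key := D.expect_runLaw_le H play (fun hist => ENNReal.ofReal (Real.exp
      (t * ((state M N rew hist).2 d - turns d (state (H := H) M N rew hist).1 *
        D.value H (rew (hist.take N)) d.policy) -
        t ^ 2 * (H * (2 * c)) ^ 2 * turns d (state (H := H) M N rew hist).1))) 1 (fun hist => ?_) T
  · simpa [state, track, turns_zero] using key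
  rcases Nat.lt_or_ge hist.length N with h1 | h1
  · refine le_trans (le_of_eq ?_) le_add_self
    rw [← PMF.expect_const (D.episodeLaw H (play hist)) 1]
    congr 1
    funext e
    rw [state_of_length_le M N rew (hist := hist ++ [e]) (by simp; omega)]
    simp [turns_zero]
  simp only [state_append M N rew h1, List.take_append_of_le_length h1]
  set st := state (H := H) M N rew hist with hst
  set r := rew (hist.take N) with hr'
  set μ := D.value H r d.policy with hμ
  set w := t ^ 2 * (H * (2 * c)) ^ 2 with hw
  by_cases h2 : st.1 = M
  · simp only [step_of_eq h2, PMF.expect_const]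
    exact le_self_add
  set f := (scheduled st.1 : Plan S A H).extend with hf
  set F := ENNReal.ofReal (Real.exp (t * (st.2 d - turns d st.1 * μ) - w * turns d st.1)) with hF
  have hstep : ∀ e, step M st (obs r e) = if Follows f 0 e then
      (st.1 + 1, fun d => st.2 d + if scheduled st.1 = d then retFrom r 0 e else 0) else (0, 0) := by
    intro e
    rw [step, if_neg h2, path_obs, total_obs]
  set X : Episode S A → ℝ≥0∞ := fun e => F * if scheduled st.1 = d then
    ENNReal.ofReal (Real.exp (-w)) * ENNReal.ofReal (Real.exp (t * (retFrom r 0 e - μ))) else 1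
    with hX
  -- The summand `1` accounts for a restart.
  have hpt : ∀ e, ENNReal.ofReal (Real.exp (t * ((step M st (obs r e)).2 d -
      turns d (step M st (obs r e)).1 * μ) - w * turns d (step M st (obs r e)).1)) ≤
      (if Follows f 0 e then X e else 0) + 1 := by
    intro e
    rw [hstep]
    by_cases h3 : Follows f 0 e
    · simp only [if_pos h3]
      refine le_trans (le_of_eq ?_) le_self_add
      by_cases h4 : scheduled st.1 = d
      · simp only [hX, hF, if_pos h4, turns_succ_of_eq h4]
        rw [← ENNReal.ofReal_mul (by positivity), ← ENNReal.ofReal_mul (by positivity),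
          ← Real.exp_add, ← Real.exp_add]
        push_cast
        ring_nf
      · simp only [hX, hF, if_neg h4, turns_succ_of_ne h4, add_zero, mul_one]
    · simp [if_neg h3, turns_zero]
  calc _ ≤ _ := PMF.expect_mono _ hpt
    _ = (D.episodeLaw H (play hist)).expect (fun e => if Follows f 0 e then X e else 0) + 1 := by
        rw [PMF.expect_add, PMF.expect_const]
    _ ≤ F + 1 := by
        gcongr
        -- Here the agent's actual policy is replaced by the named plan, whatever that policy is.
        refine (D.expect_episodeLaw_follows_le H (play hist) f X).trans ?_
        rw [hX, PMF.expect_const_mul]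
        refine mul_le_of_le_one_right' ?_
        by_cases h4 : scheduled st.1 = d
        · simp only [if_pos h4]
          rw [PMF.expect_const_mul]
          have h5 := D.expect_exp_retFrom_le_of_abs_le H r (detPolicy f) c t
            (fun h hh s a => hr _ h hh s a) htc
          have h6 : detPolicy f = d.policy := by rw [hf, h4]; rfl
          rw [h6] at h5 ⊢
          calc _ ≤ ENNReal.ofReal (Real.exp (-w)) * ENNReal.ofReal (Real.exp w) := by gcongr
            _ = 1 := by
              rw [← ENNReal.ofReal_mul (by positivity), ← Real.exp_add]
              simp
        · simp only [if_neg h4, PMF.expect_const, le_refl]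

/-- The scores are accurate at the end of the exploration. -/
theorem runLaw_score_inaccurate_le (m : ℕ) (hM : M = numPlans S A H * m) (R δ : ℝ) (hδ : 0 < δ)
    (hδR : δ ≤ 2 * R) (c : ℝ) (hc : H * (2 * c) ≤ R) (hc0 : 0 ≤ c)
    (hr : ∀ p, ∀ h < H, ∀ s a, |rew p h s a| ≤ c) (d : Plan S A H) (T : ℕ) :
    (D.runLaw H play T).toOuterMeasure {hist | (state (H := H) M N rew hist).1 = M ∧
      δ * m < |(state M N rew hist).2 d - m * D.value H (rew (hist.take N)) d.policy|} ≤
      ENNReal.ofReal (2 * (1 + T) * Real.exp (-(δ ^ 2 / (4 * R ^ 2) * m))) := by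
  have hR : 0 < R := by linarith
  set b := (H : ℝ) * (2 * c) with hb
  have hb0 : 0 ≤ b := by positivity
  have key : ∀ t, |t| = δ / (2 * R ^ 2) → (D.runLaw H play T).toOuterMeasure
      {hist | (state (H := H) M N rew hist).1 = M ∧ δ * m * |t| <
        t * ((state M N rew hist).2 d - m * D.value H (rew (hist.take N)) d.policy)} ≤
      ENNReal.ofReal ((1 + T) * Real.exp (-(δ ^ 2 / (4 * R ^ 2) * m))) := by
    intro t ht
    -- The choice `|t| = δ / (2 R²)` optimizes `δ |t| - t² R²`, with value `δ² / (4 R²)` per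
    -- repetition; the two signs of `t` cover both tails.
    have h1 : |t| * b ≤ 1 := by
      calc |t| * b ≤ δ / (2 * R ^ 2) * R := by rw [ht]; gcongr
        _ = δ / (2 * R) := by field_simp
        _ ≤ 1 := by rw [div_le_one (by positivity)]; exact hδR
    have h2 := PMF.toOuterMeasure_le_of_expect_exp _ _ {hist | (state (H := H) M N rew hist).1 = M ∧
      δ * m * |t| < t * ((state M N rew hist).2 d - m * D.value H (rew (hist.take N)) d.policy)} _
      (δ ^ 2 / (4 * R ^ 2) * m) (expect_exp_score_le M N rew D play c t hr h1 d T) ?_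
    · refine h2.trans (le_of_eq ?_)
      rw [ENNReal.ofReal_mul (by positivity), ENNReal.ofReal_add (by positivity) (by positivity)]
      simp
    · rintro hist ⟨h3, h4⟩
      rw [h3, hM, turns_mul, ← hM]
      have h5 : t ^ 2 * b ^ 2 ≤ δ ^ 2 / (4 * R ^ 2) := by
        rw [← sq_abs t, ht]
        calc (δ / (2 * R ^ 2)) ^ 2 * b ^ 2 ≤ (δ / (2 * R ^ 2)) ^ 2 * R ^ 2 := by gcongr
          _ = _ := by field_simp; norm_num
      have h6 : δ * m * |t| = 2 * (δ ^ 2 / (4 * R ^ 2) * m) := by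
        rw [ht]
        field_simp
        norm_num
      have h7 := mul_le_mul_of_nonneg_right h5 (Nat.cast_nonneg (α := ℝ) m)
      linarith
  have hpos : 0 ≤ δ / (2 * R ^ 2) := by positivity
  have h1 := key (δ / (2 * R ^ 2)) (abs_of_nonneg hpos)
  have h2 := key (-(δ / (2 * R ^ 2))) (by rw [abs_neg, abs_of_nonneg hpos])
  have hpos' : 0 < δ / (2 * R ^ 2) := by positivity
  rw [abs_of_nonneg hpos] at h1
  rw [abs_neg, abs_of_nonneg hpos] at h2
  refine (measure_mono (t := _ ∪ _) ?_).trans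
    ((measure_union_le _ _).trans ((add_le_add h1 h2).trans (le_of_eq ?_)))
  rotate_left
  · rw [← ENNReal.ofReal_add (by positivity) (by positivity)]
    ring_nf
  · rintro hist ⟨h4, h5⟩
    rcases lt_abs.1 h5 with h6 | h6
    · exact Or.inl ⟨h4, by nlinarith⟩
    · exact Or.inr ⟨h4, by nlinarith⟩

/-- With accurate scores, the plan chosen after the exploration is nearly optimal. -/
theorem value_le_value_best (m : ℕ) (hm : 0 < m) (v score : Plan S A H → ℝ) (δ : ℝ)
    (hacc : ∀ d, |score d - m * v d| ≤ δ * m) (d : Plan S A H) :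
    v d ≤ v (best score) + 2 * δ := by
  have h1 := abs_le.1 (hacc d)
  have h2 := abs_le.1 (hacc (best score))
  have h3 := le_best score d
  have hm' : (0 : ℝ) < m := by exact_mod_cast hm
  have : m * v d ≤ m * (v (best score) + 2 * δ) := by nlinarith
  exact le_of_mul_le_mul_left this hm'

end Exploration

end RobustExplore

/-! ### The regret exponent of the learner -/

/-- This is why plans are repeated `log² T` and not `log T` times: the learner does not know the
rate `c`, and with a square even a tiny rate beats every power of `T`, the price being the constant
`exp (1 / c)`. It follows from `2 x - c x² ≤ 1 / c`. -/
theorem one_add_mul_exp_neg_log_sq_le {c : ℝ} (hc : 0 < c) {T : ℕ} (hT : 1 ≤ T) {y : ℝ}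
    (hy : Real.log T ^ 2 ≤ y) :
    (1 + T) * Real.exp (-(c * y)) ≤ 2 * Real.exp (1 / c) * (T : ℝ)⁻¹ := by
  have hT' : (1 : ℝ) ≤ T := by exact_mod_cast hT
  have hT0 : (0 : ℝ) < T := by linarith
  have h1 : (T : ℝ) = Real.exp (Real.log T) := (Real.exp_log hT0).symm
  have h2 : (T : ℝ)⁻¹ = Real.exp (-Real.log T) := by rw [Real.exp_neg, ← h1]
  calc (1 + T) * Real.exp (-(c * y)) ≤ (2 * T) * Real.exp (-(c * Real.log T ^ 2)) := by
        gcongr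
        linarith
    _ = 2 * Real.exp (Real.log T - c * Real.log T ^ 2) := by
        rw [sub_eq_add_neg, Real.exp_add, ← h1]
        ring
    _ ≤ 2 * Real.exp (1 / c - Real.log T) := by
        refine mul_le_mul_of_nonneg_left (Real.exp_le_exp.2 ?_) (by norm_num)
        have : 2 * Real.log T - c * Real.log T ^ 2 ≤ 1 / c := by
          rw [le_div_iff₀ hc]
          nlinarith [sq_nonneg (c * Real.log T - 1)]
        linarith
    _ = _ := by
        rw [sub_eq_add_neg, Real.exp_add, ← h2]
        ring

theorem PMF.ofReal_one_sub_le {α ι : Type*} (p : PMF α) (I : Finset ι) (g : Set α)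
    (bad : ι → Set α) (ε : ℝ) (hε : 0 ≤ ε)
    (hbad : ∑ i ∈ I, p.toOuterMeasure (bad i) ≤ ENNReal.ofReal ε)
    (h : ∀ a, p a ≠ 0 → (∀ i ∈ I, a ∉ bad i) → a ∈ g) :
    ENNReal.ofReal (1 - ε) ≤ p.toOuterMeasure g := by
  have h1 := p.add_toOuterMeasure_le I Set.univ Set.univ g bad fun a ha _ _ => h a ha
  have hu : p.toOuterMeasure Set.univ = 1 := by
    rw [PMF.toOuterMeasure_apply_eq_one_iff]
    exact Set.subset_univ _
  rw [hu, add_left_comm, ENNReal.add_le_add_iff_left ENNReal.one_ne_top] at h1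
  rw [ENNReal.ofReal_sub _ hε, ENNReal.ofReal_one, tsub_le_iff_right]
  exact h1.trans (by gcongr)

theorem half_le_log {T : ℕ} (hT : 2 ≤ T) : 1 / 2 ≤ Real.log T := by
  have : Real.log 2 ≤ Real.log T := Real.log_le_log (by norm_num) (by exact_mod_cast hT)
  linarith [Real.log_two_gt_d9]

namespace Dynamics

variable {S A : Type*} (D : Dynamics S A) [Fintype S] [Fintype A]

theorem abs_value_le {r : ℕ → S → A → ℝ} {c : ℝ} (H : ℕ) (hr : ∀ h < H, ∀ s a, |r h s a| ≤ c)
    (π : Policy S A) : |D.value H r π| ≤ H * c := by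
  have h1 := D.value_mono (r := fun _ _ _ => -c) (r' := r) H π
    fun h hh s a => (abs_le.1 (hr h hh s a)).1
  have h2 := D.value_mono (r := r) (r' := fun _ _ _ => c) H π
    fun h hh s a => (abs_le.1 (hr h hh s a)).2
  rw [value_const] at h1 h2
  exact abs_le.2 ⟨by linarith, h2⟩

end Dynamics

namespace RobustExplore

open Episode

variable {S A : Type*} {H : ℕ} [Fintype S] [Fintype A] [DecidableEq S] [Nonempty A]

theorem exists_plan_value_eq_optValue (D : Dynamics S A) (r : ℕ → S → A → ℝ) :
    ∃ d : Plan S A H, D.value H r d.policy = D.optValue H r := by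
  obtain ⟨f, hf, -⟩ := D.exists_det_value_eq_optValue H r
  refine ⟨fun h s => f h s, ?_⟩
  rw [← hf]
  refine D.value_congr_det H r fun h hh s => ?_
  simp [Plan.extend, hh]

theorem repeats_pos {T : ℕ} (hT : 2 ≤ T) : 0 < repeats T := by
  refine Nat.ceil_pos.2 ?_
  have := half_le_log hT
  positivity

theorem exploreLen_le {T : ℕ} (hT : 2 ≤ T) :
    (exploreLen S A H T : ℝ) ≤ numPlans S A H * (5 * Real.log T ^ 2) := by
  rw [exploreLen]
  push_cast
  gcongr
  have h1 := Nat.ceil_lt_add_one (sq_nonneg (Real.log T))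
  have h2 := half_le_log hT
  rw [repeats]
  nlinarith

theorem play_alg (r : ℕ → S → A → ℝ) (T : ℕ) (hist : List (Episode S A)) :
    (alg S A H).play r T hist =
      (named (H := H) (exploreLen S A H T)
        (state (exploreLen S A H T) 0 (fun _ => r) hist)).policy := rfl

/-- The learner follows his own plans, so the exploration is polylogarithmic in length, and by the
gap the plan chosen afterwards is exactly optimal. The regret is thus `O(log³ T)`, within every
exponent `γ ≥ 0`. -/
theorem hasRegretExponent_alg (H : ℕ) (γ : ℝ) (hγ : 0 ≤ γ) :
    (alg S A H).HasRegretExponent H γ := by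
  intro D r
  obtain ⟨c, hc0, hc⟩ : ∃ c, 0 ≤ c ∧ ∀ h < H, ∀ s a, |r h s a| ≤ c := by
    obtain ⟨c, hc⟩ := (Set.finite_range fun x : Fin H × S × A =>
      |r x.1 x.2.1 x.2.2|).bddAbove
    refine ⟨max c 0, le_max_right _ _, fun h hh s a => le_max_of_le_left ?_⟩
    exact hc ⟨(⟨h, hh⟩, s, a), rfl⟩
  set w := D.optValue H r with hw
  obtain ⟨g, hg0, hg⟩ := exists_pos_gap (fun d : Plan S A H => D.value H r d.policy) w
  obtain ⟨d₀, hd₀⟩ := exists_plan_value_eq_optValue (H := H) D r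
  -- An accuracy `δ` per plan makes the chosen plan `2 δ`-optimal, and `2 δ < g` forces optimality.
  set δ := g / 3 with hδ
  -- The summand `g` keeps `R` positive and `δ ≤ 2 R` even when all rewards vanish.
  set R := H * (2 * c) + g with hR
  have hHc : 0 ≤ (H : ℝ) * (2 * c) := by positivity
  set c₀ := δ ^ 2 / (4 * R ^ 2) with hc₀
  have hc₀pos : 0 < c₀ := by positivity
  set n := numPlans S A H with hn
  set C₁ := 1 + n * (4 * Real.exp (1 / c₀)) with hC₁
  set C₂ := H * (2 * c) * (15 * n) with hC₂
  have hC₁0 : 0 ≤ C₁ := by positivity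
  have hC₂0 : 0 ≤ C₂ := by positivity
  -- Of the three logarithms, two come from the exploration length and one from the tail bound `log
  -- T` on the number of deviations, whose mean is zero here.
  refine ⟨C₁ + C₂, 1, 3, one_pos, fun T hT => ?_⟩
  have hT1 : (1 : ℝ) ≤ T := by exact_mod_cast (by omega : 1 ≤ T)
  have hT0 : (0 : ℝ) < T := by linarith
  have hlog := half_le_log hT
  set M := exploreLen S A H T with hM
  have hMle := exploreLen_le (S := S) (A := A) (H := H) hT
  rw [← hM, ← hn] at hMle
  set st := state (H := H) M 0 (fun _ => r) with hst
  let bad : Option (Plan S A H) → Set (List (Episode S A)) := fun o =>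
    match o with
    | none => {hist | 2 * pathSum (fun _ _ => (0 : ℝ)) hist + Real.log T ≤
        pathSum (fun p e => ind (0 ≤ p.length ∧ ¬ Follows (named M (st p)).extend 0 e)) hist}
    | some d => {hist | (st hist).1 = M ∧ δ * repeats T <
        |(st hist).2 d - repeats T * D.value H r d.policy|}
  have key := PMF.ofReal_one_sub_le (D.runLaw H ((alg S A H).play r T) T)
    (Finset.univ : Finset (Option (Plan S A H)))
    {hist | ∑ k ∈ Finset.range T, (w - D.value H r ((alg S A H).play r T (hist.take k)))
      ≤ (C₁ + C₂) * (T : ℝ) ^ γ * Real.log T ^ 3} bad (C₁ * (T : ℝ)⁻¹) (by positivity) ?_ ?_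
  · refine le_trans (ENNReal.ofReal_le_ofReal ?_) key
    rw [Real.rpow_neg_one]
    have : 0 ≤ C₂ * (T : ℝ)⁻¹ := by positivity
    linarith
  · rw [Fintype.sum_option]
    have h1 : (D.runLaw H ((alg S A H).play r T) T).toOuterMeasure (bad none) ≤
        ENNReal.ofReal ((T : ℝ)⁻¹) := by
      have := D.runLaw_count_ge H ((alg S A H).play r T)
        (fun p e => 0 ≤ p.length ∧ ¬ Follows (named M (st p)).extend 0 e) (fun _ => 0)
        (fun _ => le_rfl) (fun p => ?_) T (Real.log T)
      · rwa [Real.exp_neg, Real.exp_log hT0] at this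
      · have h2 := D.episodeLaw_not_follows_le H ((alg S A H).play r T p)
          (named M (st p)).extend
        rw [play_alg, Plan.policy, ← hM, ← hst, D.value_det_deviation] at h2
        rw [play_alg, Plan.policy, ← hM, ← hst]
        simpa using h2
    have h2 : ∀ d, (D.runLaw H ((alg S A H).play r T) T).toOuterMeasure (bad (some d)) ≤
        ENNReal.ofReal (4 * Real.exp (1 / c₀) * (T : ℝ)⁻¹) := by
      intro d
      refine (runLaw_score_inaccurate_le M 0 (fun _ => r) D ((alg S A H).play r T) (repeats T) rfl
        R δ (by positivity) (by linarith) c (by linarith) hc0 (fun _ => hc) d T).trans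
          (ENNReal.ofReal_le_ofReal ?_)
      have := one_add_mul_exp_neg_log_sq_le hc₀pos (by omega : 1 ≤ T)
        (Nat.le_ceil (Real.log T ^ 2))
      rw [← repeats] at this
      linarith
    calc _ ≤ ENNReal.ofReal ((T : ℝ)⁻¹) + ∑ _d : Plan S A H,
          ENNReal.ofReal (4 * Real.exp (1 / c₀) * (T : ℝ)⁻¹) :=
          add_le_add h1 (Finset.sum_le_sum fun d _ => h2 d)
      _ = ENNReal.ofReal (C₁ * (T : ℝ)⁻¹) := by
          rw [← ENNReal.ofReal_sum_of_nonneg fun _ _ => by positivity,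
            ← ENNReal.ofReal_add (by positivity) (Finset.sum_nonneg fun _ _ => by positivity)]
          congr 1
          rw [Finset.sum_const, Finset.card_univ, nsmul_eq_mul, hC₁, hn, numPlans]
          ring
  · intro hist hh hgood
    have hlen := D.length_of_runLaw_ne_zero H _ T hist hh
    have hunclean := hgood none (Finset.mem_univ _)
    have hscore := fun d => hgood (some d) (Finset.mem_univ _)
    simp only [bad, Set.mem_ofPred_eq, not_le, not_and, not_lt] at hunclean hscore
    have hz : pathSum (fun (_ : List (Episode S A)) (_ : Episode S A) => (0 : ℝ)) hist = 0 := by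
      simp [pathSum]
    rw [hz, mul_zero, zero_add] at hunclean
    have hexp := pathSum_explore_le (H := H) M 0 (fun _ => r) hist
    have hfst := state_fst_le (H := H) M 0 (fun _ => r) hist
    have hsum := pathSum_eq_sum_range
      (fun p => w - D.value H r ((alg S A H).play r T p)) hist
    rw [hlen] at hsum
    rw [Set.mem_ofPred_eq, ← hsum]
    have hle : pathSum (fun p _ => w - D.value H r ((alg S A H).play r T p)) hist ≤
        pathSum (fun p _ => H * (2 * c) * ind (0 ≤ p.length ∧ (st p).1 ≠ M)) hist := by
      refine pathSum_mono fun k hk => ?_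
      rw [play_alg, ← hM, ← hst]
      by_cases h1 : (st (hist.take k)).1 = M
      · rw [ind_of_false fun h => h.2 h1, mul_zero, named, if_pos h1]
        have hfin := state_eq_of_take (H := H) M 0 (fun _ => r) hk.le (Nat.zero_le k) h1
        rw [← hst] at hfin
        rw [← hfin] at h1 ⊢
        have hb := value_le_value_best (repeats T) (repeats_pos hT)
          (fun d => D.value H r d.policy) (st hist).2 δ (fun d => hscore d h1) d₀
        rw [hd₀, ← hw] at hb
        by_contra hlt
        have := hg (best (st hist).2) (by linarith)
        linarith
      · rw [ind_of_true ⟨Nat.zero_le _, h1⟩, mul_one]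
        have h2 := abs_le.1 (D.abs_value_le H hc (named M (st (hist.take k))).policy)
        have h3 := abs_le.1 (D.abs_value_le H hc d₀.policy)
        rw [hd₀, ← hw] at h3
        linarith
    refine hle.trans ?_
    rw [pathSum_const_mul]
    have h4 : pathSum (fun p _ => ind (0 ≤ p.length ∧ (st p).1 ≠ M)) hist ≤
        15 * n * Real.log T ^ 3 := by
      have hfst' : ((state (H := H) M 0 (fun _ => r) hist).1 : ℝ) ≤ M := by exact_mod_cast hfst
      calc _ ≤ M * Real.log T + M := hexp.trans (add_le_add (by gcongr) hfst')
        _ ≤ M * (3 * Real.log T) := by nlinarith [Nat.cast_nonneg (α := ℝ) M]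
        _ ≤ n * (5 * Real.log T ^ 2) * (3 * Real.log T) := by gcongr
        _ = _ := by ring
    calc _ ≤ H * (2 * c) * (15 * n * Real.log T ^ 3) := by gcongr
      _ = C₂ * 1 * Real.log T ^ 3 := by rw [hC₂]; ring
      _ ≤ (C₁ + C₂) * (T : ℝ) ^ γ * Real.log T ^ 3 := by
          gcongr
          · linarith
          · exact Real.one_le_rpow hT1 hγ

end RobustExplore

/-! ### Single offers: visits, and the agent's cost of a wrong choice -/

namespace Episode

variable {S A : Type*}

/-- The state-action pair of the episode at step `h` satisfies `Q`. -/
def Occurs (h : ℕ) (Q : S × A → Prop) (e : Episode S A) : Prop := ∃ x, e[h]? = some x ∧ Q x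

end Episode

namespace Dynamics

open Episode

variable {S A : Type*} (D : Dynamics S A) [Fintype S] [Fintype A]

/-- Markov's inequality: the reward that pays one for the event has a return of at least one on it.
Expressing the bound as a value lets it be compared with the agent's loss. -/
theorem episodeLaw_occurs_le (H h : ℕ) (π : Policy S A) (Q : S × A → Prop) :
    (D.episodeLaw H π).toOuterMeasure {e | Occurs h Q e} ≤
      ENNReal.ofReal (D.value H (fun h' s a => ind (h' = h ∧ Q (s, a))) π) := by
  rw [← D.expect_episodeLaw_retFrom H _ π fun _ _ _ _ => ind_nonneg _,
    PMF.toOuterMeasure_eq_expect]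
  refine PMF.expect_mono _ fun e => ?_
  by_cases he : Occurs h Q e
  · obtain ⟨x, hx, hQ⟩ := he
    have := le_retFrom_of_getElem? (fun h' s a => ind (h' = h ∧ Q (s, a)))
      (fun _ _ _ => ind_nonneg _) 0 h e x hx
    rw [ind_of_true ⟨by simp, hQ⟩] at this
    have hm : e ∈ {e : Episode S A | Occurs h Q e} := ⟨x, hx, hQ⟩
    rw [Set.indicator_of_mem hm]
    simpa using this
  · simp [he]

theorem le_episodeLaw_visit {H : ℕ} (hD : D.UniformlyErgodic H) :
    ∃ c : ℝ, 0 < c ∧ ∀ h < H, ∀ s, D.Reachable h s → ∀ π : Policy S A, ENNReal.ofReal c ≤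
      (D.episodeLaw H π).toOuterMeasure {e | Occurs h (fun x => x.1 = s) e} := by
  obtain ⟨c, hc0, hc⟩ := hD
  -- The ergodicity constant lives in `ℝ≥0∞`; the minimum with `1` makes it finite.
  have hne : min c 1 ≠ ∞ := ne_top_of_le_ne_top ENNReal.one_ne_top (min_le_right _ _)
  refine ⟨(min c 1).toReal, ENNReal.toReal_pos ?_ hne, fun h hh s hs π => ?_⟩
  · simpa using hc0.ne'
  · rw [ENNReal.ofReal_toReal hne]
    refine (min_le_left _ _).trans ((hc h hh s hs π).trans ?_)
    rw [← D.episodeLaw_state H h hh π s]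
    refine measure_mono fun e he => ?_
    simpa [Occurs] using he

theorem optQ_mem_Icc [Nonempty A] {r : ℕ → S → A → ℝ} (hr : ∀ h s a, r h s a ∈ Set.Icc (0 : ℝ) 1)
    (n h : ℕ) (s : S) (a : A) : D.optQ r n h s a ∈ Set.Icc (0 : ℝ) n := by
  induction n generalizing h s a with
  | zero => simp [optQ]
  | succ n ih =>
    have hV : ∀ s', D.optV r n (h + 1) s' ∈ Set.Icc (0 : ℝ) n := by
      intro s'
      obtain ⟨b, hb⟩ := D.exists_optQ_eq_optV r n (h + 1) s'
      rw [← hb]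
      exact ih _ _ _
    rw [optQ_succ]
    have h1 : 0 ≤ ∑ s', (D.trans s a s').toReal * D.optV r n (h + 1) s' :=
      Finset.sum_nonneg fun s' _ => mul_nonneg ENNReal.toReal_nonneg (hV s').1
    have h2 : ∑ s', (D.trans s a s').toReal * D.optV r n (h + 1) s' ≤ n := by
      calc _ ≤ ∑ s', (D.trans s a s').toReal * n :=
            Finset.sum_le_sum fun s' _ => mul_le_mul_of_nonneg_left (hV s').2 ENNReal.toReal_nonneg
        _ = n := by rw [← Finset.sum_mul, PMF.sum_toReal_eq_one, one_mul]
    have h3 := hr h s a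
    push_cast
    exact ⟨by linarith [h3.1], by linarith [h3.2]⟩

end Dynamics

namespace PrincipalAgentMDP

open Episode

variable {S A : Type*} (M : PrincipalAgentMDP S A) [Fintype S] [Fintype A] [Nonempty A]

theorem agentReward_zero_mem (h : ℕ) (s : S) (a : A) :
    M.agentReward 0 h s a ∈ Set.Icc (0 : ℝ) 1 := by
  simpa [agentReward] using M.rA_mem s a

/-- The maximum over `a'` is attained at an optimal action, where the difference is nonnegative, so
the positive part plays no role. The minimal transfer is the optimal advantage with the opposite
sign. -/
theorem minTransfer_eq (H h : ℕ) (s : S) (a : A) :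
    M.minTransfer H h s a = M.optV (M.agentReward 0) (H - h) h s -
      M.optQ (M.agentReward 0) (H - h) h s a := by
  refine le_antisymm (ciSup_le fun a' => max_le ?_ ?_) ?_
  · linarith [M.optQ_le_optV (M.agentReward 0) (H - h) h s a']
  · linarith [M.optQ_le_optV (M.agentReward 0) (H - h) h s a]
  · obtain ⟨b, hb⟩ := M.exists_optQ_eq_optV (M.agentReward 0) (H - h) h s
    rw [← hb]
    refine le_trans (le_max_left _ 0) (le_ciSup (f := fun a' => max
      (M.optQ (M.agentReward 0) (H - h) h s a' - M.optQ (M.agentReward 0) (H - h) h s a) 0)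
      (Set.finite_range _).bddAbove b)

theorem minTransfer_nonneg (H h : ℕ) (s : S) (a : A) : 0 ≤ M.minTransfer H h s a := by
  rw [minTransfer_eq]
  linarith [M.optQ_le_optV (M.agentReward 0) (H - h) h s a]

theorem minTransfer_le (H h : ℕ) (s : S) (a : A) : M.minTransfer H h s a ≤ H := by
  rw [minTransfer_eq]
  obtain ⟨b, hb⟩ := M.exists_optQ_eq_optV (M.agentReward 0) (H - h) h s
  have h1 := (M.optQ_mem_Icc M.agentReward_zero_mem (H - h) h s b).2
  have h2 := (M.optQ_mem_Icc M.agentReward_zero_mem (H - h) h s a).1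
  have h3 : ((H - h : ℕ) : ℝ) ≤ H := by exact_mod_cast Nat.sub_le _ _
  linarith

/-- The agent's loss in an episode. -/
noncomputable def agentGap (H : ℕ) (τ : Transfer S A) (π : Policy S A) : ℝ :=
  M.optValue H (M.agentReward τ) - M.value H (M.agentReward τ) π

theorem agentGap_nonneg (H : ℕ) (τ : Transfer S A) (π : Policy S A) : 0 ≤ M.agentGap H τ π :=
  sub_nonneg.2 (M.value_le_optValue H _ π)

/-- Optimal state-action values when a transfer is offered for a single triple only. -/
theorem optQ_single {H h : ℕ} (hh : h < H) {s : S} {a : A} {x : ℝ≥0} {τ : Transfer S A}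
    (h1 : τ h s a = x)
    (h0 : ∀ h' s' a', ¬ (h' = h ∧ s' = s ∧ a' = a) → τ h' s' a' = 0) (b : A) :
    M.optQ (M.agentReward τ) (H - h) h s b =
      M.optQ (M.agentReward 0) (H - h) h s b + ind (b = a) * x := by
  rw [show H - h = (H - (h + 1)) + 1 by omega, Dynamics.optQ, Dynamics.optQ]
  have : ∀ s' a', M.optQ (M.agentReward τ) (H - (h + 1)) (h + 1) s' a' =
      M.optQ (M.agentReward 0) (H - (h + 1)) (h + 1) s' a' := by
    intro s' a'
    refine M.optQ_congr _ _ _ _ fun h' hh' s'' a'' => ?_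
    simp only [agentReward]
    rw [h0 h' s'' a'' (by omega)]
    rfl
  simp only [this]
  by_cases hb : b = a
  · subst hb
    rw [ind_of_true rfl]
    simp only [agentReward, h1, Pi.zero_apply, NNReal.coe_zero]
    ring
  · rw [ind_of_false hb]
    simp only [agentReward, h0 h s b (by tauto), Pi.zero_apply, NNReal.coe_zero]
    ring

/-- By `optValue_sub_value` the agent's loss is the value of the nonnegative suboptimality of his
actions under the offered transfers; those in `Q` contribute at least `δ` each time. -/
theorem mul_value_le_agentGap {H h : ℕ} (τ : Transfer S A) (π : Policy S A) (s : S) (δ : ℝ)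
    (Q : S × A → Prop)
    (hQ : ∀ s' b, Q (s', b) → s' = s ∧ δ ≤ M.optV (M.agentReward τ) (H - h) h s -
      M.optQ (M.agentReward τ) (H - h) h s b) :
    δ * M.value H (fun h' s' b => ind (h' = h ∧ Q (s', b))) π ≤ M.agentGap H τ π := by
  rw [agentGap, M.optValue_sub_value, ← M.value_const_mul]
  refine M.value_mono H π fun h' _ s' b => ?_
  have h3 := M.optQ_le_optV (M.agentReward τ) (H - h') h' s' b
  by_cases h4 : h' = h ∧ Q (s', b)
  · obtain ⟨rfl, h5⟩ := h4
    obtain ⟨rfl, h6⟩ := hQ _ _ h5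
    rw [ind_of_true ⟨rfl, h5⟩, mul_one]
    exact h6
  · rw [ind_of_false h4, mul_zero]
    linarith

/-- If the offer exceeds the minimal transfer, other actions are costly. -/
theorem agentGap_of_high {H h : ℕ} (hh : h < H) {s : S} {a : A} {x : ℝ≥0} {τ : Transfer S A}
    (h1 : τ h s a = x)
    (h0 : ∀ h' s' a', ¬ (h' = h ∧ s' = s ∧ a' = a) → τ h' s' a' = 0) {δ : ℝ}
    (hx : M.minTransfer H h s a + δ ≤ x) (π : Policy S A) :
    δ * M.value H (fun h' s' b => ind (h' = h ∧ (s' = s ∧ b ≠ a))) π ≤ M.agentGap H τ π := by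
  refine M.mul_value_le_agentGap τ π s δ (fun y => y.1 = s ∧ y.2 ≠ a) fun s' b hb => ⟨hb.1, ?_⟩
  have h2 := M.optQ_le_optV (M.agentReward τ) (H - h) h s a
  rw [M.optQ_single hh h1 h0, ind_of_true rfl] at h2
  rw [M.optQ_single hh h1 h0, ind_of_false hb.2]
  rw [M.minTransfer_eq] at hx
  linarith [M.optQ_le_optV (M.agentReward 0) (H - h) h s b]

/-- If the offer is below the minimal transfer, the action is costly. -/
theorem agentGap_of_low {H h : ℕ} (hh : h < H) {s : S} {a : A} {x : ℝ≥0} {τ : Transfer S A}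
    (h1 : τ h s a = x)
    (h0 : ∀ h' s' a', ¬ (h' = h ∧ s' = s ∧ a' = a) → τ h' s' a' = 0) {δ : ℝ} (hδ : 0 < δ)
    (hx : x + δ ≤ M.minTransfer H h s a) (π : Policy S A) :
    δ * M.value H (fun h' s' b => ind (h' = h ∧ ((s', b) = (s, a)))) π ≤ M.agentGap H τ π := by
  refine M.mul_value_le_agentGap τ π s δ (fun y => y = (s, a)) fun s' b hb => ?_
  obtain ⟨rfl, rfl⟩ := Prod.mk.inj hb
  refine ⟨rfl, ?_⟩
  obtain ⟨d, hd⟩ := M.exists_optQ_eq_optV (M.agentReward 0) (H - h) h s'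
  have h2 := M.optQ_le_optV (M.agentReward τ) (H - h) h s' d
  rw [M.minTransfer_eq, ← hd] at hx
  -- An optimal action without transfers has minimal transfer zero, which an offer of at least zero
  -- cannot miss by `δ > 0`.
  have hne : d ≠ b := by
    rintro rfl
    have := x.2
    rw [sub_self] at hx
    have h3 : (0 : ℝ) ≤ x := x.2
    linarith
  rw [M.optQ_single hh h1 h0, ind_of_false hne] at h2
  rw [M.optQ_single hh h1 h0, ind_of_true rfl]
  linarith

end PrincipalAgentMDP

/-! ### Phase one: the batched binary search -/

namespace TwoPhase

open Episode

variable {S A : Type*} [DecidableEq S] [DecidableEq A]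

theorem batch_take (L i K : ℕ) (l : List (ObsEpisode S A)) (hK : (i + 1) * L ≤ K) :
    batch L i (l.take K) = batch L i l := by
  have : i * L + L = (i + 1) * L := by ring
  rw [batch, batch, List.drop_take, List.take_take, min_eq_left (by omega)]

theorem batch_map (M : PrincipalAgentMDP S A) (L i : ℕ) (hist : List (Episode S A)) :
    batch L i (hist.map M.observe) = ((hist.drop (i * L)).take L).map M.observe := by
  rw [batch, List.map_take, List.map_drop]

theorem observe_getElem? (M : PrincipalAgentMDP S A) (e : Episode S A) (h : ℕ) :
    (M.observe e)[h]? = e[h]?.map fun x => (x.1, x.2, M.rP x.1 x.2) := by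
  simp [PrincipalAgentMDP.observe]

/-- Whether an episode with `l` predecessors belongs to the `i`-th batch. -/
def InBatch (L i l : ℕ) : Prop := i * L ≤ l ∧ l < i * L + L

theorem visits_batch (M : PrincipalAgentMDP S A) (L i : ℕ) (hist : List (Episode S A)) (h : ℕ)
    (s : S) : (visits (batch L i (hist.map M.observe)) h s : ℝ) =
      pathSum (fun p e => ind (InBatch L i p.length ∧ Occurs h (fun x => x.1 = s) e)) hist := by
  rw [visits, batch_map, List.countP_map, countP_window_eq_pathSum]
  congr 1
  funext p e
  congr 1
  simp only [Function.comp_apply, observe_getElem?, Occurs, InBatch, decide_eq_true_eq]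
  cases e[h]? <;> simp

theorem plays_batch (M : PrincipalAgentMDP S A) (L i : ℕ) (hist : List (Episode S A)) (h : ℕ)
    (s : S) (a : A) : (plays (batch L i (hist.map M.observe)) h s a : ℝ) =
      pathSum (fun p e => ind (InBatch L i p.length ∧ Occurs h (fun x => x = (s, a)) e)) hist := by
  rw [plays, batch_map, List.countP_map, countP_window_eq_pathSum]
  congr 1
  funext p e
  congr 1
  simp only [Function.comp_apply, observe_getElem?, Occurs, InBatch, decide_eq_true_eq]
  cases e[h]? <;> simp [Prod.ext_iff]

theorem ind_visit_eq (P : Prop) (h : ℕ) (s : S) (a : A) (e : Episode S A) :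
    ind (P ∧ Occurs h (fun x => x.1 = s) e) = ind (P ∧ Occurs h (fun x => x = (s, a)) e) +
      ind (P ∧ Occurs h (fun x => x.1 = s ∧ x.2 ≠ a) e) := by
  by_cases hP : P
  · unfold Occurs
    cases e[h]? with
    | none => simp [ind]
    | some x =>
      by_cases h1 : x.1 = s <;> by_cases h2 : x.2 = a <;> simp [ind, h1, h2, hP, Prod.ext_iff]
  · simp [ind, hP]

variable [Fintype S] [Fintype A]

/-- The offers are computed from the episodes seen so far, whereas the analysis refers to the
complete history; both see the same intervals once the relevant batches are over. -/
theorem interval_take (H L n K : ℕ) (l : List (ObsEpisode S A)) (q : Fin H × S × A) (j : ℕ)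
    (hK : (searchIndex H q * n + j) * L ≤ K) :
    interval H L n (l.take K) q j = interval H L n l q j := by
  induction j with
  | zero => rfl
  | succ j ih =>
    have h1 : (searchIndex H q * n + j + 1) * L ≤ K := hK
    have h2 : (searchIndex H q * n + j) * L ≤ K := le_trans (Nat.mul_le_mul_right _ (by omega)) h1
    simp only [interval]
    rw [ih h2, batch_take _ _ _ _ h1]

theorem searchIndex_lt (H : ℕ) (q : Fin H × S × A) :
    searchIndex H q < Fintype.card (Fin H × S × A) := (Fintype.equivFin _ q).2

theorem searchIndex_inj (H : ℕ) {q q' : Fin H × S × A} :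
    searchIndex H q = searchIndex H q' ↔ q = q' := by
  rw [searchIndex, searchIndex, ← Fin.ext_iff, EmbeddingLike.apply_eq_iff_eq]

theorem batch_index_lt {H n j : ℕ} (q : Fin H × S × A) (hj : j < n) :
    searchIndex H q * n + j + 1 ≤ Fintype.card (Fin H × S × A) * n := by
  calc searchIndex H q * n + j + 1 ≤ (searchIndex H q + 1) * n := by rw [Nat.add_mul]; omega
    _ ≤ _ := Nat.mul_le_mul_right _ (searchIndex_lt H q)

theorem estimate_take (H L n K : ℕ) (l : List (ObsEpisode S A))
    (hK : Fintype.card (Fin H × S × A) * n * L ≤ K) :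
    estimate H L n (l.take K) = estimate H L n l := by
  funext h s a
  unfold estimate
  split_ifs with hh
  · rw [interval_take]
    refine le_trans (Nat.mul_le_mul_right _ ?_) hK
    calc searchIndex H (⟨h, hh⟩, s, a) * n + n = (searchIndex H (⟨h, hh⟩, s, a) + 1) * n := by ring
      _ ≤ _ := Nat.mul_le_mul_right _ (searchIndex_lt H _)
  · rfl

theorem interval_le (H L n : ℕ) (l : List (ObsEpisode S A)) (q : Fin H × S × A) (j : ℕ) :
    ((interval H L n l q j).2 : ℝ) = (interval H L n l q j).1 + H / 2 ^ j ∧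
      ((interval H L n l q j).2 : ℝ) ≤ H := by
  induction j with
  | zero => simp [interval]
  | succ j ih =>
    obtain ⟨ih1, ih2⟩ := ih
    have h2 : (0 : ℝ) ≤ H / 2 ^ j := by positivity
    have h3 : (H : ℝ) / 2 ^ (j + 1) = H / 2 ^ j / 2 := by rw [pow_succ]; field_simp
    simp only [interval]
    split_ifs
    · simp only [NNReal.coe_div, NNReal.coe_add, NNReal.coe_ofNat, h3]
      exact ⟨by linarith, by linarith⟩
    · simp only [NNReal.coe_div, NNReal.coe_add, NNReal.coe_ofNat, h3]
      exact ⟨by linarith, by linarith⟩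

/-- Midpoint of the search interval. -/
noncomputable def midpoint (H L n : ℕ) (l : List (ObsEpisode S A)) (q : Fin H × S × A) (j : ℕ) :
    ℝ≥0 := ((interval H L n l q j).1 + (interval H L n l q j).2) / 2

variable (M : PrincipalAgentMDP S A) (B : RLAlg S A) (slack : ℝ≥0) (H : ℕ) (α β : ℝ) (T : ℕ)

/-- The transfers offered in the batch of a round of the search for `q`. -/
theorem offer_search {q : Fin H × S × A} {j k : ℕ} (hj : j < rounds H β T)
    {hist : List (Episode S A)} (hlen : phaseOneLen S A H α β T ≤ hist.length)
    (hk : InBatch (batchLen α T) (searchIndex H q * rounds H β T + j) k) (h : ℕ) (s : S) (a : A) :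
    M.offer (alg B slack H α β T) (hist.take k) h s a =
      if h = q.1 ∧ s = q.2.1 ∧ a = q.2.2 then
        midpoint H (batchLen α T) (rounds H β T) (hist.map M.observe) q j else 0 := by
  set L := batchLen α T with hL
  set n := rounds H β T with hn
  set i := searchIndex H q * n + j with hi
  obtain ⟨hk1, hk2⟩ := hk
  have hkN : k < phaseOneLen S A H α β T := by
    refine lt_of_lt_of_le hk2 ?_
    have : (i + 1) * L ≤ Fintype.card (Fin H × S × A) * n * L :=
      Nat.mul_le_mul_right _ (batch_index_lt q hj)
    rw [Nat.add_mul, one_mul] at this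
    exact this
  have hkl : (hist.take k).length = k := by rw [List.length_take]; omega
  have hn0 : 0 < n := by omega
  have hL0 : 0 < L := by omega
  have hdiv : k / L = i := by
    rw [Nat.div_eq_iff hL0]
    have := Nat.mul_comm i L
    omega
  have hidiv : i / n = searchIndex H q := by
    rw [hi, Nat.div_eq_iff hn0]
    have := Nat.mul_comm (searchIndex H q) n
    omega
  have himod : i % n = j := by
    rw [hi, Nat.mul_comm, Nat.mul_add_mod, Nat.mod_eq_of_lt hj]
  rw [PrincipalAgentMDP.offer, alg]
  simp only [List.length_map, hkl, if_pos hkN, ← hL, ← hn, hdiv, searchTransfer, hidiv, himod,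
    searchIndex_inj]
  by_cases hh : h < H
  · simp only [dif_pos hh]
    by_cases hq : (⟨h, hh⟩, s, a) = q
    · subst hq
      rw [if_pos rfl, if_pos ⟨rfl, rfl, rfl⟩, List.map_take, interval_take _ _ _ _ _ _ _ hk1]
      rfl
    · rw [if_neg hq, if_neg]
      rintro ⟨h1, h2, h3⟩
      exact hq (Prod.ext (Fin.ext h1) (Prod.ext h2 h3))
  · rw [dif_neg hh, if_neg]
    rintro ⟨h1, -⟩
    exact hh (h1 ▸ q.1.2)

/-- Too few visits to `s` at step `h` in the `i`-th batch. -/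
def fewVisits (L i h : ℕ) (s : S) (c l : ℝ) : Set (List (Episode S A)) :=
  {hist | pathSum (fun p e => ind (InBatch L i p.length ∧ Occurs h (fun x => x.1 = s) e)) hist + l ≤
    1 / 2 * pathSum (fun p _ => ind (InBatch L i p.length) * c) hist}

/-- Too many occurrences of `Q` at step `h` in the `i`-th batch, given the policies. -/
def manyOccurs (D : Dynamics S A) (play : List (Episode S A) → Policy S A) (L i h : ℕ)
    (Q : S × A → Prop) (l : ℝ) : Set (List (Episode S A)) :=
  {hist | 2 * pathSum (fun p _ => ind (InBatch L i p.length) *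
      D.value H (fun h' s b => ind (h' = h ∧ Q (s, b))) (play p)) hist + l ≤
    pathSum (fun p e => ind (InBatch L i p.length ∧ Occurs h Q e)) hist}

theorem runLaw_fewVisits_le (D : Dynamics S A) (play : List (Episode S A) → Policy S A)
    (L i h : ℕ) (s : S) (c l : ℝ) (hc : 0 ≤ c) (hvis : ∀ π : Policy S A, ENNReal.ofReal c ≤
      (D.episodeLaw H π).toOuterMeasure {e | Occurs h (fun x => x.1 = s) e}) :
    (D.runLaw H play T).toOuterMeasure (fewVisits L i h s c l) ≤
      ENNReal.ofReal (Real.exp (-l)) := by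
  refine D.runLaw_count_le H play _ _ (fun p => mul_nonneg (ind_nonneg _) hc) (fun p => ?_) T l
  by_cases hp : InBatch L i p.length
  · rw [ind_of_true hp, one_mul]
    simpa only [hp, true_and] using hvis (play p)
  · simp [ind_of_false hp]

theorem runLaw_manyOccurs_le (D : Dynamics S A) (play : List (Episode S A) → Policy S A)
    (L i h : ℕ) (Q : S × A → Prop) (l : ℝ) :
    (D.runLaw H play T).toOuterMeasure (manyOccurs H D play L i h Q l) ≤
      ENNReal.ofReal (Real.exp (-l)) := by
  refine D.runLaw_count_ge H play (fun p e => InBatch L i p.length ∧ Occurs h Q e) _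
    (fun p => mul_nonneg (ind_nonneg _) ?_) (fun p => ?_) T l
  · have := D.value_mono (r := fun _ _ _ => 0) (r' := fun h' s b => ind (h' = h ∧ Q (s, b))) H
      (play p) fun _ _ _ _ => ind_nonneg _
    rwa [D.value_zero] at this
  · by_cases hp : InBatch L i p.length
    · rw [ind_of_true hp, one_mul]
      simpa only [hp, true_and] using D.episodeLaw_occurs_le H h (play p) Q
    · simp [hp]

theorem pathSum_inBatch_le {L i N : ℕ} (hi : i * L + L ≤ N) (g : List (Episode S A) → ℝ)
    (hg : ∀ p, 0 ≤ g p) {hist : List (Episode S A)} (hN : N ≤ hist.length) :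
    pathSum (fun p _ => ind (InBatch L i p.length) * g p) hist ≤
      ∑ k ∈ Finset.range N, g (hist.take k) := by
  rw [pathSum_eq_sum_range (fun p => ind (InBatch L i p.length) * g p),
    ← Finset.sum_subset (Finset.range_mono hN)]
  · refine Finset.sum_le_sum fun k _ => ?_
    refine mul_le_of_le_one_left (hg _) ?_
    unfold ind
    split_ifs <;> norm_num
  · intro k hk hk'
    rw [ind_of_false, zero_mul]
    rintro ⟨-, h2⟩
    simp only [Finset.mem_range, List.length_take] at hk hk' h2
    omega

variable [Nonempty A]

/-- The decision at the end of a round is right unless the offer is close to the minimal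
transfer. -/
theorem round_correct (G : Agent S A) (ξ : G.Seed) {q : Fin H × S × A} {j : ℕ}
    (hj : j < rounds H β T) {hist : List (Episode S A)}
    (hlen : phaseOneLen S A H α β T ≤ hist.length) (c δ Rg : ℝ) (hδ : 0 < δ)
    (hRg : M.agentRegret H (alg B slack H α β T) G (phaseOneLen S A H α β T) ξ hist ≤ Rg)
    (hnum : 16 * Rg ≤ c * batchLen α T * δ)
    (hv : hist ∉ fewVisits (batchLen α T) (searchIndex H q * rounds H β T + j) q.1 q.2.1 c
      (c * batchLen α T / 12))
    (hp : hist ∉ manyOccurs H M.toDynamics (M.agentPolicy (alg B slack H α β T) G ξ) (batchLen α T)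
      (searchIndex H q * rounds H β T + j) q.1 (fun x => x = (q.2.1, q.2.2))
      (c * batchLen α T / 12))
    (hn : hist ∉ manyOccurs H M.toDynamics (M.agentPolicy (alg B slack H α β T) G ξ) (batchLen α T)
      (searchIndex H q * rounds H β T + j) q.1 (fun x => x.1 = q.2.1 ∧ x.2 ≠ q.2.2)
      (c * batchLen α T / 12)) :
    (M.minTransfer H q.1 q.2.1 q.2.2 + δ ≤
      midpoint H (batchLen α T) (rounds H β T) (hist.map M.observe) q j →
        visits (batch (batchLen α T) (searchIndex H q * rounds H β T + j) (hist.map M.observe))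
          q.1 q.2.1 ≤ 2 * plays (batch (batchLen α T) (searchIndex H q * rounds H β T + j)
            (hist.map M.observe)) q.1 q.2.1 q.2.2) ∧
    (midpoint H (batchLen α T) (rounds H β T) (hist.map M.observe) q j + δ ≤
      M.minTransfer H q.1 q.2.1 q.2.2 →
        ¬ visits (batch (batchLen α T) (searchIndex H q * rounds H β T + j) (hist.map M.observe))
          q.1 q.2.1 ≤ 2 * plays (batch (batchLen α T) (searchIndex H q * rounds H β T + j)
            (hist.map M.observe)) q.1 q.2.1 q.2.2) := by
  set L := batchLen α T with hL
  set n := rounds H β T with hn'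
  set i := searchIndex H q * n + j with hi
  set play := M.agentPolicy (alg B slack H α β T) G ξ with hplay
  have hiN : i * L + L ≤ phaseOneLen S A H α β T := by
    have : (i + 1) * L ≤ Fintype.card (Fin H × S × A) * n * L :=
      Nat.mul_le_mul_right _ (batch_index_lt q hj)
    rwa [Nat.add_mul, one_mul] at this
  have hwin : pathSum (fun (p : List (Episode S A)) (_ : Episode S A) =>
      ind (InBatch L i p.length) * c) hist = L * c :=
    pathSum_window_const c (i * L) L hist (hiN.trans hlen)
  have hreg : pathSum (fun p _ => ind (InBatch L i p.length) *
      M.agentGap H (M.offer (alg B slack H α β T) p) (play p)) hist ≤ Rg :=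
    (pathSum_inBatch_le hiN (fun p => M.agentGap H (M.offer (alg B slack H α β T) p) (play p))
      (fun p => M.agentGap_nonneg H _ _) hlen).trans hRg
  have hbound : ∀ Q : S × A → Prop, (∀ k, InBatch L i k → δ * M.value H
      (fun h' s b => ind (h' = (q.1 : ℕ) ∧ Q (s, b))) (play (hist.take k)) ≤
      M.agentGap H (M.offer (alg B slack H α β T) (hist.take k)) (play (hist.take k))) →
      δ * pathSum (fun p _ => ind (InBatch L i p.length) * M.value H
        (fun h' s b => ind (h' = (q.1 : ℕ) ∧ Q (s, b))) (play p)) hist ≤ Rg := by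
    intro Q hQ
    rw [← pathSum_const_mul]
    refine le_trans (pathSum_mono fun k hk => ?_) hreg
    have hlk : (hist.take k).length = k := by rw [List.length_take]; omega
    by_cases hin : InBatch L i k
    · rw [hlk, ind_of_true hin, one_mul, one_mul]
      exact hQ k hin
    · rw [hlk, ind_of_false hin]
      simp
  have hoff := fun k hk => offer_search (k := k) (q := q) M B slack H α β T hj hlen hk
  have hvis := visits_batch M L i hist q.1 q.2.1
  have hpl := plays_batch M L i hist q.1 q.2.1 q.2.2
  have hsplit : pathSum (fun p e => ind (InBatch L i p.length ∧
      Occurs q.1 (fun x => x.1 = q.2.1) e)) hist =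
      pathSum (fun p e => ind (InBatch L i p.length ∧
        Occurs q.1 (fun x => x = (q.2.1, q.2.2)) e)) hist +
      pathSum (fun p e => ind (InBatch L i p.length ∧
        Occurs q.1 (fun x => x.1 = q.2.1 ∧ x.2 ≠ q.2.2) e)) hist := by
    rw [← pathSum_add]
    congr 1
    funext p e
    exact ind_visit_eq _ _ _ _ _
  simp only [fewVisits, manyOccurs, Set.mem_ofPred_eq, not_le] at hv hp hn
  rw [hwin] at hv
  constructor
  · intro hx
    have h1 := hbound (fun x => x.1 = q.2.1 ∧ x.2 ≠ q.2.2) fun k hk =>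
      M.agentGap_of_high q.1.2 (by rw [hoff k hk, if_pos ⟨rfl, rfl, rfl⟩])
        (fun h' s' a' hne => by rw [hoff k hk, if_neg hne]) hx _
    have h3 : (visits (batch L i (hist.map M.observe)) q.1 q.2.1 : ℝ) ≤
        2 * plays (batch L i (hist.map M.observe)) q.1 q.2.1 q.2.2 := by
      rw [hvis, hpl]
      generalize pathSum (fun p _ => ind (InBatch L i p.length) * M.value H (fun h' s b =>
        ind (h' = (q.1 : ℕ) ∧ (fun x : S × A => x.1 = q.2.1 ∧ x.2 ≠ q.2.2) (s, b))) (play p)) hist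
        = X at h1 hn
      -- The expected number `X` of wrong choices is at most `c L / 16`, so fewer than `c L / 8 + c
      -- L / 12 = 5 c L / 24` occur. Visits exceed `c L / 2 - c L / 12 = 5 c L / 12`, twice as many.
      -- The tail length `c L / 12` and the factor `16` in `hnum` are fitted to this.
      have : 16 * X ≤ c * L := le_of_mul_le_mul_right (by linarith) hδ
      linarith
    exact_mod_cast h3
  · intro hx
    have h1 := hbound (fun x => x = (q.2.1, q.2.2)) fun k hk =>
      M.agentGap_of_low q.1.2 (by rw [hoff k hk, if_pos ⟨rfl, rfl, rfl⟩])
        (fun h' s' a' hne => by rw [hoff k hk, if_neg hne]) hδ hx _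
    have h3 : 2 * (plays (batch L i (hist.map M.observe)) q.1 q.2.1 q.2.2 : ℝ) <
        visits (batch L i (hist.map M.observe)) q.1 q.2.1 := by
      rw [hvis, hpl]
      generalize pathSum (fun p _ => ind (InBatch L i p.length) * M.value H (fun h' s b =>
        ind (h' = (q.1 : ℕ) ∧ (fun x : S × A => x = (q.2.1, q.2.2)) (s, b))) (play p)) hist
        = X at h1 hp
      have : 16 * X ≤ c * L := le_of_mul_le_mul_right (by linarith) hδ
      linarith
    have h4 : 2 * plays (batch L i (hist.map M.observe)) q.1 q.2.1 q.2.2 <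
        visits (batch L i (hist.map M.observe)) q.1 q.2.1 := by exact_mod_cast h3
    omega

/-- If all decisions are right up to `δ`, the search ends close to its target. -/
theorem interval_accurate {L n : ℕ} {l : List (ObsEpisode S A)} {q : Fin H × S × A} {t δ : ℝ}
    (ht0 : 0 ≤ t) (htH : t ≤ H) (hδ : 0 ≤ δ)
    (hcor : ∀ j < n, (t + δ ≤ midpoint H L n l q j →
        visits (batch L (searchIndex H q * n + j) l) q.1 q.2.1 ≤
          2 * plays (batch L (searchIndex H q * n + j) l) q.1 q.2.1 q.2.2) ∧
      (midpoint H L n l q j + δ ≤ t →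
        ¬ visits (batch L (searchIndex H q * n + j) l) q.1 q.2.1 ≤
          2 * plays (batch L (searchIndex H q * n + j) l) q.1 q.2.1 q.2.2)) (j : ℕ) (hj : j ≤ n) :
    ((interval H L n l q j).1 : ℝ) ≤ t + δ ∧ t ≤ (interval H L n l q j).2 + δ := by
  induction j with
  | zero =>
    simp only [interval, NNReal.coe_zero, NNReal.coe_natCast]
    exact ⟨by linarith, by linarith⟩
  | succ j ih =>
    obtain ⟨ih1, ih2⟩ := ih (by omega)
    -- A bound could only fail if the end that moved to the midpoint passed the target by more than
    -- `δ`; the decision would then have been clear and made wrongly.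
    obtain ⟨h1, h2⟩ := hcor j (by omega)
    simp only [interval]
    split_ifs with hd
    · refine ⟨ih1, ?_⟩
      by_contra hlt
      exact h2 (not_le.1 hlt).le hd
    · refine ⟨?_, ih2⟩
      by_contra hlt
      exact hd (h1 (not_le.1 hlt).le)

theorem rounds_spec (hH : 0 < H) (hT : 0 < T) :
    (H : ℝ) / 2 ^ rounds H β T ≤ (T : ℝ) ^ (-β) / 2 := by
  have hH' : (0 : ℝ) < H := by exact_mod_cast hH
  have hT' : (0 : ℝ) < T := by exact_mod_cast hT
  have hpos : (0 : ℝ) < (T : ℝ) ^ β := Real.rpow_pos_of_pos hT' _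
  have h1 : 2 * H * (T : ℝ) ^ β ≤ 2 ^ rounds H β T := by
    have h2 := Nat.le_ceil (Real.logb 2 (2 * H * (T : ℝ) ^ β))
    rw [Real.logb_le_iff_le_rpow (by norm_num) (by positivity)] at h2
    rw [← Real.rpow_natCast]
    exact h2
  rw [Real.rpow_neg hT'.le, div_le_iff₀ (by positivity)]
  calc (H : ℝ) = ((T : ℝ) ^ β)⁻¹ / 2 * (2 * H * (T : ℝ) ^ β) := by field_simp
    _ ≤ _ := by gcongr

theorem estimate_accurate (hH : 0 < H) (hT : 0 < T) {hist : List (Episode S A)}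
    {q : Fin H × S × A}
    (hcor : ∀ j < rounds H β T, (M.minTransfer H q.1 q.2.1 q.2.2 + (T : ℝ) ^ (-β) / 2 ≤
      midpoint H (batchLen α T) (rounds H β T) (hist.map M.observe) q j →
        visits (batch (batchLen α T) (searchIndex H q * rounds H β T + j) (hist.map M.observe))
          q.1 q.2.1 ≤ 2 * plays (batch (batchLen α T) (searchIndex H q * rounds H β T + j)
            (hist.map M.observe)) q.1 q.2.1 q.2.2) ∧
    (midpoint H (batchLen α T) (rounds H β T) (hist.map M.observe) q j + (T : ℝ) ^ (-β) / 2 ≤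
      M.minTransfer H q.1 q.2.1 q.2.2 →
        ¬ visits (batch (batchLen α T) (searchIndex H q * rounds H β T + j) (hist.map M.observe))
          q.1 q.2.1 ≤ 2 * plays (batch (batchLen α T) (searchIndex H q * rounds H β T + j)
            (hist.map M.observe)) q.1 q.2.1 q.2.2)) :
    |(estimate H (batchLen α T) (rounds H β T) (hist.map M.observe) q.1 q.2.1 q.2.2 : ℝ) -
      M.minTransfer H q.1 q.2.1 q.2.2| ≤ (T : ℝ) ^ (-β) := by
  have hT' : (0 : ℝ) < T := by exact_mod_cast hT
  have hpos : (0 : ℝ) < (T : ℝ) ^ (-β) := Real.rpow_pos_of_pos hT' _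
  obtain ⟨h1, h2⟩ := interval_accurate H (M.minTransfer_nonneg H q.1 q.2.1 q.2.2)
    (M.minTransfer_le H q.1 q.2.1 q.2.2) (by positivity) hcor (rounds H β T) le_rfl
  have h3 := (interval_le H (batchLen α T) (rounds H β T) (hist.map M.observe) q
    (rounds H β T)).1
  have h4 := rounds_spec H β T hH hT
  have h5 : estimate H (batchLen α T) (rounds H β T) (hist.map M.observe) q.1 q.2.1 q.2.2 =
      (interval H (batchLen α T) (rounds H β T) (hist.map M.observe) q (rounds H β T)).2 := by
    simp [estimate]
  rw [h5, abs_le]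
  exact ⟨by linarith, by linarith⟩

theorem estimate_le (L n : ℕ) (l : List (ObsEpisode S A)) (h : ℕ) (s : S) (a : A) :
    (estimate H L n l h s a : ℝ) ≤ H := by
  unfold estimate
  split_ifs
  · exact (interval_le H L n l _ n).2
  · simp

end TwoPhase

/-! ### Welfare, and implementing plans by transfers -/

theorem PMF.abs_sum_toReal_mul_le {α : Type*} [Fintype α] (p : PMF α) (x : α → ℝ) (c : ℝ)
    (hx : ∀ a, p a ≠ 0 → |x a| ≤ c) : |∑ a, (p a).toReal * x a| ≤ c := by
  calc |∑ a, (p a).toReal * x a| ≤ ∑ a, |(p a).toReal * x a| := Finset.abs_sum_le_sum_abs _ _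
    _ ≤ ∑ a, (p a).toReal * c := by
        refine Finset.sum_le_sum fun a _ => ?_
        rw [abs_mul, abs_of_nonneg ENNReal.toReal_nonneg]
        by_cases ha : p a = 0
        · simp [ha]
        · exact mul_le_mul_of_nonneg_left (hx a ha) ENNReal.toReal_nonneg
    _ = c := by rw [← Finset.sum_mul, PMF.sum_toReal_eq_one, one_mul]

namespace PrincipalAgentMDP

variable {S A : Type*} (M : PrincipalAgentMDP S A)

/-- The sum of the rewards of the two players. -/
def jointReward : ℕ → S → A → ℝ := fun _ s a => M.rA s a + M.rP s a

theorem jointReward_mem (h : ℕ) (s : S) (a : A) : M.jointReward h s a ∈ Set.Icc (0 : ℝ) 2 := by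
  have h1 := M.rA_mem s a
  have h2 := M.rP_mem s a
  exact ⟨add_nonneg h1.1 h2.1, by simp only [jointReward]; linarith [h1.2, h2.2]⟩

variable [Fintype S] [Fintype A]

/-- Transfers cancel between the two players, so welfare is the value of an ordinary decision
process. -/
theorem welfare_eq (H : ℕ) (π : Policy S A) (τ : Transfer S A) :
    M.welfare H π τ = M.value H M.jointReward π := by
  have := M.value_lin H (M.agentReward τ) (M.principalReward τ) 1 π
  rw [one_mul] at this
  rw [welfare, ← this]
  congr 1
  funext h s a
  simp only [agentReward, principalReward, jointReward]
  ring

theorem optWelfare_eq (H : ℕ) : M.optWelfare H = M.optValue H M.jointReward := by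
  simp only [optWelfare, Dynamics.optValue, welfare_eq]

theorem welfareRegret_eq (H : ℕ) (alg : PrincipalAlg S A) (G : Agent S A) (T : ℕ) (ξ : G.Seed)
    (hist : List (Episode S A)) : M.welfareRegret H alg G T ξ hist = ∑ k ∈ Finset.range T,
      (M.optValue H M.jointReward -
        M.value H M.jointReward (M.agentPolicy alg G ξ (hist.take k))) := by
  simp only [welfareRegret, welfare_eq, optWelfare_eq, Finset.sum_sub_distrib, Finset.sum_const,
    Finset.card_range, nsmul_eq_mul]

theorem welfareRegret_nonneg (H : ℕ) (alg : PrincipalAlg S A) (G : Agent S A) (T : ℕ) (ξ : G.Seed)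
    (hist : List (Episode S A)) : 0 ≤ M.welfareRegret H alg G T ξ hist := by
  rw [welfareRegret_eq]
  exact Finset.sum_nonneg fun k _ => sub_nonneg.2 (M.value_le_optValue H _ _)

theorem optValue_jointReward_sub_le [Nonempty A] (H : ℕ) (π : Policy S A) :
    M.optValue H M.jointReward - M.value H M.jointReward π ≤ 2 * H := by
  obtain ⟨f, hf, -⟩ := M.exists_det_value_eq_optValue H M.jointReward
  have h1 := (M.value_mem_Icc M.jointReward_mem H (detPolicy f)).2
  have h2 := (M.value_mem_Icc M.jointReward_mem H π).1
  linarith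

/-- Deviations from a plan cost little welfare. -/
theorem value_jointReward_sub_le (H : ℕ) (f : ℕ → S → A) (π : Policy S A) :
    M.value H M.jointReward (detPolicy f) - M.value H M.jointReward π ≤
      2 * H * M.value H (fun h s a => ind (a ≠ f h s)) π := by
  rw [M.value_sub_value, ← M.value_const_mul]
  refine M.value_mono H π fun h hh s a => ?_
  rw [show H - h = (H - (h + 1)) + 1 by omega]
  -- In the performance difference, the plan's own action contributes zero, and any other at most
  -- the remaining value, hence at most `2 H`.
  by_cases ha : a = f h s
  · rw [ind_of_false (by simpa using ha), M.valueFrom_det_succ, ha]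
    simp
  · rw [ind_of_true ha, mul_one]
    have h1 := (M.valueFrom_mem_Icc M.jointReward_mem (detPolicy f) ((H - (h + 1)) + 1) h s).2
    have h2 : 0 ≤ ∑ s', (M.trans s a s').toReal *
        M.valueFrom M.jointReward (detPolicy f) (H - (h + 1)) (h + 1) s' :=
      Finset.sum_nonneg fun s' _ => mul_nonneg ENNReal.toReal_nonneg
        (M.valueFrom_mem_Icc M.jointReward_mem _ _ _ _).1
    have h3 := (M.jointReward_mem h s a).1
    have h4 : (((H - (h + 1)) + 1 : ℕ) : ℝ) ≤ H := by exact_mod_cast (by omega)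
    linarith

variable [Nonempty A]

/-- Value of a plan for the agent when it is implemented by approximately minimal transfers plus a
constant slack of one. -/
theorem abs_valueFrom_implement_sub_le {H : ℕ} {f : ℕ → S → A} {est τ : Transfer S A} {ε : ℝ}
    (hest : ∀ h < H, ∀ s, M.Reachable h s → ∀ a, |(est h s a : ℝ) - M.minTransfer H h s a| ≤ ε)
    (hτ : ∀ h s, τ h s (f h s) = est h s (f h s) + 1) (n h : ℕ) (s : S) (hn : n + h = H)
    (hs : M.Reachable h s) :
    |M.valueFrom (M.agentReward τ) (detPolicy f) n h s - M.optV (M.agentReward 0) n h s - n| ≤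
      n * ε := by
  induction n generalizing h s with
  | zero => simp [Dynamics.valueFrom, Dynamics.optV_zero]
  | succ n ih =>
    -- The minimal transfer lifts the planned action to the value of an optimal one, so each step of
    -- the plan yields the optimal value without transfers plus the slack `1`, up to an error `ε`.
    have h1 := hest h (by omega) s hs (f h s)
    rw [M.minTransfer_eq, show H - h = n + 1 by omega, M.optQ_succ] at h1
    have h2 := PMF.abs_sum_toReal_mul_le (M.trans s (f h s)) (fun s' =>
      M.valueFrom (M.agentReward τ) (detPolicy f) n (h + 1) s' -
        M.optV (M.agentReward 0) n (h + 1) s' - n) (n * ε)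
        fun s' hs' => ih (h + 1) s' (by omega) (hs.succ hs')
    simp only [mul_sub, Finset.sum_sub_distrib, ← Finset.sum_mul, PMF.sum_toReal_eq_one,
      one_mul] at h2
    rw [M.valueFrom_det_succ]
    simp only [agentReward, hτ, Pi.zero_apply, NNReal.coe_zero, NNReal.coe_add,
      NNReal.coe_one] at h1 h2 ⊢
    rw [abs_le] at h1 h2 ⊢
    push_cast
    constructor <;> linarith [h1.1, h1.2, h2.1, h2.2]

/-- When a plan is implemented by approximately minimal transfers plus a slack, each deviation is
costly for the agent. -/
theorem deviation_le_agentGap {H : ℕ} {f : ℕ → S → A} {est τ : Transfer S A} {ε : ℝ} (hε : 0 ≤ ε)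
    (hest : ∀ h < H, ∀ s, M.Reachable h s → ∀ a, |(est h s a : ℝ) - M.minTransfer H h s a| ≤ ε)
    (hτ : ∀ h s, τ h s (f h s) = est h s (f h s) + 1) (hτ0 : ∀ h s a, a ≠ f h s → τ h s a = 0)
    (π : Policy S A) :
    (1 - 2 * H * ε) * M.value H (fun h s a => ind (a ≠ f h s)) π ≤ M.agentGap H τ π := by
  refine le_trans ?_ (sub_le_sub_right (M.value_le_optValue H (M.agentReward τ) (detPolicy f)) _)
  rw [M.value_sub_value, ← M.value_const_mul]
  refine M.value_mono_of_reachable H π fun h hh s a hs => ?_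
  obtain ⟨n, hn⟩ : ∃ n, n + 1 + h = H := ⟨H - (h + 1), by omega⟩
  rw [show H - (h + 1) = n by omega, show H - h = n + 1 by omega]
  by_cases ha : a = f h s
  · rw [ind_of_false (by simpa using ha), M.valueFrom_det_succ, ha]
    simp
  · rw [ind_of_true ha, mul_one]
    have h1 := M.abs_valueFrom_implement_sub_le hest hτ (n + 1) h s hn hs
    have h2 := PMF.abs_sum_toReal_mul_le (M.trans s a) (fun s' =>
      M.valueFrom (M.agentReward τ) (detPolicy f) n (h + 1) s' -
        M.optV (M.agentReward 0) n (h + 1) s' - n) (n * ε)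
        fun s' hs' => M.abs_valueFrom_implement_sub_le hest hτ n (h + 1) s' (by omega)
          (hs.succ hs')
    simp only [mul_sub, Finset.sum_sub_distrib, ← Finset.sum_mul, PMF.sum_toReal_eq_one,
      one_mul] at h2
    -- An unpaid action earns at most the optimal value without transfers plus the `n` future
    -- slacks; the plan earns `n + 1` slacks. The loss is at least `1 - (2 n + 1) ε`.
    have h3 := M.optQ_le_optV (M.agentReward 0) (n + 1) h s a
    rw [M.optQ_succ] at h3
    have h4 : M.agentReward τ h s a = M.agentReward 0 h s a := by
      simp [agentReward, hτ0 h s a ha]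
    rw [h4]
    rw [abs_le] at h1 h2
    have h5 : (n : ℝ) + 1 ≤ H := by exact_mod_cast (by omega)
    have h6 : ((n : ℝ) + 1) * ε ≤ H * ε := mul_le_mul_of_nonneg_right h5 hε
    have h7 := h1.1
    push_cast at h7
    linarith [h2.2]

/-- With minimal transfers, the principal's value is the welfare up to a constant. -/
theorem exists_value_sub_minTransfer_eq (H : ℕ) :
    ∃ b : ℝ, ∀ π : Policy S A, M.value H (fun h s a => M.rP s a - M.minTransfer H h s a) π =
      M.value H M.jointReward π - b := by
  -- The potential is the agent's optimal value: adding it to the joint reward cancels `rA` and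
  -- leaves `rP` minus the minimal transfer. The constant is its initial mean, the payoff that the
  -- agent can secure without transfers.
  refine ⟨∑ s, (M.init s).toReal * M.optV (M.agentReward 0) (H - 0) 0 s, fun π => ?_⟩
  have h1 := M.value_shaping H M.jointReward (fun h s => M.optV (M.agentReward 0) (H - h) h s) π
    (fun s => by simp [Dynamics.optV_zero])
  rw [← h1]
  refine M.value_congr H π fun h hh s a => ?_
  rw [M.minTransfer_eq, show H - h = (H - (h + 1)) + 1 by omega, M.optQ_succ]
  simp only [jointReward, agentReward, Pi.zero_apply, NNReal.coe_zero]
  ring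

/-- Errors of the estimates matter only in reachable states, where they are at most `ε` per step. -/
theorem abs_value_estimate_sub_le {H : ℕ} {est : Transfer S A} {ε b : ℝ}
    (hest : ∀ h < H, ∀ s, M.Reachable h s → ∀ a, |(est h s a : ℝ) - M.minTransfer H h s a| ≤ ε)
    (hb : ∀ π : Policy S A, M.value H (fun h s a => M.rP s a - M.minTransfer H h s a) π =
      M.value H M.jointReward π - b) (π : Policy S A) :
    |M.value H (fun h s a => M.rP s a - est h s a) π - (M.value H M.jointReward π - b)| ≤
      H * ε := by
  rw [← hb]
  have h1 := M.value_mono_of_reachable (r := fun h s a => M.rP s a - est h s a)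
    (r' := fun h s a => (M.rP s a - M.minTransfer H h s a) + 1 * ε) H π fun h hh s a hs => by
      have := abs_le.1 (hest h hh s hs a)
      linarith [this.1]
  have h2 := M.value_mono_of_reachable
    (r := fun h s a => (M.rP s a - M.minTransfer H h s a) + (-1) * ε)
    (r' := fun h s a => M.rP s a - est h s a) H π fun h hh s a hs => by
      have := abs_le.1 (hest h hh s hs a)
      linarith [this.2]
  rw [M.value_lin H (fun h s a => M.rP s a - M.minTransfer H h s a) (fun _ _ _ => ε),
    M.value_const] at h1 h2
  rw [abs_le]
  constructor <;> linarith

end PrincipalAgentMDP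

/-! ### Phase two: welfare regret on the good event -/

namespace TwoPhase

open Episode RobustExplore

variable {S A : Type*} [DecidableEq S] [DecidableEq A] [Fintype S] [Fintype A] [Nonempty A]
  (M : PrincipalAgentMDP S A) (H : ℕ) (α β : ℝ) (T : ℕ)

/-- The principal's rewards, shifted by the estimates of the minimal transfers. -/
noncomputable def shiftedReward (p : List (Episode S A)) : ℕ → S → A → ℝ := fun h s a =>
  M.rP s a - estimate H (batchLen α T) (rounds H β T) (p.map M.observe) h s a

theorem abs_shiftedReward_le (p : List (Episode S A)) (h : ℕ) (s : S) (a : A) :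
    |shiftedReward M H α β T p h s a| ≤ H + 1 := by
  have h1 := M.rP_mem s a
  have h2 := estimate_le H (batchLen α T) (rounds H β T) (p.map M.observe) h s a
  have h3 := (estimate H (batchLen α T) (rounds H β T) (p.map M.observe) h s a).coe_nonneg
  have h4 : (0 : ℝ) ≤ H := Nat.cast_nonneg H
  rw [shiftedReward, abs_le]
  exact ⟨by linarith [h1.1], by linarith [h1.2]⟩

/-- State of the learning algorithm of the second phase. -/
noncomputable def learnState (p : List (Episode S A)) : ℕ × (Plan S A H → ℝ) :=
  state (exploreLen S A H (T - phaseOneLen S A H α β T)) (phaseOneLen S A H α β T)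
    (shiftedReward M H α β T) p

/-- The plan that is implemented in the second phase. -/
noncomputable def learnPlan (p : List (Episode S A)) : Plan S A H :=
  named (exploreLen S A H (T - phaseOneLen S A H α β T)) (learnState M H α β T p)

theorem offer_implement {p : List (Episode S A)} (hp : phaseOneLen S A H α β T ≤ p.length)
    (h : ℕ) (s : S) (a : A) :
    M.offer (alg (RobustExplore.alg S A H) 1 H α β T) p h s a =
      if a = (learnPlan M H α β T p).extend h s then
        estimate H (batchLen α T) (rounds H β T) (p.map M.observe) h s a + 1 else 0 := by
  rw [PrincipalAgentMDP.offer, alg]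
  simp only [List.length_map, if_neg (not_lt.2 hp)]
  -- The estimates depend on the first phase only. Hence the shifted rewards are frozen when the
  -- learner starts, and his data are those of `state` with rewards determined by the first `N`
  -- episodes.
  have hest : estimate H (batchLen α T) (rounds H β T)
      ((p.take (phaseOneLen S A H α β T)).map M.observe) =
      estimate H (batchLen α T) (rounds H β T) (p.map M.observe) := by
    rw [List.map_take, estimate_take _ _ _ (phaseOneLen S A H α β T) _ le_rfl]
  have : (((p.map M.observe).drop (phaseOneLen S A H α β T)).map fun e =>
      e.mapIdx fun h x => (x.1, x.2.1, x.2.2 - (estimate H (batchLen α T) (rounds H β T)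
        (p.map M.observe) h x.1 x.2.1 : ℝ))) = (p.drop (phaseOneLen S A H α β T)).map
        (obs (shiftedReward M H α β T (p.take (phaseOneLen S A H α β T)))) := by
    rw [← List.map_drop, List.map_map]
    refine List.map_congr_left fun e _ => List.ext_getElem? fun i => ?_
    simp only [Function.comp_apply, obs, shiftedReward, hest, List.getElem?_mapIdx,
      observe_getElem?, Option.map_map]
    rfl
  rw [this]
  rfl

/-- Expected number of deviations from the plan. -/
noncomputable def deviation (play : List (Episode S A) → Policy S A) (p : List (Episode S A)) : ℝ :=
  M.value H (fun h s a => ind (a ≠ (learnPlan M H α β T p).extend h s)) (play p)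

theorem deviation_nonneg (play : List (Episode S A) → Policy S A) (p : List (Episode S A)) :
    0 ≤ deviation M H α β T play p := by
  have := M.value_mono (r := fun _ _ _ => 0)
    (r' := fun h s a => ind (a ≠ (learnPlan M H α β T p).extend h s)) H (play p)
    fun _ _ _ _ => ind_nonneg _
  rwa [M.value_zero] at this

/-- Too many episodes of the second phase in which the agent does not follow the plan. -/
def manyDeviations (play : List (Episode S A) → Policy S A) (l : ℝ) : Set (List (Episode S A)) :=
  {hist | 2 * pathSum (fun p _ => ind (phaseOneLen S A H α β T ≤ p.length) *
      deviation M H α β T play p) hist + l ≤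
    pathSum (fun p e => ind (phaseOneLen S A H α β T ≤ p.length ∧
      ¬ Follows (learnPlan M H α β T p).extend 0 e)) hist}

theorem runLaw_manyDeviations_le (play : List (Episode S A) → Policy S A) (T' : ℕ) (l : ℝ) :
    (M.runLaw H play T').toOuterMeasure (manyDeviations M H α β T play l) ≤
      ENNReal.ofReal (Real.exp (-l)) := by
  refine M.runLaw_count_ge H play (fun p e => phaseOneLen S A H α β T ≤ p.length ∧
      ¬ Follows (learnPlan M H α β T p).extend 0 e) _
    (fun p => mul_nonneg (ind_nonneg _) (deviation_nonneg M H α β T play p)) (fun p => ?_) T' l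
  by_cases hp : phaseOneLen S A H α β T ≤ p.length
  · rw [ind_of_true hp, one_mul]
    simpa only [hp, true_and, deviation] using M.episodeLaw_not_follows_le H (play p) _
  · simp [hp]

/-- The score of a plan is inaccurate at the end of the exploration. -/
def badScore (δ : ℝ) (d : Plan S A H) : Set (List (Episode S A)) :=
  {hist | (learnState M H α β T hist).1 = exploreLen S A H (T - phaseOneLen S A H α β T) ∧
    δ * repeats (T - phaseOneLen S A H α β T) <
      |(learnState M H α β T hist).2 d - repeats (T - phaseOneLen S A H α β T) *
        M.value H (shiftedReward M H α β T (hist.take (phaseOneLen S A H α β T))) d.policy|}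

/-- Welfare regret on the event that the estimates and the scores are accurate. -/
theorem welfareRegret_le (G : Agent S A) (ξ : G.Seed) {hist : List (Episode S A)}
    (hlen : hist.length = T) (hN : phaseOneLen S A H α β T + 2 ≤ T) {ε δ g Rg l : ℝ} (hε : 0 ≤ ε)
    (hest : ∀ h < H, ∀ s, M.Reachable h s → ∀ a,
      |(estimate H (batchLen α T) (rounds H β T) (hist.map M.observe) h s a : ℝ) -
        M.minTransfer H h s a| ≤ ε)
    (hHε : 2 * H * ε ≤ 1 / 2) (hg : ∀ d : Plan S A H,
      M.value H M.jointReward d.policy < M.optValue H M.jointReward →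
        M.value H M.jointReward d.policy + g ≤ M.optValue H M.jointReward)
    (hδg : 2 * δ + 2 * (H * ε) < g)
    (hRg : M.agentRegret H (alg (RobustExplore.alg S A H) 1 H α β T) G T ξ hist ≤ Rg)
    (hdev : hist ∉ manyDeviations M H α β T
      (M.agentPolicy (alg (RobustExplore.alg S A H) 1 H α β T) G ξ) l)
    (hscore : ∀ d, hist ∉ badScore M H α β T δ d) :
    M.welfareRegret H (alg (RobustExplore.alg S A H) 1 H α β T) G T ξ hist ≤
      2 * H * (phaseOneLen S A H α β T + 2 * Rg +
        exploreLen S A H (T - phaseOneLen S A H α β T) * (4 * Rg + l + 1)) := by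
  set N := phaseOneLen S A H α β T with hNdef
  set B := alg (RobustExplore.alg S A H) 1 H α β T with hB
  set play := M.agentPolicy B G ξ with hplay
  set E := exploreLen S A H (T - N) with hE
  set Dv := pathSum (fun p _ => ind (N ≤ p.length) * deviation M H α β T play p) hist with hDv
  -- By `hHε` each expected deviation costs the agent at least `1 - 2 H ε ≥ 1/2`.
  have hDvRg : Dv ≤ 2 * Rg := by
    have h1 : Dv ≤ pathSum (fun p _ => 2 * M.agentGap H (M.offer B p) (play p)) hist := by
      refine pathSum_mono fun k hk => ?_
      have hlk : (hist.take k).length = k := by rw [List.length_take]; omega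
      have h0 := M.agentGap_nonneg H (M.offer B (hist.take k)) (play (hist.take k))
      rw [hlk]
      by_cases hNk : N ≤ k
      · rw [ind_of_true hNk, one_mul]
        have hest' : estimate H (batchLen α T) (rounds H β T) ((hist.take k).map M.observe) =
            estimate H (batchLen α T) (rounds H β T) (hist.map M.observe) := by
          rw [List.map_take, estimate_take _ _ _ _ _ hNk]
        have h2 := M.deviation_le_agentGap (τ := M.offer B (hist.take k))
          (f := (learnPlan M H α β T (hist.take k)).extend) hε hest
          (fun h s => by rw [offer_implement M H α β T (by omega), if_pos rfl, hest'])
          (fun h s a ha => by rw [offer_implement M H α β T (by omega), if_neg ha])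
          (play (hist.take k))
        have h3 := deviation_nonneg M H α β T play (hist.take k)
        rw [← deviation] at h2
        nlinarith
      · rw [ind_of_false hNk]
        linarith
    rw [pathSum_const_mul, pathSum_eq_sum_range
      (fun p => M.agentGap H (M.offer B p) (play p)), hlen] at h1
    have h2 : ∑ k ∈ Finset.range T, M.agentGap H (M.offer B (hist.take k)) (play (hist.take k))
      ≤ Rg := hRg
    linarith
  have hexp : pathSum (fun p _ => ind (N ≤ p.length ∧ (learnState M H α β T p).1 ≠ E)) hist ≤
      E * (4 * Rg + l + 1) := by
    have h1 := pathSum_explore_le (H := H) E N (shiftedReward M H α β T) hist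
    have h2 : ((state (H := H) E N (shiftedReward M H α β T) hist).1 : ℝ) ≤ E := by
      exact_mod_cast state_fst_le (H := H) E N (shiftedReward M H α β T) hist
    have h3 : pathSum (fun p e => ind (N ≤ p.length ∧
        ¬ Follows (learnPlan M H α β T p).extend 0 e)) hist ≤ 4 * Rg + l := by
      simp only [manyDeviations, Set.mem_ofPred_eq, not_le] at hdev
      linarith
    have h4 := mul_le_mul_of_nonneg_left h3 (Nat.cast_nonneg (α := ℝ) E)
    refine h1.trans ?_
    calc _ ≤ E * (4 * Rg + l) + E := add_le_add h4 h2
      _ = _ := by ring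
  have hfirst : pathSum (fun (p : List (Episode S A)) (_ : Episode S A) =>
      ind (0 ≤ p.length ∧ p.length < 0 + N) * 1) hist = N := by
    rw [pathSum_window_const 1 0 N hist (by omega), mul_one]
  rw [M.welfareRegret_eq]
  have hsum := pathSum_eq_sum_range (fun p => M.optValue H M.jointReward -
        M.value H M.jointReward (play p)) hist
  rw [hlen] at hsum
  rw [← hsum]
  have hmain : pathSum (fun p _ => M.optValue H M.jointReward -
        M.value H M.jointReward (play p)) hist ≤
      pathSum (fun p _ => 2 * H * ((ind (0 ≤ p.length ∧ p.length < 0 + N) * 1 +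
        ind (N ≤ p.length) * deviation M H α β T play p) +
        ind (N ≤ p.length ∧ (learnState M H α β T p).1 ≠ E))) hist := by
    refine pathSum_mono fun k hk => ?_
    have hlk : (hist.take k).length = k := by rw [List.length_take]; omega
    have h2H := M.optValue_jointReward_sub_le H (play (hist.take k))
    rw [hlk]
    by_cases hNk : N ≤ k
    · rw [ind_of_true hNk, ind_of_false (P := 0 ≤ k ∧ k < 0 + N) (by omega)]
      have h1 := M.value_jointReward_sub_le H (learnPlan M H α β T (hist.take k)).extend
        (play (hist.take k))
      rw [← deviation] at h1
      change M.value H M.jointReward (learnPlan M H α β T (hist.take k)).policy - _ ≤ _ at h1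
      by_cases hst : (learnState M H α β T (hist.take k)).1 = E
      · rw [ind_of_false fun h => h.2 hst]
        suffices M.value H M.jointReward (learnPlan M H α β T (hist.take k)).policy =
            M.optValue H M.jointReward by linarith
        have hfin : learnState M H α β T hist = learnState M H α β T (hist.take k) :=
          state_eq_of_take E N (shiftedReward M H α β T) hk.le hNk hst
        have hpl : learnPlan M H α β T (hist.take k) = best (learnState M H α β T hist).2 := by
          rw [learnPlan, ← hfin, named, if_pos (by rw [hfin]; exact hst)]
        rw [hpl]
        obtain ⟨d₀, hd₀⟩ := exists_plan_value_eq_optValue (H := H) M.toDynamics M.jointReward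
        obtain ⟨b, hb⟩ := M.exists_value_sub_minTransfer_eq H
        have hacc : ∀ d : Plan S A H, |(learnState M H α β T hist).2 d - repeats (T - N) *
            M.value H (shiftedReward M H α β T (hist.take N)) d.policy| ≤
            δ * repeats (T - N) := by
          intro d
          have := hscore d
          simp only [badScore, Set.mem_ofPred_eq, not_and, not_lt] at this
          exact this (by rw [hfin]; exact hst)
        have h3 := value_le_value_best (repeats (T - N)) (repeats_pos (by omega)) _ _ δ hacc d₀
        have h4 : ∀ d : Plan S A H, |M.value H (shiftedReward M H α β T (hist.take N)) d.policy -
            (M.value H M.jointReward d.policy - b)| ≤ H * ε := by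
          intro d
          refine M.abs_value_estimate_sub_le (fun h hh s hs a => ?_) hb d.policy
          rw [List.map_take, estimate_take _ _ _ (phaseOneLen S A H α β T) _ le_rfl]
          exact hest h hh s hs a
        have h5 := abs_le.1 (h4 d₀)
        have h6 := abs_le.1 (h4 (best (learnState M H α β T hist).2))
        rw [hd₀] at h5
        -- The score error `δ` and the estimation error `H ε` each enter twice, for the chosen plan
        -- and for an optimal one; the sum is below the gap `g`.
        by_contra hne
        have h7 := hg (best (learnState M H α β T hist).2)
          (lt_of_le_of_ne (M.value_le_optValue H _ _) hne)
        linarith [h5.1, h5.2, h6.1, h6.2]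
      · rw [ind_of_true ⟨hNk, hst⟩]
        have h3 := M.optValue_jointReward_sub_le H (learnPlan M H α β T (hist.take k)).policy
        linarith
    · rw [ind_of_true (P := 0 ≤ k ∧ k < 0 + N) (by omega), ind_of_false hNk]
      have := mul_nonneg (by positivity : (0 : ℝ) ≤ 2 * H)
        (ind_nonneg (N ≤ k ∧ (learnState M H α β T (hist.take k)).1 ≠ E))
      linarith
  refine hmain.trans ?_
  rw [pathSum_const_mul, pathSum_add, pathSum_add, hfirst, ← hDv]
  gcongr

end TwoPhase

/-! ### Probabilities including the agent's seed, and the union bound -/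

namespace PrincipalAgentMDP

variable {S A : Type*} (M : PrincipalAgentMDP S A)

theorem prob_mono_support (H : ℕ) (alg : PrincipalAlg S A) (G : Agent S A) (T : ℕ)
    {E F : G.Seed → List (Episode S A) → Prop}
    (h : ∀ ξ hist, M.runLaw H (M.agentPolicy alg G ξ) T hist ≠ 0 → E ξ hist → F ξ hist) :
    M.prob H alg G T E ≤ M.prob H alg G T F := by
  refine lintegral_mono fun ξ => ?_
  simp only [PMF.toOuterMeasure_eq_expect]
  refine PMF.expect_mono_support _ fun hist hh => ?_
  by_cases hE : E ξ hist
  · simp [Set.indicator, hE, h ξ hist hh hE]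
  · simp [Set.indicator, hE]

theorem prob_le_one (H : ℕ) (alg : PrincipalAlg S A) (G : Agent S A) (T : ℕ)
    (E : G.Seed → List (Episode S A) → Prop) : M.prob H alg G T E ≤ 1 := by
  calc M.prob H alg G T E ≤ ∫⁻ _ξ, 1 ∂G.law := lintegral_mono fun ξ =>
        PMF.toOuterMeasure_le_one _ _
    _ = 1 := by simp

variable [Fintype S] [Fintype A]

theorem agentRegret_take (H : ℕ) (alg : PrincipalAlg S A) (G : Agent S A) (N : ℕ) (ξ : G.Seed)
    (hist : List (Episode S A)) :
    M.agentRegret H alg G N ξ (hist.take N) = M.agentRegret H alg G N ξ hist := by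
  refine Finset.sum_congr rfl fun k hk => ?_
  rw [List.take_take, min_eq_left (Finset.mem_range.1 hk).le]

/-- The probability of an event that concerns the first `N` of `T` episodes. -/
theorem prob_agentRegret_le (H : ℕ) (alg : PrincipalAlg S A) (G : Agent S A) {N T : ℕ} (hNT : N ≤ T)
    (R : ℝ) : M.prob H alg G N (fun ξ hist => M.agentRegret H alg G N ξ hist ≤ R) =
      M.prob H alg G T (fun ξ hist => M.agentRegret H alg G N ξ hist ≤ R) := by
  refine lintegral_congr fun ξ => ?_
  simp only [PMF.toOuterMeasure_eq_expect]
  rw [← M.expect_runLaw_take H _ N T hNT]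
  congr 1
  funext hist
  simp only [Set.indicator, Set.mem_ofPred_eq, agentRegret_take, Pi.one_apply]

end PrincipalAgentMDP

namespace TwoPhase

open Episode RobustExplore

variable {S A : Type*} [DecidableEq S] [DecidableEq A] [Fintype S] [Fintype A] [Nonempty A]
  (M : PrincipalAgentMDP S A) (H : ℕ) (α β : ℝ) (T : ℕ)

theorem runLaw_badScore_le (play : List (Episode S A) → Policy S A) {R δ : ℝ} (hδ : 0 < δ)
    (hδR : δ ≤ 2 * R) (hR : H * (2 * (H + 1)) ≤ R) (d : Plan S A H) (m : ℕ) :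
    (M.runLaw H play m).toOuterMeasure (badScore M H α β T δ d) ≤
      ENNReal.ofReal (2 * (1 + m) * Real.exp (-(δ ^ 2 / (4 * R ^ 2) *
        repeats (T - phaseOneLen S A H α β T)))) :=
  runLaw_score_inaccurate_le _ _ (shiftedReward M H α β T) M.toDynamics play
    (repeats (T - phaseOneLen S A H α β T)) rfl R δ hδ hδR (H + 1) hR (by positivity)
    (fun p h _ s a => abs_shiftedReward_le M H α β T p h s a) d m

/-- The event that a decision of the search may go wrong. -/
def badRound (play : List (Episode S A) → Policy S A) (c : ℝ)
    (x : (Fin H × S × A) × Fin (rounds H β T)) : Set (List (Episode S A)) :=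
  {hist | M.Reachable x.1.1 x.1.2.1 ∧ hist ∈ fewVisits (batchLen α T)
      (searchIndex H x.1 * rounds H β T + x.2) x.1.1 x.1.2.1 c (c * batchLen α T / 12)} ∪
    (manyOccurs H M.toDynamics play (batchLen α T) (searchIndex H x.1 * rounds H β T + x.2) x.1.1
        (fun y => y = (x.1.2.1, x.1.2.2)) (c * batchLen α T / 12) ∪
      manyOccurs H M.toDynamics play (batchLen α T) (searchIndex H x.1 * rounds H β T + x.2) x.1.1
        (fun y => y.1 = x.1.2.1 ∧ y.2 ≠ x.1.2.2) (c * batchLen α T / 12))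

theorem runLaw_badRound_le (play : List (Episode S A) → Policy S A) {c : ℝ} (hc : 0 ≤ c)
    (hvis : ∀ h < H, ∀ s, M.Reachable h s → ∀ π : Policy S A, ENNReal.ofReal c ≤
      (M.episodeLaw H π).toOuterMeasure {e | Occurs h (fun x => x.1 = s) e})
    (x : (Fin H × S × A) × Fin (rounds H β T)) (T' : ℕ) :
    (M.runLaw H play T').toOuterMeasure (badRound M H α β T play c x) ≤
      ENNReal.ofReal (3 * Real.exp (-(c * batchLen α T / 12))) := by
  have h1 : (M.runLaw H play T').toOuterMeasure {hist | M.Reachable x.1.1 x.1.2.1 ∧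
      hist ∈ fewVisits (batchLen α T) (searchIndex H x.1 * rounds H β T + x.2) x.1.1 x.1.2.1 c
        (c * batchLen α T / 12)} ≤ ENNReal.ofReal (Real.exp (-(c * batchLen α T / 12))) := by
    by_cases hr : M.Reachable x.1.1 x.1.2.1
    · exact (measure_mono fun hist hh => hh.2).trans (runLaw_fewVisits_le H T' M.toDynamics play
        (batchLen α T) (searchIndex H x.1 * rounds H β T + x.2) x.1.1 x.1.2.1 c
        (c * batchLen α T / 12) hc (hvis x.1.1 x.1.1.2 x.1.2.1 hr))
    · simp [hr]
  refine (measure_union_le _ _).trans ((add_le_add h1 ((measure_union_le _ _).trans (add_le_add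
    (runLaw_manyOccurs_le H T' M.toDynamics play _ _ _ _ _)
    (runLaw_manyOccurs_le H T' M.toDynamics play _ _ _ _ _)))).trans (le_of_eq ?_))
  rw [← ENNReal.ofReal_add (by positivity) (by positivity),
    ← ENNReal.ofReal_add (by positivity) (by positivity)]
  ring_nf

/-- Probability that the estimates are accurate and the welfare regret is small, for a fixed number
of episodes. -/
theorem le_prob_accurate (hH : 0 < H) (hN : phaseOneLen S A H α β T + 2 ≤ T)
    (hN0 : 1 ≤ phaseOneLen S A H α β T) {κ C ζ c g δ R : ℝ}
    (hc : 0 ≤ c) (hvis : ∀ h < H, ∀ s, M.Reachable h s → ∀ π : Policy S A, ENNReal.ofReal c ≤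
      (M.episodeLaw H π).toOuterMeasure {e | Occurs h (fun x => x.1 = s) e})
    (hg : ∀ d : Plan S A H, M.value H M.jointReward d.policy < M.optValue H M.jointReward →
        M.value H M.jointReward d.policy + g ≤ M.optValue H M.jointReward)
    (hδ : 0 < δ) (hδR : δ ≤ 2 * R) (hR : H * (2 * (H + 1)) ≤ R)
    (hHε : 2 * H * (T : ℝ) ^ (-β) ≤ 1 / 2) (hδg : 2 * δ + 2 * (H * (T : ℝ) ^ (-β)) < g)
    (hnum : 16 * (C * (phaseOneLen S A H α β T : ℝ) ^ κ) ≤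
      c * batchLen α T * ((T : ℝ) ^ (-β) / 2))
    (G : Agent S A) (hG : M.HasAgentRegret H κ C ζ G) :
    ENNReal.ofReal (1 - (phaseOneLen S A H α β T : ℝ) ^ (-ζ)) +
      ENNReal.ofReal (1 - (T : ℝ) ^ (-ζ)) ≤
      M.prob H (alg (RobustExplore.alg S A H) 1 H α β T) G T (fun ξ hist =>
        (∀ h < H, ∀ s, M.Reachable h s → ∀ a,
          |(estimate H (batchLen α T) (rounds H β T) (hist.map M.observe) h s a : ℝ) -
            M.minTransfer H h s a| ≤ (T : ℝ) ^ (-β)) ∧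
        M.welfareRegret H (alg (RobustExplore.alg S A H) 1 H α β T) G T ξ hist ≤
          2 * H * (phaseOneLen S A H α β T + 2 * (C * (T : ℝ) ^ κ) +
            exploreLen S A H (T - phaseOneLen S A H α β T) *
              (4 * (C * (T : ℝ) ^ κ) + Real.log T + 1))) +
      ENNReal.ofReal (1 + (Fintype.card (Fin H × S × A) * rounds H β T *
          (3 * Real.exp (-(c * batchLen α T / 12))) + (Real.exp (-Real.log T) +
          numPlans S A H * (2 * (1 + T) * Real.exp (-(δ ^ 2 / (4 * R ^ 2) *
            repeats (T - phaseOneLen S A H α β T))))))) := by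
  set N := phaseOneLen S A H α β T with hNdef
  set B := alg (RobustExplore.alg S A H) 1 H α β T with hB
  have hT : 0 < T := by omega
  -- The regret bound is used at two numbers of episodes. The search needs it for the first phase
  -- alone: `N ^ κ` is about `T ^ (α κ)`, and the bound `T ^ κ` would require `β + κ < α`, more than
  -- what is assumed.
  have e1 := hG B N hN0
  rw [M.prob_agentRegret_le H B G (by omega : N ≤ T)] at e1
  have e2 := hG B T hT
  -- The lower integral is superadditive without measurability of the events in the seed. For this
  -- reason the union bound is stated for sums of probabilities and integrated seed by seed.
  refine (add_le_add e1 e2).trans ((le_lintegral_add _ _).trans ?_)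
  have hconst : ∀ (f : G.Seed → ℝ≥0∞) (K : ℝ≥0∞), ∫⁻ ξ, f ξ ∂G.law + K =
      ∫⁻ ξ, (f ξ + K) ∂G.law := by
    intro f K
    rw [lintegral_add_right _ measurable_const]
    simp
  rw [PrincipalAgentMDP.prob, hconst]
  refine lintegral_mono fun ξ => ?_
  set play := M.agentPolicy B G ξ with hplay
  let bad : ((Fin H × S × A) × Fin (rounds H β T)) ⊕ Option (Plan S A H) →
      Set (List (Episode S A)) := fun x =>
    match x with
    | .inl x => badRound M H α β T play c x
    | .inr none => manyDeviations M H α β T play (Real.log T)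
    | .inr (some d) => badScore M H α β T δ d
  have hbad : ∑ x, (M.runLaw H play T).toOuterMeasure (bad x) ≤
      ENNReal.ofReal (Fintype.card (Fin H × S × A) * rounds H β T *
          (3 * Real.exp (-(c * batchLen α T / 12))) + (Real.exp (-Real.log T) +
          numPlans S A H * (2 * (1 + T) * Real.exp (-(δ ^ 2 / (4 * R ^ 2) *
            repeats (T - N)))))) := by
    rw [Fintype.sum_sum_type, Fintype.sum_option]
    refine (add_le_add (Finset.sum_le_sum fun x _ => runLaw_badRound_le M H α β T play hc hvis x T)
      (add_le_add (runLaw_manyDeviations_le M H α β T play T (Real.log T))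
        (Finset.sum_le_sum fun d _ => runLaw_badScore_le M H α β T play hδ hδR hR d T))).trans
      (le_of_eq ?_)
    simp only [Finset.sum_const, Finset.card_univ]
    rw [← ENNReal.ofReal_nsmul, ← ENNReal.ofReal_nsmul, nsmul_eq_mul, nsmul_eq_mul]
    rw [← ENNReal.ofReal_add (by positivity) (by positivity),
      ← ENNReal.ofReal_add (by positivity) (by positivity), Fintype.card_prod _ (Fin (rounds H β T)),
      Fintype.card_fin (rounds H β T), numPlans]
    push_cast
    rfl
  have key := (M.runLaw H play T).add_toOuterMeasure_le Finset.univ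
    {hist | M.agentRegret H B G N ξ hist ≤ C * (N : ℝ) ^ κ}
    {hist | M.agentRegret H B G T ξ hist ≤ C * (T : ℝ) ^ κ}
    {hist | (∀ h < H, ∀ s, M.Reachable h s → ∀ a,
          |(estimate H (batchLen α T) (rounds H β T) (hist.map M.observe) h s a : ℝ) -
            M.minTransfer H h s a| ≤ (T : ℝ) ^ (-β)) ∧
        M.welfareRegret H B G T ξ hist ≤
          2 * H * (N + 2 * (C * (T : ℝ) ^ κ) +
            exploreLen S A H (T - N) * (4 * (C * (T : ℝ) ^ κ) + Real.log T + 1))} bad ?_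
  · refine key.trans ?_
    rw [ENNReal.ofReal_add zero_le_one (by positivity), ENNReal.ofReal_one]
    gcongr
  · intro hist hh h1 h2 hgood
    have hlen := M.length_of_runLaw_ne_zero H _ T hist hh
    have hT' : (0 : ℝ) < T := by exact_mod_cast hT
    have hest : ∀ h < H, ∀ s, M.Reachable h s → ∀ a,
          |(estimate H (batchLen α T) (rounds H β T) (hist.map M.observe) h s a : ℝ) -
            M.minTransfer H h s a| ≤ (T : ℝ) ^ (-β) := by
      intro h hh s hs a
      refine estimate_accurate (q := (⟨h, hh⟩, s, a)) M H α β T hH hT fun j hj => ?_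
      have hb := hgood (.inl ((⟨h, hh⟩, s, a), ⟨j, hj⟩)) (Finset.mem_univ _)
      simp only [bad, badRound, Set.mem_union, not_or] at hb
      exact round_correct M _ 1 H α β T G ξ (q := (⟨h, hh⟩, s, a)) hj (by omega) c
        ((T : ℝ) ^ (-β) / 2) _ (by positivity) h1 hnum (fun hf => hb.1 ⟨hs, hf⟩) hb.2.1 hb.2.2
    exact ⟨hest, welfareRegret_le M H α β T G ξ hlen hN (by positivity) hest hHε hg hδg h2
      (hgood (.inr none) (Finset.mem_univ _)) fun d => hgood (.inr (some d)) (Finset.mem_univ _)⟩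

end TwoPhase

/-! ### Asymptotics in the number of episodes -/

theorem eventually_log_rpow_le {s r ε : ℝ} (hr : 0 < r) (hε : 0 < ε) :
    ∀ᶠ T : ℕ in atTop, Real.log T ^ s ≤ ε * (T : ℝ) ^ r := by
  have h := ((isLittleO_log_rpow_rpow_atTop s hr).bound hε)
  filter_upwards [tendsto_natCast_atTop_atTop.eventually h, eventually_ge_atTop 1] with T hT hT1
  have hl : 0 ≤ Real.log T := Real.log_natCast_nonneg T
  rwa [Real.norm_of_nonneg (Real.rpow_nonneg hl s),
    Real.norm_of_nonneg (Real.rpow_nonneg (Nat.cast_nonneg T) r)] at hT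

theorem eventually_rpow_mul_log_pow_le {a ε : ℝ} (ha : a < 1) (hε : 0 < ε) (p : ℕ) :
    ∀ᶠ T : ℕ in atTop, (T : ℝ) ^ a * Real.log T ^ p ≤ ε * T := by
  filter_upwards [eventually_log_rpow_le (s := p) (sub_pos.2 ha) hε, eventually_ge_atTop 1]
    with T hT hT1
  have hT0 : (0 : ℝ) < T := by exact_mod_cast hT1
  rw [Real.rpow_natCast] at hT
  calc (T : ℝ) ^ a * Real.log T ^ p ≤ (T : ℝ) ^ a * (ε * (T : ℝ) ^ (1 - a)) := by gcongr
    _ = ε * ((T : ℝ) ^ a * (T : ℝ) ^ (1 - a)) := by ring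
    _ = ε * T := by rw [← Real.rpow_add hT0]; simp

theorem eventually_rpow_neg_le {b ε : ℝ} (hb : 0 < b) (hε : 0 < ε) :
    ∀ᶠ T : ℕ in atTop, (T : ℝ) ^ (-b) < ε :=
  ((tendsto_rpow_neg_atTop hb).comp tendsto_natCast_atTop_atTop).eventually (gt_mem_nhds hε)

theorem eventually_sq_mul_exp_neg_rpow_le {a b : ℝ} (ha : 0 < a) (hb : 0 < b) :
    ∀ᶠ T : ℕ in atTop, 3 * (T : ℝ) ^ 2 * Real.exp (-(b * (T : ℝ) ^ a)) ≤ 1 := by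
  have h1 := (tendsto_rpow_mul_exp_neg_mul_atTop_nhds_zero (2 / a) b hb).comp
    ((tendsto_rpow_atTop ha).comp tendsto_natCast_atTop_atTop)
  filter_upwards [h1.eventually (gt_mem_nhds (show (0 : ℝ) < 1 / 3 by norm_num)),
    eventually_ge_atTop 1] with T hT hT1
  have hT0 : (0 : ℝ) ≤ T := Nat.cast_nonneg T
  simp only [Function.comp_apply] at hT
  rw [← Real.rpow_mul hT0, mul_div_cancel₀ _ ha.ne', Real.rpow_two, neg_mul] at hT
  linarith

namespace TwoPhase

open Episode RobustExplore

theorem exists_rounds_le {H : ℕ} (hH : 0 < H) {β : ℝ} (hβ : 0 < β) :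
    ∃ K : ℝ, 0 < K ∧ ∀ T : ℕ, 2 ≤ T → (rounds H β T : ℝ) ≤ K * Real.log T := by
  have hH' : (1 : ℝ) ≤ H := by exact_mod_cast hH
  have hl2 : 0 < Real.log 2 := Real.log_pos (by norm_num)
  have hlH : 0 ≤ Real.log (2 * H) := Real.log_nonneg (by linarith)
  refine ⟨2 * (Real.log (2 * H) / Real.log 2 + 1) + β / Real.log 2, by positivity, fun T hT => ?_⟩
  have hT0 : (0 : ℝ) < T := by exact_mod_cast (by omega : 0 < T)
  have hlog := half_le_log hT
  have hlb : Real.logb 2 (2 * H * (T : ℝ) ^ β) =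
      Real.log (2 * H) / Real.log 2 + β / Real.log 2 * Real.log T := by
    rw [Real.logb, Real.log_mul (by positivity) (by positivity), Real.log_rpow hT0]
    ring
  have hnn : 0 ≤ Real.logb 2 (2 * H * (T : ℝ) ^ β) := by
    rw [hlb]
    positivity
  have h1 := Nat.ceil_lt_add_one hnn
  rw [rounds]
  rw [hlb] at h1 ⊢
  have h2 : 0 ≤ Real.log (2 * H) / Real.log 2 + 1 := by positivity
  nlinarith

theorem rpow_le_batchLen (α : ℝ) (T : ℕ) : (T : ℝ) ^ α ≤ batchLen α T := Nat.le_ceil _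

theorem rounds_pos {H : ℕ} (hH : 0 < H) {β : ℝ} (hβ : 0 < β) {T : ℕ} (hT : 1 ≤ T) :
    0 < rounds H β T := by
  refine Nat.ceil_pos.2 (Real.logb_pos (by norm_num) ?_)
  have hH' : (1 : ℝ) ≤ H := by exact_mod_cast hH
  have hT' : (1 : ℝ) ≤ (T : ℝ) ^ β := Real.one_le_rpow (by exact_mod_cast hT) hβ.le
  nlinarith

variable (S A : Type*) [Fintype S] [Fintype A] [Nonempty S] [Nonempty A]

theorem rpow_le_phaseOneLen {H : ℕ} (hH : 0 < H) (α : ℝ) {β : ℝ} (hβ : 0 < β) {T : ℕ}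
    (hT : 1 ≤ T) : (T : ℝ) ^ α ≤ phaseOneLen S A H α β T := by
  have : Nonempty (Fin H) := ⟨⟨0, hH⟩⟩
  refine (rpow_le_batchLen α T).trans ?_
  rw [phaseOneLen]
  exact_mod_cast Nat.le_mul_of_pos_left _ (Nat.mul_pos Fintype.card_pos (rounds_pos hH hβ hT))

theorem exists_phaseOneLen_le {H : ℕ} (hH : 0 < H) {α β : ℝ} (hα : 0 ≤ α) (hβ : 0 < β) :
    ∃ K : ℝ, 0 < K ∧ ∀ T : ℕ, 2 ≤ T →
      (phaseOneLen S A H α β T : ℝ) ≤ K * ((T : ℝ) ^ α * Real.log T) := by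
  have : Nonempty (Fin H) := ⟨⟨0, hH⟩⟩
  obtain ⟨K, hK, h⟩ := exists_rounds_le hH hβ
  have hcard : (0 : ℝ) < Fintype.card (Fin H × S × A) := by exact_mod_cast Fintype.card_pos
  refine ⟨Fintype.card (Fin H × S × A) * K * 2, by positivity, fun T hT => ?_⟩
  have hT1 : (1 : ℝ) ≤ T := by exact_mod_cast (by omega : 1 ≤ T)
  have hL : (batchLen α T : ℝ) ≤ 2 * (T : ℝ) ^ α := by
    have h1 := Nat.ceil_lt_add_one (Real.rpow_nonneg (zero_le_one.trans hT1) α)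
    have h2 := Real.one_le_rpow hT1 hα
    rw [batchLen]
    linarith
  have hlog := half_le_log hT
  rw [phaseOneLen]
  push_cast
  calc (Fintype.card (Fin H × S × A) : ℝ) * rounds H β T * batchLen α T
      ≤ Fintype.card (Fin H × S × A) * (K * Real.log T) * (2 * (T : ℝ) ^ α) := by
        gcongr
        exact h T hT
    _ = _ := by ring

/-- The conditions on the number of episodes are satisfied in the long run. -/
theorem eventually_numerics {H : ℕ} (hH : 0 < H) {κ α β C c g : ℝ} (hκ : 0 ≤ κ) (hκα : κ < α)
    (hα : α < 1) (hβ₀ : 0 < β) (hβ : β / α < 1 - κ) (hC : 0 < C) (hc : 0 < c) (hg : 0 < g) :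
    ∀ᶠ T : ℕ in atTop, 4 ≤ T ∧ 2 * phaseOneLen S A H α β T ≤ T ∧
      16 * (C * (phaseOneLen S A H α β T : ℝ) ^ κ) ≤ c * batchLen α T * ((T : ℝ) ^ (-β) / 2) ∧
      2 * H * (T : ℝ) ^ (-β) ≤ 1 / 2 ∧ 2 * (H * (T : ℝ) ^ (-β)) < g / 2 ∧
      3 * (T : ℝ) ^ 2 * Real.exp (-(c * batchLen α T / 12)) ≤ 1 := by
  have hα0 : 0 < α := hκ.trans_lt hκα
  -- This is where `β / α < 1 - κ` enters: the wrong choices, of order `T ^ (β + α κ)` up to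
  -- logarithms, are negligible against a batch of `T ^ α`.
  have hexp : 0 < α - β - α * κ := by
    rw [div_lt_iff₀ hα0] at hβ
    linarith
  have hH' : (0 : ℝ) < H := by exact_mod_cast hH
  obtain ⟨K, hK, hNK⟩ := exists_phaseOneLen_le S A hH hα0.le hβ₀
  filter_upwards [eventually_ge_atTop 4,
    eventually_rpow_mul_log_pow_le (ε := 1 / (2 * K)) hα (by positivity) 1,
    eventually_log_rpow_le (s := κ) (ε := c / (32 * C * K ^ κ)) hexp (by positivity),
    eventually_rpow_neg_le (ε := 1 / (4 * H)) hβ₀ (by positivity),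
    eventually_rpow_neg_le (ε := g / (4 * H)) hβ₀ (by positivity),
    eventually_sq_mul_exp_neg_rpow_le (b := c / 12) hα0 (by positivity)]
    with T h4 hlin hlog hε1 hε2 hex
  have hT0 : (0 : ℝ) < T := by exact_mod_cast (by omega : 0 < T)
  have hN := hNK T (by omega)
  have hl : 0 ≤ Real.log T := Real.log_natCast_nonneg T
  refine ⟨h4, ?_, ?_, ?_, ?_, ?_⟩
  · have : (2 * phaseOneLen S A H α β T : ℝ) ≤ T := by
      rw [pow_one] at hlin
      calc (2 * phaseOneLen S A H α β T : ℝ) ≤ 2 * (K * (1 / (2 * K) * T)) := by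
            gcongr
            exact hN.trans (by gcongr)
        _ = T := by field_simp
    exact_mod_cast this
  · calc 16 * (C * (phaseOneLen S A H α β T : ℝ) ^ κ)
        ≤ 16 * (C * (K * ((T : ℝ) ^ α * Real.log T)) ^ κ) := by gcongr
      _ = 16 * C * K ^ κ * (T : ℝ) ^ (α * κ) * Real.log T ^ κ := by
          rw [Real.mul_rpow hK.le (by positivity), Real.mul_rpow (by positivity) hl,
            ← Real.rpow_mul hT0.le]
          ring
      _ ≤ 16 * C * K ^ κ * (T : ℝ) ^ (α * κ) *
          (c / (32 * C * K ^ κ) * (T : ℝ) ^ (α - β - α * κ)) := by gcongr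
      _ = c / 2 * ((T : ℝ) ^ (α * κ) * (T : ℝ) ^ (α - β - α * κ)) := by
          have : K ^ κ ≠ 0 := (Real.rpow_pos_of_pos hK κ).ne'
          field_simp
          norm_num
      _ = c * (T : ℝ) ^ α * ((T : ℝ) ^ (-β) / 2) := by
          rw [← Real.rpow_add hT0, show α * κ + (α - β - α * κ) = α + -β by ring,
            Real.rpow_add hT0]
          ring
      _ ≤ _ := by
          gcongr
          exact rpow_le_batchLen α T
  · rw [lt_div_iff₀ (by positivity)] at hε1
    linarith
  · rw [lt_div_iff₀ (by positivity)] at hε2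
    linarith
  · refine le_trans ?_ hex
    gcongr
    have := mul_le_mul_of_nonneg_left (rpow_le_batchLen α T) hc.le
    linarith

end TwoPhase

/-- The learner is run for `T - N` episodes only. As `T - N ≥ T / 2 ≥ √T`, its logarithm is at least
half of `log T`. -/
theorem log_sq_le_four_mul_repeats {T N : ℕ} (hT : 4 ≤ T) (hN : 2 * N ≤ T) :
    Real.log T ^ 2 ≤ 4 * (RobustExplore.repeats (T - N) : ℝ) := by
  have hT0 : (0 : ℝ) < T := by exact_mod_cast (by omega : 0 < T)
  have h1 : (T : ℝ) / 2 ≤ ((T - N : ℕ) : ℝ) := by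
    rw [Nat.cast_sub (by omega)]
    have : (2 * N : ℝ) ≤ T := by exact_mod_cast hN
    linarith
  have h2 : Real.log T / 2 ≤ Real.log ((T - N : ℕ) : ℝ) := by
    have h3 := Real.log_le_log (by positivity) h1
    rw [Real.log_div hT0.ne' (by norm_num)] at h3
    have h4 : 2 * Real.log 2 ≤ Real.log T := by
      rw [← Real.log_rpow (by norm_num)]
      exact Real.log_le_log (by positivity) (by norm_num; exact_mod_cast hT)
    linarith
  have h5 := Nat.le_ceil (Real.log ((T - N : ℕ) : ℝ) ^ 2)
  have h6 : 0 ≤ Real.log T := Real.log_natCast_nonneg T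
  rw [← RobustExplore.repeats] at h5
  nlinarith

/-! ### The high-probability bound -/

namespace TwoPhase

open Episode RobustExplore

variable {S A : Type*} [DecidableEq S] [DecidableEq A] [Fintype S] [Fintype A] [Nonempty S]
  [Nonempty A]

/-- Collecting the terms of the regret bound. -/
theorem regret_bound_le {KN C P h a k b x N E : ℝ} (hKN : 0 ≤ KN) (hC : 0 ≤ C) (hP : 0 ≤ P)
    (hh : 0 ≤ h) (ha : 1 ≤ a) (hk : 1 ≤ k) (hb : 0 ≤ b) (hx : 1 / 2 ≤ x) (hN : N ≤ KN * (a * x))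
    (hE : E ≤ P * (5 * x ^ 2)) :
    2 * h * (N + 2 * (C * k) + E * (4 * (C * k) + x + 1)) ≤
      2 * h * (4 * KN + 16 * C + 5 * P * (8 * C + 3)) * (a * x ^ 3 + b * x ^ 3 + k * x ^ 3) := by
  have hx0 : 0 < x := by linarith
  have hx2 : (1 : ℝ) ≤ 4 * x ^ 2 := by nlinarith
  have hx3 : (1 : ℝ) ≤ 8 * x ^ 3 := by nlinarith
  have hxx : x ≤ 4 * x ^ 3 := by nlinarith
  have b1 : N ≤ 4 * KN * (a * x ^ 3) := by
    calc N ≤ KN * (a * x) := hN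
      _ ≤ KN * (a * (4 * x ^ 3)) := by gcongr
      _ = _ := by ring
  have b2 : 2 * (C * k) ≤ 16 * C * (k * x ^ 3) := by
    calc 2 * (C * k) = 2 * (C * k) * 1 := by ring
      _ ≤ 2 * (C * k) * (8 * x ^ 3) := by gcongr
      _ = _ := by ring
  have b3 : E * (4 * (C * k) + x + 1) ≤ 5 * P * (8 * C + 3) * (k * x ^ 3) := by
    have h1 : 4 * (C * k) + x + 1 ≤ (8 * C + 3) * (k * x) := by
      have h2 : C * k ≤ 2 * (C * k * x) := by
        have : 0 ≤ C * k := by positivity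
        nlinarith
      have h3 : x ≤ k * x := le_mul_of_one_le_left hx0.le hk
      linarith
    calc _ ≤ P * (5 * x ^ 2) * ((8 * C + 3) * (k * x)) := by gcongr
      _ = _ := by ring
  have c1 : 0 ≤ a * x ^ 3 := by positivity
  have c2 : 0 ≤ k * x ^ 3 := by positivity
  have c3 : 0 ≤ b * x ^ 3 := by positivity
  rw [mul_assoc (2 * h)]
  refine mul_le_mul_of_nonneg_left ?_ (by positivity)
  have d1 : 0 ≤ 4 * KN := by positivity
  have d2 : 0 ≤ 16 * C := by positivity
  have d3 : 0 ≤ 5 * P * (8 * C + 3) := by positivity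
  have e1 := mul_nonneg d1 (add_nonneg c2 c3)
  have e2 := mul_nonneg d2 (add_nonneg c1 c3)
  have e3 := mul_nonneg d3 (add_nonneg c1 c3)
  linarith

set_option maxHeartbeats 1000000 in
/-- High-probability bound for the estimates and the welfare regret. -/
theorem exists_le_prob (H : ℕ) {κ α β : ℝ} (γ : ℝ)
    (hκ : 0 ≤ κ) (hκα : κ < α) (hα : α < 1) (hβ₀ : 0 < β) (hβ : β / α < 1 - κ)
    (M : PrincipalAgentMDP S A) (hM : M.UniformlyErgodic H) {C ζ : ℝ} (hC : 0 < C) (hζ : 0 < ζ) :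
    ∃ (K ζ' : ℝ) (p : ℕ), 0 < ζ' ∧ ∀ G : Agent S A, M.HasAgentRegret H κ C ζ G → ∀ T : ℕ, 2 ≤ T →
      ENNReal.ofReal (1 - K * (T : ℝ) ^ (-ζ')) ≤
        M.prob H (alg (RobustExplore.alg S A H) 1 H α β T) G T fun ξ hist =>
          (∀ h < H, ∀ s, M.Reachable h s → ∀ a,
            |(estimate H (batchLen α T) (rounds H β T) (hist.map M.observe) h s a : ℝ) -
              M.minTransfer H h s a| ≤ (T : ℝ) ^ (-β)) ∧
          M.welfareRegret H (alg (RobustExplore.alg S A H) 1 H α β T) G T ξ hist ≤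
            K * ((T : ℝ) ^ α * Real.log T ^ p + (T : ℝ) ^ γ * Real.log T ^ p +
              (T : ℝ) ^ κ * Real.log T ^ p) := by
  rcases Nat.eq_zero_or_pos H with rfl | hH
  · refine ⟨0, 1, 0, one_pos, fun G _ T _ => ?_⟩
    have : ∀ ξ hist, M.welfareRegret 0 (alg (RobustExplore.alg S A 0) 1 0 α β T) G T ξ hist ≤ 0 := by
      intro ξ hist
      rw [M.welfareRegret_eq]
      refine Finset.sum_nonpos fun k _ => ?_
      have := M.optValue_jointReward_sub_le 0 (M.agentPolicy (alg (RobustExplore.alg S A 0) 1 0 α β T)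
        G ξ (hist.take k))
      simpa using this
    refine le_of_eq_of_le ?_ (lintegral_mono (f := fun _ => 1) fun ξ => ?_)
    · simp
    · rw [← (PMF.toOuterMeasure_apply_eq_one_iff _ _).2 (Set.subset_univ (M.runLaw 0
        (M.agentPolicy (alg (RobustExplore.alg S A 0) 1 0 α β T) G ξ) T).support)]
      refine measure_mono fun hist _ => ⟨fun h hh => absurd hh (Nat.not_lt_zero h), ?_⟩
      simpa using this ξ hist
  have hα0 : 0 < α := hκ.trans_lt hκα
  obtain ⟨c, hc, hvis⟩ := M.le_episodeLaw_visit hM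
  obtain ⟨g, hg, hgap⟩ := exists_pos_gap
    (fun d : Plan S A H => M.value H M.jointReward d.policy) (M.optValue H M.jointReward)
  obtain ⟨KN, hKN, hN⟩ := exists_phaseOneLen_le S A hH hα0.le hβ₀
  obtain ⟨T₀, hT₀⟩ := eventually_atTop.1
    (eventually_numerics S A hH hκ hκα hα hβ₀ hβ hC hc hg)
  -- Half of the gap is left for the score errors, `2 δ = g / 2`, and half for the estimation
  -- errors. In `R`, the bound `H + 1` on the shifted rewards takes the place of `c`.
  set δ := g / 4 with hδ
  set R := (H : ℝ) * (2 * (H + 1)) + g with hR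
  set c₀ := δ ^ 2 / (4 * R ^ 2) with hc₀
  have hc₀pos : 0 < c₀ := by positivity
  set P : ℝ := (numPlans S A H : ℝ) with hP
  have hP0 : 0 ≤ P := Nat.cast_nonneg _
  set K₁ := 4 + P * (4 * Real.exp (1 / (c₀ / 4))) with hK₁
  set K₂ := 2 * H * (4 * KN + 16 * C + 5 * P * (8 * C + 3)) with hK₂
  -- The regret bound for the first phase fails with probability at most `N ^ (-ζ) ≤ T ^ (-α ζ)`,
  -- the concentration bounds with probability of order `1 / T`.
  set ζ' := min (α * ζ) 1 with hζ'
  have hζ'0 : 0 < ζ' := lt_min (by positivity) one_pos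
  have hK₁0 : 0 ≤ K₁ := by positivity
  have hK₂0 : 0 ≤ K₂ := by positivity
  refine ⟨K₁ + K₂ + (T₀ : ℝ) ^ ζ', ζ', 3, hζ'0, fun G hG T hT => ?_⟩
  set K := K₁ + K₂ + (T₀ : ℝ) ^ ζ' with hK
  have hT0K : 0 ≤ (T₀ : ℝ) ^ ζ' := Real.rpow_nonneg (Nat.cast_nonneg _) _
  have hT1 : (1 : ℝ) ≤ T := by exact_mod_cast (by omega : 1 ≤ T)
  have hT0 : (0 : ℝ) < T := by linarith
  -- For `T < T₀` the summand `T₀ ^ ζ'` of `K` makes the claimed probability nonpositive.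
  rcases Nat.lt_or_ge T T₀ with hlt | hge
  · have h1 : 1 ≤ K * (T : ℝ) ^ (-ζ') := by
      have h2 : (T : ℝ) ^ ζ' ≤ (T₀ : ℝ) ^ ζ' :=
        Real.rpow_le_rpow hT0.le (by exact_mod_cast hlt.le) hζ'0.le
      have h3 : 0 < (T : ℝ) ^ ζ' := Real.rpow_pos_of_pos hT0 _
      rw [Real.rpow_neg hT0.le, ← div_eq_mul_inv, le_div_iff₀ h3]
      linarith
    rw [ENNReal.ofReal_of_nonpos (by linarith)]
    exact zero_le
  obtain ⟨h4, hNT, hnum, hHε, hε, hex⟩ := hT₀ T hge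
  have hNα := rpow_le_phaseOneLen S A hH α hβ₀ (by omega : 1 ≤ T)
  have hTα : (1 : ℝ) ≤ (T : ℝ) ^ α := Real.one_le_rpow hT1 hα0.le
  have hN0 : 1 ≤ phaseOneLen S A H α β T := by exact_mod_cast hTα.trans hNα
  have key := le_prob_accurate M H α β T hH (by omega) hN0 hc.le hvis hgap
    (δ := δ) (R := R) (by positivity) (by rw [hR]; nlinarith [Nat.cast_nonneg (α := ℝ) H])
    (by linarith) hHε (by linarith) hnum G hG
  have hNle := hN T hT
  set N := phaseOneLen S A H α β T with hNdef
  have hlog := half_le_log hT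
  set x := Real.log T with hx
  have hE : (exploreLen S A H (T - N) : ℝ) ≤ P * (5 * x ^ 2) := by
    refine (exploreLen_le (by omega)).trans ?_
    have h1 : Real.log ((T - N : ℕ) : ℝ) ≤ x :=
      Real.log_le_log (by exact_mod_cast (by omega : 0 < T - N))
        (by exact_mod_cast Nat.sub_le T N)
    have h2 : 0 ≤ Real.log ((T - N : ℕ) : ℝ) := Real.log_natCast_nonneg _
    gcongr
  have hTκ : (1 : ℝ) ≤ (T : ℝ) ^ κ := Real.one_le_rpow hT1 hκ
  have hregret : 2 * H * (N + 2 * (C * (T : ℝ) ^ κ) + exploreLen S A H (T - N) *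
      (4 * (C * (T : ℝ) ^ κ) + x + 1)) ≤
      K * ((T : ℝ) ^ α * x ^ 3 + (T : ℝ) ^ γ * x ^ 3 + (T : ℝ) ^ κ * x ^ 3) := by
    refine (regret_bound_le hKN.le hC.le hP0 (Nat.cast_nonneg H) hTα hTκ
      (Real.rpow_nonneg hT0.le γ) hlog hNle hE).trans ?_
    gcongr
    linarith
  have hTz : ∀ z, ζ' ≤ z → (T : ℝ) ^ (-z) ≤ (T : ℝ) ^ (-ζ') := fun z hz =>
    Real.rpow_le_rpow_of_exponent_le hT1 (by linarith)
  have hinv : (T : ℝ)⁻¹ ≤ (T : ℝ) ^ (-ζ') := by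
    rw [← Real.rpow_neg_one]
    exact hTz 1 (min_le_right _ _)
  have p1 : (N : ℝ) ^ (-ζ) ≤ (T : ℝ) ^ (-ζ') := by
    calc (N : ℝ) ^ (-ζ) ≤ ((T : ℝ) ^ α) ^ (-ζ) :=
          Real.rpow_le_rpow_of_nonpos (by linarith) hNα (by linarith)
      _ = (T : ℝ) ^ (-(α * ζ)) := by rw [← Real.rpow_mul hT0.le]; ring_nf
      _ ≤ _ := hTz _ (min_le_left _ _)
  have p2 : (T : ℝ) ^ (-ζ) ≤ (T : ℝ) ^ (-ζ') := hTz ζ ((min_le_left _ _).trans (by nlinarith))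
  have p3 : Fintype.card (Fin H × S × A) * rounds H β T *
      (3 * Real.exp (-(c * batchLen α T / 12))) ≤ (T : ℝ)⁻¹ := by
    have hL1 : 1 ≤ batchLen α T := by exact_mod_cast hTα.trans (rpow_le_batchLen α T)
    -- There are no more batches than episodes of the first phase, so the union over all rounds
    -- costs a factor of at most `T`, against a failure probability exponentially small in `T ^ α`.
    have h1 : (Fintype.card (Fin H × S × A) * rounds H β T : ℝ) ≤ T := by
      have : Fintype.card (Fin H × S × A) * rounds H β T ≤ N := Nat.le_mul_of_pos_right _ hL1
      exact_mod_cast this.trans (by omega)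
    rw [← one_div, le_div_iff₀ hT0]
    calc _ ≤ (T : ℝ) * (3 * Real.exp (-(c * batchLen α T / 12))) * T := by gcongr
      _ = 3 * (T : ℝ) ^ 2 * Real.exp (-(c * batchLen α T / 12)) := by ring
      _ ≤ 1 := hex
  have p4 : Real.exp (-x) = (T : ℝ)⁻¹ := by rw [Real.exp_neg, hx, Real.exp_log hT0]
  have p5 : P * (2 * (1 + T) * Real.exp (-(c₀ * repeats (T - N)))) ≤
      P * (4 * Real.exp (1 / (c₀ / 4))) * (T : ℝ)⁻¹ := by
    have h1 := one_add_mul_exp_neg_log_sq_le (c := c₀ / 4) (by positivity) (by omega : 1 ≤ T)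
      (log_sq_le_four_mul_repeats h4 hNT)
    rw [show c₀ / 4 * (4 * (repeats (T - N) : ℝ)) = c₀ * repeats (T - N) by ring] at h1
    calc _ = P * (2 * ((1 + T) * Real.exp (-(c₀ * repeats (T - N))))) := by ring
      _ ≤ P * (2 * (2 * Real.exp (1 / (c₀ / 4)) * (T : ℝ)⁻¹)) := by gcongr
      _ = _ := by ring
  have n1 : (N : ℝ) ^ (-ζ) ≤ 1 :=
    Real.rpow_le_one_of_one_le_of_nonpos (by exact_mod_cast hN0) (by linarith)
  have n2 : (T : ℝ) ^ (-ζ) ≤ 1 := Real.rpow_le_one_of_one_le_of_nonpos hT1 (by linarith)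
  rw [← ENNReal.ofReal_add (by linarith) (by linarith), ← tsub_le_iff_right,
    ← ENNReal.ofReal_sub _ (by positivity)] at key
  refine (ENNReal.ofReal_le_ofReal ?_).trans (key.trans
    (M.prob_mono_support H _ G T fun ξ hist _ h => ⟨h.1, h.2.trans hregret⟩))
  rw [p4]
  have q1 : P * (4 * Real.exp (1 / (c₀ / 4))) * (T : ℝ)⁻¹ ≤
      P * (4 * Real.exp (1 / (c₀ / 4))) * (T : ℝ) ^ (-ζ') := by gcongr
  have q2 : K₁ * (T : ℝ) ^ (-ζ') ≤ K * (T : ℝ) ^ (-ζ') := by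
    gcongr
    linarith
  have q3 : K₁ * (T : ℝ) ^ (-ζ') = 4 * (T : ℝ) ^ (-ζ') +
      P * (4 * Real.exp (1 / (c₀ / 4))) * (T : ℝ) ^ (-ζ') := by rw [hK₁]; ring
  linarith

end TwoPhase

/-! ### Convergence in probability, and the theorem -/

/-- A high-probability bound of smaller order than `T` implies convergence in probability. -/
theorem tendsto_prob_welfareRegret {S A : Type*} [Fintype S] [Fintype A]
    (M : PrincipalAgentMDP S A) (H : ℕ) (alg : ℕ → PrincipalAlg S A) (G : Agent S A)
    {κ α γ K ζ' : ℝ} {p : ℕ} (hκ : κ < 1) (hα : α < 1) (hγ : γ < 1) (hζ' : 0 < ζ')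
    {E : ℕ → G.Seed → List (Episode S A) → Prop}
    (h : ∀ T : ℕ, 2 ≤ T → ENNReal.ofReal (1 - K * (T : ℝ) ^ (-ζ')) ≤
      M.prob H (alg T) G T fun ξ hist => E T ξ hist ∧ M.welfareRegret H (alg T) G T ξ hist ≤
        K * ((T : ℝ) ^ α * Real.log T ^ p + (T : ℝ) ^ γ * Real.log T ^ p +
          (T : ℝ) ^ κ * Real.log T ^ p)) {ε : ℝ} (hε : 0 < ε) :
    Tendsto (fun T : ℕ => M.prob H (alg T) G T fun ξ hist =>
      |M.welfareRegret H (alg T) G T ξ hist| ≤ ε * T) atTop (𝓝 1) := by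
  have hlim : Tendsto (fun T : ℕ => ENNReal.ofReal (1 - K * (T : ℝ) ^ (-ζ'))) atTop (𝓝 1) := by
    have h1 : Tendsto (fun T : ℕ => (T : ℝ) ^ (-ζ')) atTop (𝓝 0) :=
      (tendsto_rpow_neg_atTop hζ').comp tendsto_natCast_atTop_atTop
    have h2 := ENNReal.tendsto_ofReal ((h1.const_mul K).const_sub 1)
    simpa using h2
  -- Three terms share `ε`; `|K| + 1` is used since the sign of `K` is not known.
  have hε' : 0 < ε / (3 * (|K| + 1)) := by positivity
  refine tendsto_of_tendsto_of_tendsto_of_le_of_le' hlim tendsto_const_nhds ?_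
    (Eventually.of_forall fun T => M.prob_le_one H _ G T _)
  filter_upwards [eventually_ge_atTop 2, eventually_rpow_mul_log_pow_le hα hε' p,
    eventually_rpow_mul_log_pow_le hγ hε' p, eventually_rpow_mul_log_pow_le hκ hε' p]
    with T hT h1 h2 h3
  refine (h T hT).trans (M.prob_mono_support H _ G T fun ξ hist _ hE => ?_)
  rw [abs_of_nonneg (M.welfareRegret_nonneg H _ G T ξ hist)]
  refine hE.2.trans ?_
  have hl : 0 ≤ Real.log T := Real.log_natCast_nonneg T
  set X := (T : ℝ) ^ α * Real.log T ^ p + (T : ℝ) ^ γ * Real.log T ^ p +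
          (T : ℝ) ^ κ * Real.log T ^ p with hX
  have hX0 : 0 ≤ X := by positivity
  calc K * X ≤ (|K| + 1) * X := by
        gcongr
        linarith [le_abs_self K]
    _ ≤ (|K| + 1) * (3 * (ε / (3 * (|K| + 1)) * T)) := by
        gcongr
        linarith
    _ = ε * T := by field_simp

theorem theorem1 {S A : Type*} [Fintype S] [DecidableEq S] [Nonempty S]
    [Fintype A] [DecidableEq A] [Nonempty A] (H : ℕ) (κ α β γ : ℝ)
    (hκ : 0 ≤ κ) (hκα : κ < α) (hα : α < 1) (hβ₀ : 0 < β) (hβ₁ : β < 1)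
    (hβ : β / α < 1 - κ) (hγ₀ : 0 ≤ γ) (hγ₁ : γ < 1) :
    ∃ (B : RLAlg S A) (slack : ℝ≥0), B.HasRegretExponent H γ ∧
      ∀ M : PrincipalAgentMDP S A, M.UniformlyErgodic H → ∀ C ζ : ℝ, 0 < C → 0 < ζ →
        ∃ (K ζ' : ℝ) (p : ℕ), 0 < ζ' ∧
          ∀ G : Agent S A, M.HasAgentRegret H κ C ζ G →
            (∀ T : ℕ, 2 ≤ T →
              ENNReal.ofReal (1 - K * (T : ℝ) ^ (-ζ')) ≤
                M.prob H (TwoPhase.alg B slack H α β T) G T fun ξ hist =>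
                  (∀ h < H, ∀ s, M.Reachable h s → ∀ a,
                    |(TwoPhase.estimate H (TwoPhase.batchLen α T) (TwoPhase.rounds H β T)
                        (hist.map M.observe) h s a : ℝ) - M.minTransfer H h s a|
                      ≤ (T : ℝ) ^ (-β)) ∧
                  M.welfareRegret H (TwoPhase.alg B slack H α β T) G T ξ hist ≤
                    K * ((T : ℝ) ^ α * Real.log T ^ p + (T : ℝ) ^ γ * Real.log T ^ p +
                      (T : ℝ) ^ κ * Real.log T ^ p)) ∧
            (∀ ε : ℝ, 0 < ε → Tendsto (fun T : ℕ =>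
                M.prob H (TwoPhase.alg B slack H α β T) G T fun ξ hist =>
                  |M.welfareRegret H (TwoPhase.alg B slack H α β T) G T ξ hist| ≤ ε * T)
              atTop (𝓝 1)) := by
  refine ⟨RobustExplore.alg S A H, 1, RobustExplore.hasRegretExponent_alg H γ hγ₀,
    fun M hM C ζ hC hζ => ?_⟩
  obtain ⟨K, ζ', p, hζ', h⟩ :=
    TwoPhase.exists_le_prob H γ hκ hκα hα hβ₀ hβ M hM hC hζ
  exact ⟨K, ζ', p, hζ', fun G hG => ⟨h G hG, fun ε hε => tendsto_prob_welfareRegret M H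
    (fun T => TwoPhase.alg (RobustExplore.alg S A H) 1 H α β T) G (hκα.trans hα) hα hγ₁ hζ'
    (h G hG) hε⟩⟩
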